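/- Let $n\ge 1$ and let $(M^{2n+1},\varphi,\xi,\eta,g)$ be a connected smooth (Hausdorff, second countable) paracontact metric manifold: $\eta$ is a 1-form with $\eta\wedge(d\eta)^n\neq 0$ everywhere and Reeb vector field $\xi$ (that is, $\eta(\xi)=1$ and $d\eta(\xi,\cdot)=0$), $g$ is a semi-Riemannian metric and $\varphi$ a $(1,1)$-tensor field with $\eta=g(\xi,\cdot)$, $d\eta(\cdot,\cdot)=g(\cdot,\varphi\,\cdot)$ and $\varphi^2=I-\eta\otimes\xi$, where $2\,d\eta(X,Y)=X\eta(Y)-Y\eta(X)-\eta([X,Y])$. Let $\nabla$ be the Levi-Civita connection of $g$, $R(X,Y)=\nabla_{[X,Y]}-[\nabla_X,\nabla_Y]$ and $h=\tfrac12\mathcal L_\xi\varphi$. Assume that $M$ is a $(\kappa,\mu)$-space, i.e. for some smooth functions $\kappa,\mu$ on $M$, $$R(X,Y)\xi=\kappa\,(\eta(X)Y-\eta(Y)X)+\mu\,(\eta(X)hY-\eta(Y)hX)$$ for all vector fields $X,Y$. A vector field $V$ is an infinitesimal harmonic transformation, also called a $1$-harmonic vector field, if $\mathrm{tr}_g(\mathcal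 L_V\nabla)=0$. A vector field $V$ of constant squared length $g(V,V)=r\ne0$ is harmonic if it is a critical point of the energy $E_D(V)=\frac12\int_D \mathrm{tr}_g(V^*g^s)\,dv_g$ (where $g^s$ is the Sasaki metric on $TM$, so that $V^*g^s(u,w)=g(u,w)+g(\nabla_uV,\nabla_wV)$), for every relatively compact open $D\subseteq M$, with respect to smooth variations of $V$ that are supported in a compact subset of $D$ and run through vector fields of the same constant squared length $r$. Then: 1. $\xi$ is an infinitesimal harmonic transformation if and only if $\kappa=-1$ (identically on $M$). 2. If $\kappa$ is not identically $-1$, then $\xi$ is a harmonic vector field but is not $1$-harmonic. -/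

import Mathlib

open Bundle VectorField MeasureTheory
open scoped Manifold ContDiff

noncomputable section

/-- `X` is a smooth vector field on `M`. -/
def IsSmoothVectorField {E : Type*} [NormedAddCommGroup E] [NormedSpace ℝ E] {H : Type*}
    [TopologicalSpace H] (I : ModelWithCorners ℝ E H) {M : Type*} [TopologicalSpace M]
    [ChartedSpace H M] [IsManifold I ∞ M] (X : Π x : M, TangentSpace I x) : Prop :=
  ContMDiff I I.tangent ∞ (fun x ↦ (⟨x, X x⟩ : TangentBundle I M))

/-- A smooth semi-Riemannian metric on `M`: a smooth field of nondegenerate symmetric bilinear forms,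
of any signature, on the tangent spaces. -/
structure SemiRiemannianMetric {E : Type*} [NormedAddCommGroup E] [NormedSpace ℝ E] {H : Type*} [TopologicalSpace H]
  (I : ModelWithCorners ℝ E H) (M : Type*) [TopologicalSpace M] [ChartedSpace H M]
    [IsManifold I ∞ M] where
  inner (x : M) : TangentSpace I x →L[ℝ] TangentSpace I x →L[ℝ] ℝ
  symm (x : M) (v w : TangentSpace I x) : inner x v w = inner x w v
  nondegenerate (x : M) (v : TangentSpace I x) (hv : ∀ w, inner x v w = 0) : v = 0
  contMDiff : ContMDiff I
    (I.prod 𝓘(ℝ, E →L[ℝ] E →L[ℝ] ℝ)) ∞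
    (fun x ↦ TotalSpace.mk' (E →L[ℝ] E →L[ℝ] ℝ)
      (E := fun x : M ↦ TangentSpace I x →L[ℝ] TangentSpace I x →L[ℝ] ℝ) x (inner x))

namespace SemiRiemannianMetric

variable {E : Type*} [NormedAddCommGroup E] [NormedSpace ℝ E] {H : Type*} [TopologicalSpace H]
  {I : ModelWithCorners ℝ E H} {M : Type*} [TopologicalSpace M] [ChartedSpace H M]
  [IsManifold I ∞ M] (g : SemiRiemannianMetric I M)

lemma mdifferentiableAt_inner {X Y : Π x : M, TangentSpace I x} {x : M}
    (hX : MDiffAt (T% X) x) (hY : MDiffAt (T% Y) x) :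
    MDiffAt (fun y ↦ g.inner y (X y) (Y y)) x := by
  have h : MDifferentiableAt I (I.prod 𝓘(ℝ, ℝ))
      (fun y ↦ TotalSpace.mk' ℝ (E := Bundle.Trivial M ℝ) y (g.inner y (X y) (Y y))) x :=
    MDifferentiableAt.clm_bundle_apply₂ (F₁ := E)
      (F₂ := E) ((g.contMDiff x).mdifferentiableAt (by simp)) hX hY
  simp only [mdifferentiableAt_totalSpace] at h
  exact h.2

/-- The right-hand side of the Koszul formula
`2 g(∇_X Y, Z) = X g(Y, Z) + Y g(Z, X) - Z g(X, Y) + g([X, Y], Z) - g([X, Z], Y) - g([Y, Z], X)`. -/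
def koszul (X Y Z : Π x : M, TangentSpace I x) (x : M) : ℝ :=
  d% (fun y ↦ g.inner y (Y y) (Z y)) x (X x) + d% (fun y ↦ g.inner y (Z y) (X y)) x (Y x)
    - d% (fun y ↦ g.inner y (X y) (Y y)) x (Z x)
    + g.inner x (mlieBracket I X Y x) (Z x) - g.inner x (mlieBracket I X Z x) (Y x)
    - g.inner x (mlieBracket I Y Z x) (X x)

lemma eq_of_forall_inner {x : M} {v v' : TangentSpace I x}
    (h : ∀ Z : Π x : M, TangentSpace I x, MDiffAt (T% Z) x →
      g.inner x v (Z x) = g.inner x v' (Z x)) : v = v' := by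
  refine sub_eq_zero.1 (g.nondegenerate x _ fun w ↦ ?_)
  have := h (FiberBundle.extend E w) (FiberBundle.mdifferentiableAt_extend ..)
  rw [FiberBundle.extend_apply_self] at this
  simp [this]

/-- The isomorphism `v ↦ g(v, ·)` from a tangent space to its dual. -/
def flat [FiniteDimensional ℝ E] (x : M) : TangentSpace I x ≃ₗ[ℝ] (TangentSpace I x →L[ℝ] ℝ) :=
  haveI : FiniteDimensional ℝ (TangentSpace I x) := inferInstanceAs (FiniteDimensional ℝ E)
  haveI : FiniteDimensional ℝ (TangentSpace I x →L[ℝ] ℝ) :=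
    Module.Finite.equiv (LinearMap.toContinuousLinearMap (𝕜 := ℝ) (E := E) (F' := ℝ))
  LinearEquiv.ofInjectiveOfFinrankEq (g.inner x).toLinearMap
    ((injective_iff_map_eq_zero _).2 fun v hv ↦
      g.nondegenerate x v fun w ↦ congrArg (fun f : TangentSpace I x →L[ℝ] ℝ ↦ f w) hv)
    (Subspace.dual_finrank_eq.symm.trans
      (LinearMap.toContinuousLinearMap (𝕜 := ℝ) (E := E) (F' := ℝ)).finrank_eq)

lemma flat_apply [FiniteDimensional ℝ E] (x : M) (v w : TangentSpace I x) : g.flat x v w = g.inner x v w := rfl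

variable [CompleteSpace E]

variable {g} in
lemma tensorialAt_koszul_left {Y Z : Π x : M, TangentSpace I x} {x : M}
    (hY : MDiffAt (T% Y) x) (hZ : MDiffAt (T% Z) x) :
    TensorialAt I E (g.koszul · Y Z x) x where
  smul {f X} hf hX := by
    have h1 := mvfderiv_fun_mul hf (g.mdifferentiableAt_inner hZ hX)
    have h2 := mvfderiv_fun_mul hf (g.mdifferentiableAt_inner hX hY)
    simp only [koszul, Pi.smul_apply', map_smul, smul_eq_mul, _root_.smul_apply,
      mlieBracket_smul_left hf hX, h1, h2, map_add, _root_.add_apply]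
    rw [g.symm x (X x) (Z x), g.symm x (X x) (Y x)]
    ring
  add {X X'} hX hX' := by
    have h1 := mvfderiv_fun_add (g.mdifferentiableAt_inner hZ hX) (g.mdifferentiableAt_inner hZ hX')
    have h2 := mvfderiv_fun_add (g.mdifferentiableAt_inner hX hY) (g.mdifferentiableAt_inner hX' hY)
    simp only [koszul, Pi.add_apply, map_add, _root_.add_apply, h1, h2,
      mlieBracket_add_left hX hX']
    ring

variable {g} in
lemma tensorialAt_koszul_right {X Y : Π x : M, TangentSpace I x} {x : M}
    (hX : MDiffAt (T% X) x) (hY : MDiffAt (T% Y) x) :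
    TensorialAt I E (g.koszul X Y · x) x where
  smul {f Z} hf hZ := by
    have h1 := mvfderiv_fun_mul hf (g.mdifferentiableAt_inner hY hZ)
    have h2 := mvfderiv_fun_mul hf (g.mdifferentiableAt_inner hZ hX)
    simp only [koszul, Pi.smul_apply', map_smul, smul_eq_mul, _root_.smul_apply,
      mlieBracket_smul_right hf hZ, h1, h2, map_add, _root_.add_apply]
    rw [g.symm x (Z x) (X x), g.symm x (Z x) (Y x)]
    ring
  add {Z Z'} hZ hZ' := by
    have h1 := mvfderiv_fun_add (g.mdifferentiableAt_inner hY hZ) (g.mdifferentiableAt_inner hY hZ')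
    have h2 := mvfderiv_fun_add (g.mdifferentiableAt_inner hZ hX) (g.mdifferentiableAt_inner hZ' hX)
    simp only [koszul, Pi.add_apply, map_add, _root_.add_apply, h1, h2,
      mlieBracket_add_right hZ hZ']
    ring

variable [FiniteDimensional ℝ E]

/-- The bilinear form `(u, w) ↦ 2 g(∇_u Y, w)` on the tangent space at `x`. -/
def koszulHom {Y : Π x : M, TangentSpace I x} {x : M} (hY : MDiffAt (T% Y) x) :
    TangentSpace I x →L[ℝ] TangentSpace I x →L[ℝ] ℝ :=
  TensorialAt.mkHom₂ (fun X Z ↦ g.koszul X Y Z x) x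
    (fun _ hZ ↦ tensorialAt_koszul_left hY hZ) (fun _ hX ↦ tensorialAt_koszul_right hX hY)

open Classical in
/-- The Levi-Civita connection as a bare function: `∇Y` at `x` is the endomorphism `u ↦ ∇_u Y` of
the tangent space determined by the Koszul formula (and zero if `Y` is not differentiable). -/
def leviCivitaFun (Y : Π x : M, TangentSpace I x) (x : M) :
    TangentSpace I x →L[ℝ] TangentSpace I x :=
  if hY : MDiffAt (T% Y) x then
    haveI : FiniteDimensional ℝ (TangentSpace I x) := inferInstanceAs (FiniteDimensional ℝ E)
    haveI : T2Space (TangentSpace I x) := inferInstanceAs (T2Space E)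
    LinearMap.toContinuousLinearMap
      ((2⁻¹ : ℝ) • ((g.flat x).symm.toLinearMap ∘ₗ (g.koszulHom hY).toLinearMap))
  else 0

/-- The Koszul formula. -/
lemma two_mul_inner_leviCivitaFun {X Y Z : Π x : M, TangentSpace I x} {x : M}
    (hX : MDiffAt (T% X) x) (hY : MDiffAt (T% Y) x) (hZ : MDiffAt (T% Z) x) :
    2 * g.inner x (g.leviCivitaFun Y x (X x)) (Z x) = g.koszul X Y Z x := by
  have h : g.leviCivitaFun Y x (X x) = (2⁻¹ : ℝ) • (g.flat x).symm (g.koszulHom hY (X x)) := by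
    rw [leviCivitaFun, dif_pos hY]; rfl
  rw [← g.flat_apply, h, map_smul, LinearEquiv.apply_symm_apply, _root_.smul_apply, smul_eq_mul,
    mul_inv_cancel_left₀ two_ne_zero]
  exact TensorialAt.mkHom₂_apply (Φ := fun X Z ↦ g.koszul X Y Z x) _ _ hX hZ

/-- The Levi-Civita connection of a semi-Riemannian metric, defined by the Koszul formula;
`∇_X Y` at `x` is `g.leviCivita Y x (X x)`. -/
def leviCivita : CovariantDerivative I E (TangentSpace I : M → Type _) where
  toFun := g.leviCivitaFun
  isCovariantDerivativeOnUniv :=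
  { add := by
      intro Y Y' x hY hY' _
      ext1 u
      obtain ⟨X, hX, rfl⟩ : ∃ X : Π x : M, TangentSpace I x, MDiffAt (T% X) x ∧ X x = u :=
        ⟨FiberBundle.extend E u, FiberBundle.mdifferentiableAt_extend .., by simp⟩
      refine g.eq_of_forall_inner fun Z hZ ↦ ?_
      have hYY : MDiffAt (T% (Y + Y')) x := mdifferentiableAt_add_section hY hY'
      have h := g.two_mul_inner_leviCivitaFun hX hYY hZ
      have h1 := g.two_mul_inner_leviCivitaFun hX hY hZ
      have h2 := g.two_mul_inner_leviCivitaFun hX hY' hZ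
      have e1 := mvfderiv_fun_add (g.mdifferentiableAt_inner hY hZ)
        (g.mdifferentiableAt_inner hY' hZ)
      have e2 := mvfderiv_fun_add (g.mdifferentiableAt_inner hX hY)
        (g.mdifferentiableAt_inner hX hY')
      simp only [koszul, Pi.add_apply, map_add, _root_.add_apply, e1, e2,
        mlieBracket_add_left hY hY', mlieBracket_add_right hY hY'] at h h1 h2 ⊢
      linarith
    leibniz := by
      intro Y f x hY hf _
      ext1 u
      obtain ⟨X, hX, rfl⟩ : ∃ X : Π x : M, TangentSpace I x, MDiffAt (T% X) x ∧ X x = u :=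
        ⟨FiberBundle.extend E u, FiberBundle.mdifferentiableAt_extend .., by simp⟩
      refine g.eq_of_forall_inner fun Z hZ ↦ ?_
      have hfY : MDiffAt (T% (f • Y)) x := hf.smul_section hY
      have h := g.two_mul_inner_leviCivitaFun hX hfY hZ
      have h1 := g.two_mul_inner_leviCivitaFun hX hY hZ
      have e1 := mvfderiv_fun_mul hf (g.mdifferentiableAt_inner hY hZ)
      have e2 := mvfderiv_fun_mul hf (g.mdifferentiableAt_inner hX hY)
      simp only [koszul, Pi.smul_apply', map_smul, smul_eq_mul, _root_.smul_apply,
        mlieBracket_smul_left hf hY, mlieBracket_smul_right hf hY, e1, e2, map_add,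
        _root_.add_apply, ContinuousLinearMap.smulRight_apply] at h h1 ⊢
      rw [g.symm x (Y x) (X x)] at h
      linear_combination (h - f x * h1) / 2 }

lemma two_mul_inner_leviCivita {X Y Z : Π x : M, TangentSpace I x} {x : M}
    (hX : MDiffAt (T% X) x) (hY : MDiffAt (T% Y) x) (hZ : MDiffAt (T% Z) x) :
    2 * g.inner x (g.leviCivita Y x (X x)) (Z x) = g.koszul X Y Z x :=
  g.two_mul_inner_leviCivitaFun hX hY hZ

/-- The Levi-Civita connection is torsion-free. -/
lemma torsion_leviCivita : g.leviCivita.torsion = 0 := by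
  rw [CovariantDerivative.torsion_eq_zero_iff]
  intro X Y x hX hY
  refine g.eq_of_forall_inner fun Z hZ ↦ ?_
  have h1 := g.two_mul_inner_leviCivita hX hY hZ
  have h2 := g.two_mul_inner_leviCivita hY hX hZ
  simp only [koszul, mlieBracket_swap_apply (V := Y) (W := X)] at h1 h2
  simp only [map_sub, _root_.sub_apply, map_neg, _root_.neg_apply, g.symm _ (X _) (Y _),
    g.symm _ (Z _) (Y _), g.symm _ (Z _) (X _)] at h1 h2 ⊢
  linarith

/-- The Levi-Civita connection is compatible with the metric. -/
lemma mvfderiv_inner {X Y Z : Π x : M, TangentSpace I x} {x : M}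
    (hX : MDiffAt (T% X) x) (hY : MDiffAt (T% Y) x) (hZ : MDiffAt (T% Z) x) :
    d% (fun y ↦ g.inner y (Y y) (Z y)) x (X x) =
      g.inner x (g.leviCivita Y x (X x)) (Z x) + g.inner x (Y x) (g.leviCivita Z x (X x)) := by
  have h1 := g.two_mul_inner_leviCivita hX hY hZ
  have h2 := g.two_mul_inner_leviCivita hX hZ hY
  rw [g.symm x (Y x)]
  simp only [koszul, mlieBracket_swap_apply (V := Z) (W := Y)] at h1 h2
  simp only [map_neg, _root_.neg_apply, g.symm _ (X _) (Y _), g.symm _ (Z _) (Y _),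
    g.symm _ (Z _) (X _)] at h1 h2 ⊢
  linarith

/-- The curvature tensor with the sign convention `R(X, Y) = ∇_[X, Y] - [∇_X, ∇_Y]`. -/
def curvature (X Y Z : Π x : M, TangentSpace I x) (x : M) : TangentSpace I x :=
  g.leviCivita Z x (mlieBracket I X Y x)
    - (g.leviCivita (fun y ↦ g.leviCivita Z y (Y y)) x (X x)
      - g.leviCivita (fun y ↦ g.leviCivita Z y (X y)) x (Y x))

/-- The Lie derivative of the Levi-Civita connection along `V`:
`(L_V ∇)(X, Y) = [V, ∇_X Y] - ∇_[V, X] Y - ∇_X [V, Y]`, a tensor in `X` and `Y`. -/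
def lieDerivConnection (V X Y : Π x : M, TangentSpace I x) (x : M) : TangentSpace I x :=
  mlieBracket I V (fun y ↦ g.leviCivita Y y (X y)) x
    - g.leviCivita Y x (mlieBracket I V X x)
    - g.leviCivita (fun y ↦ mlieBracket I V Y y) x (X x)

/-- Some basis of the tangent space at `x`. -/
def tangentBasis (I : ModelWithCorners ℝ E H) (x : M) :
    Module.Basis (Fin (Module.finrank ℝ E)) ℝ (TangentSpace I x) :=
  Module.finBasis ℝ E

/-- The metric trace `∑ᵢⱼ gⁱʲ B(eᵢ, eⱼ)` of a bilinear map `B` on the tangent space at `x`, where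
`(eᵢ)` is a basis and `(gⁱʲ)` is the inverse of its Gram matrix. It does not depend on the basis;
in a pseudo-orthonormal basis it reads `∑ᵢ εᵢ B(eᵢ, eᵢ)` with `εᵢ = g(eᵢ, eᵢ) = ±1`. -/
def metricTrace (x : M) {A : Type*} [AddCommGroup A] [Module ℝ A]
    (B : TangentSpace I x → TangentSpace I x → A) : A :=
  ∑ i, ∑ j, (Matrix.of fun k l ↦ g.inner x (tangentBasis I x k) (tangentBasis I x l))⁻¹ i j •
    B (tangentBasis I x i) (tangentBasis I x j)

/-- `V` is an infinitesimal harmonic transformation: `tr (L_V ∇) = 0`. -/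
def IsInfinitesimalHarmonicTransformation (V : Π x : M, TangentSpace I x) : Prop :=
  ∀ x : M, g.metricTrace x (fun u w ↦
    g.lieDerivConnection V (FiberBundle.extend E u) (FiberBundle.extend E w) x) = 0

/-- `1`-harmonic vector field is another name for an infinitesimal harmonic transformation. -/
def IsOneHarmonic (V : Π x : M, TangentSpace I x) : Prop :=
  g.IsInfinitesimalHarmonicTransformation V

/-- The energy density `½ tr_g (V^* gˢ)` of `V : (M, g) → (TM, gˢ)`, where `gˢ` is the Sasaki metric:
`(V^* gˢ)(u, w) = g(u, w) + g(∇_u V, ∇_w V)`. -/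
def energyDensity (V : Π x : M, TangentSpace I x) (x : M) : ℝ :=
  2⁻¹ * g.metricTrace x (fun u w ↦
    g.inner x u w + g.inner x (g.leviCivita V x u) (g.leviCivita V x w))

end SemiRiemannianMetric

namespace SemiRiemannianMetric

variable {m : ℕ} {M : Type*} [TopologicalSpace M] [ChartedSpace (EuclideanSpace ℝ (Fin m)) M]
  [IsManifold (𝓡 m) ∞ M] (g : SemiRiemannianMetric (𝓡 m) M)

/-- The Gram matrix of the coordinate vector fields of the chart `chartAt p`, as a function of the
coordinates `y`. -/
def chartGram (p : M) (y : EuclideanSpace ℝ (Fin m)) : Matrix (Fin m) (Fin m) ℝ :=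
  Matrix.of fun i j ↦
    g.inner ((chartAt (EuclideanSpace ℝ (Fin m)) p).symm y)
      (mfderiv (𝓡 m) (𝓡 m) (chartAt (EuclideanSpace ℝ (Fin m)) p).symm y
        (EuclideanSpace.basisFun (Fin m) ℝ i))
      (mfderiv (𝓡 m) (𝓡 m) (chartAt (EuclideanSpace ℝ (Fin m)) p).symm y
        (EuclideanSpace.basisFun (Fin m) ℝ j))

/-- The measure `√|det (gᵢⱼ)| dy¹ ⋯ dyᵐ` on the domain of the chart `chartAt p`. -/
def chartVolume [MeasurableSpace M] (p : M) : Measure M :=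
  ((volume.restrict (chartAt (EuclideanSpace ℝ (Fin m)) p).target).withDensity
    (fun y ↦ ENNReal.ofReal √|(g.chartGram p y).det|)).map
      (chartAt (EuclideanSpace ℝ (Fin m)) p).symm

/-- Countably many chart domains cover `M`. -/
lemma exists_chart_sequence (m : ℕ) (M : Type*) [TopologicalSpace M]
    [ChartedSpace (EuclideanSpace ℝ (Fin m)) M] [Nonempty M] [SecondCountableTopology M] :
    ∃ c : ℕ → M, ⋃ k, (chartAt (EuclideanSpace ℝ (Fin m)) (c k)).source = Set.univ := by
  obtain ⟨s, hs, hs'⟩ := TopologicalSpace.countable_cover_nhds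
    (fun x : M ↦ chart_source_mem_nhds (EuclideanSpace ℝ (Fin m)) x)
  have hne : s.Nonempty := by
    rcases s.eq_empty_or_nonempty with rfl | h
    · simp at hs'
      exact absurd hs' Set.empty_ne_univ
    · exact h
  obtain ⟨c, rfl⟩ := hs.exists_eq_range hne
  exact ⟨c, by simpa using hs'⟩

/-- The semi-Riemannian volume measure, `√|det (gᵢⱼ)| dy¹ ⋯ dyᵐ` in every chart. It is glued from
countably many chart domains made disjoint; the result does not depend on their choice. -/
def volumeMeasure [Nonempty M] [SecondCountableTopology M] [MeasurableSpace M] : Measure M :=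
  Measure.sum fun k ↦ (g.chartVolume ((exists_chart_sequence m M).choose k)).restrict
    (disjointed (fun l ↦ (chartAt (EuclideanSpace ℝ (Fin m))
      ((exists_chart_sequence m M).choose l)).source) k)

variable [Nonempty M] [SecondCountableTopology M] [MeasurableSpace M]

/-- The energy over `D` of the map `V : (M, g) → (TM, gˢ)`. -/
def energy (D : Set M) (V : Π x : M, TangentSpace (𝓡 m) x) : ℝ :=
  ∫ x in D, g.energyDensity V x ∂g.volumeMeasure

/-- `U` is a smooth variation of `V`, supported in a compact subset of `D`, through vector fields of
constant squared length `r`. -/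
structure IsVariation (r : ℝ) (D : Set M) (V : Π x : M, TangentSpace (𝓡 m) x)
    (U : ℝ → Π x : M, TangentSpace (𝓡 m) x) : Prop where
  contMDiff : ContMDiff (𝓘(ℝ, ℝ).prod (𝓡 m)) (𝓡 m).tangent ∞
    (fun p : ℝ × M ↦ (⟨p.2, U p.1 p.2⟩ : TangentBundle (𝓡 m) M))
  inner_self (t : ℝ) (x : M) : g.inner x (U t x) (U t x) = r
  zero : U 0 = V
  support : ∃ K : Set M, IsCompact K ∧ K ⊆ D ∧ ∀ t, ∀ x ∉ K, U t x = V x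

/-- `V` is a harmonic vector field: it is smooth, of constant squared length `r ≠ 0`, and a critical
point of the energy functional among the vector fields of the same length (over every relatively
compact domain `D` of `M`). -/
def IsHarmonicVectorField (V : Π x : M, TangentSpace (𝓡 m) x) : Prop :=
  IsSmoothVectorField (𝓡 m) V ∧ ∃ r : ℝ, r ≠ 0 ∧ (∀ x, g.inner x (V x) (V x) = r) ∧
    ∀ D : Set M, IsOpen D → IsCompact (closure D) →
      ∀ U : ℝ → Π x : M, TangentSpace (𝓡 m) x, g.IsVariation r D V U →
        HasDerivAt (fun t ↦ g.energy D (U t)) 0 0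

end SemiRiemannianMetric

section Forms

variable {E : Type*} [NormedAddCommGroup E] [NormedSpace ℝ E] {H : Type*} [TopologicalSpace H]
  {I : ModelWithCorners ℝ E H} {M : Type*} [TopologicalSpace M] [ChartedSpace H M]
  [IsManifold I ∞ M]

/-- The exterior derivative of a `1`-form, with the normalization
`dη(X, Y) = ½ (X η(Y) - Y η(X) - η([X, Y]))`. -/
def extDerivOneForm (η : Π x : M, TangentSpace I x →L[ℝ] ℝ)
    (X Y : Π x : M, TangentSpace I x) (x : M) : ℝ :=
  2⁻¹ * (d% (fun y ↦ η y (Y y)) x (X x) - d% (fun y ↦ η y (X y)) x (Y x)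
    - η x (mlieBracket I X Y x))

/-- `η` is a contact form on a `(2n+1)`-dimensional manifold: `η ∧ (dη)ⁿ` vanishes nowhere. The sum
is, up to a nonzero constant factor, the value of `η ∧ (dη)ⁿ` on `v₀, …, v₂ₙ`. -/
def IsContactForm (n : ℕ) (η : Π x : M, TangentSpace I x →L[ℝ] ℝ) : Prop :=
  ∀ x : M, ∃ v : Fin (2 * n + 1) → Π x : M, TangentSpace I x, (∀ i, IsSmoothVectorField I (v i)) ∧
    ∑ σ : Equiv.Perm (Fin (2 * n + 1)), ((Equiv.Perm.sign σ : ℤ) : ℝ) *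
      (η x (v (σ 0) x) * ∏ i : Fin n, extDerivOneForm η
        (v (σ ⟨2 * i + 1, by omega⟩)) (v (σ ⟨2 * i + 2, by omega⟩)) x) ≠ 0

end Forms

/-- A paracontact metric structure `(φ, ξ, η, g)` on a `(2n+1)`-dimensional manifold: a contact form
`η` with Reeb vector field `ξ`, a semi-Riemannian metric `g` and a `(1,1)`-tensor field `φ` with
`η = g(ξ, ·)`, `dη = g(·, φ ·)` and `φ² = I - η ⊗ ξ`. -/
structure ParacontactMetricStructure (n : ℕ) (M : Type*) [TopologicalSpace M]
    [ChartedSpace (EuclideanSpace ℝ (Fin (2 * n + 1))) M]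
    [IsManifold (𝓡 (2 * n + 1)) ∞ M] where
  φ (x : M) : TangentSpace (𝓡 (2 * n + 1)) x →L[ℝ] TangentSpace (𝓡 (2 * n + 1)) x
  ξ (x : M) : TangentSpace (𝓡 (2 * n + 1)) x
  η (x : M) : TangentSpace (𝓡 (2 * n + 1)) x →L[ℝ] ℝ
  g : SemiRiemannianMetric (𝓡 (2 * n + 1)) M
  contMDiff_φ : ContMDiff (𝓡 (2 * n + 1)) ((𝓡 (2 * n + 1)).prod
      𝓘(ℝ, EuclideanSpace ℝ (Fin (2 * n + 1)) →L[ℝ] EuclideanSpace ℝ (Fin (2 * n + 1)))) ∞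
    (fun x ↦ TotalSpace.mk'
      (EuclideanSpace ℝ (Fin (2 * n + 1)) →L[ℝ] EuclideanSpace ℝ (Fin (2 * n + 1)))
      (E := fun x : M ↦ TangentSpace (𝓡 (2 * n + 1)) x →L[ℝ] TangentSpace (𝓡 (2 * n + 1)) x)
      x (φ x))
  contMDiff_ξ : IsSmoothVectorField (𝓡 (2 * n + 1)) ξ
  contMDiff_η : ContMDiff (𝓡 (2 * n + 1)) ((𝓡 (2 * n + 1)).prod
      𝓘(ℝ, EuclideanSpace ℝ (Fin (2 * n + 1)) →L[ℝ] ℝ)) ∞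
    (fun x ↦ TotalSpace.mk' (EuclideanSpace ℝ (Fin (2 * n + 1)) →L[ℝ] ℝ)
      (E := fun x : M ↦ TangentSpace (𝓡 (2 * n + 1)) x →L[ℝ] ℝ) x (η x))
  isContactForm : IsContactForm n η
  η_ξ (x : M) : η x (ξ x) = 1
  dη_ξ (X : Π x : M, TangentSpace (𝓡 (2 * n + 1)) x)
    (hX : IsSmoothVectorField (𝓡 (2 * n + 1)) X) (x : M) :
    extDerivOneForm η ξ X x = 0
  η_eq (x : M) (v : TangentSpace (𝓡 (2 * n + 1)) x) : η x v = g.inner x (ξ x) v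
  dη_eq (X Y : Π x : M, TangentSpace (𝓡 (2 * n + 1)) x)
    (hX : IsSmoothVectorField (𝓡 (2 * n + 1)) X)
    (hY : IsSmoothVectorField (𝓡 (2 * n + 1)) Y) (x : M) :
    extDerivOneForm η X Y x = g.inner x (X x) (φ x (Y x))
  φ_φ (x : M) (v : TangentSpace (𝓡 (2 * n + 1)) x) : φ x (φ x v) = v - η x v • ξ x

namespace ParacontactMetricStructure

variable {n : ℕ} {M : Type*} [TopologicalSpace M]
  [ChartedSpace (EuclideanSpace ℝ (Fin (2 * n + 1))) M] [IsManifold (𝓡 (2 * n + 1)) ∞ M]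
  (S : ParacontactMetricStructure n M)

/-- The tensor `h = ½ L_ξ φ`, that is `h X = ½ ([ξ, φ X] - φ [ξ, X])`. -/
def h (X : Π x : M, TangentSpace (𝓡 (2 * n + 1)) x) (x : M) : TangentSpace (𝓡 (2 * n + 1)) x :=
  (2⁻¹ : ℝ) • (mlieBracket (𝓡 (2 * n + 1)) S.ξ (fun y ↦ S.φ y (X y)) x
    - S.φ x (mlieBracket (𝓡 (2 * n + 1)) S.ξ X x))

/-- `M` is a `(κ, μ)`-space, with smooth functions `κ` and `μ`:
`R(X, Y)ξ = κ (η(X) Y - η(Y) X) + μ (η(X) h Y - η(Y) h X)` for all vector fields `X`, `Y`. -/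
structure IsKappaMuSpace (κ μ : M → ℝ) : Prop where
  contMDiff_κ : ContMDiff (𝓡 (2 * n + 1)) 𝓘(ℝ, ℝ) ∞ κ
  contMDiff_μ : ContMDiff (𝓡 (2 * n + 1)) 𝓘(ℝ, ℝ) ∞ μ
  curvature_ξ (X Y : Π x : M, TangentSpace (𝓡 (2 * n + 1)) x)
    (hX : IsSmoothVectorField (𝓡 (2 * n + 1)) X)
    (hY : IsSmoothVectorField (𝓡 (2 * n + 1)) Y) (x : M) :
    S.g.curvature X Y S.ξ x =
      κ x • (S.η x (X x) • Y x - S.η x (Y x) • X x)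
        + μ x • (S.η x (X x) • S.h Y x - S.η x (Y x) • S.h X x)

end ParacontactMetricStructure

end

/-! Write P = ∇ξ, and let traces be taken over a pair of dual bases eᵢ, eⁱ, since g may be
indefinite. Both claims rest on one computation: the rough Laplacian tr ∇²ξ equals (2nκ + 4n)ξ.

The condition dη = g(·, φ·) says that the adjoint of P is P + 2φ, hence g((∇_u P)v, w) = g((∇_u P)w,
v) + 2g((∇_u φ)w, v). Tracing over u and v expresses g(tr ∇²ξ, w) by two traces. For the first, the
Ricci identity (∇_u P)v - (∇_v P)u = -R(u, v)ξ and tr ∇_w P = w(tr P) = 0 leave minus the trace of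
R(·, w)ξ. By the (κ, μ)-condition this is 2nκ η(w): the function μ drops out because tr h = 0 and η
∘ h = 0. The second involves the divergence of φ and equals 2n η(w). It follows from the derivative
of φ² = I - η ⊗ ξ, the cyclic identity for ∇φ (that is, closedness of dη) and tr φP = -2n. The same
argument yields tr P = 0. This algebra takes place at one point, in `ParacontactPoint`; its outcome
is `sum_N`.

Infinitesimal harmonicity: (L_ξ ∇)(X, Y) = -R(ξ, X)Y + (∇_X P)Y. Pair symmetry of the curvature
turns the trace of the first term into the trace of R(·, w)ξ again, so tr L_ξ ∇ = 4n(1 + κ)ξ, which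
vanishes exactly where κ = -1.

Harmonicity: a variation through fields of constant length has velocity W orthogonal to ξ, and the
first variation of the energy density is ∑ g(∇_{eᵢ} W, P eⁱ) = div((P + 2φ)W) - g(tr ∇²ξ, W). The
last term vanishes because the Laplacian is a multiple of ξ, whatever κ is. The divergence theorem
for compactly supported fields finishes the argument. It is derived here from the chart formula
√|det G| div Z = ∑ ∂ᵢ(√|det G| Zⁱ) and a partition of unity. -/

noncomputable section

set_option linter.unusedSectionVars false

/-! ### Smooth vector fields and extensions of tangent vectors -/

section SmoothFields

variable {E : Type*} [NormedAddCommGroup E] [NormedSpace ℝ E] {H : Type*} [TopologicalSpace H]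
  {I : ModelWithCorners ℝ E H} {M : Type*} [TopologicalSpace M] [ChartedSpace H M]
  [IsManifold I ∞ M] {X Y Z : Π x : M, TangentSpace I x} {f : M → ℝ}

namespace IsSmoothVectorField

lemma contMDiffAt (hX : IsSmoothVectorField I X) {k : ℕ∞} (x : M) :
    CMDiffAt k (T% X) x :=
  (ContMDiff.contMDiffAt hX).of_le (by exact_mod_cast le_top)

lemma mdifferentiableAt (hX : IsSmoothVectorField I X) (x : M) : MDiffAt (T% X) x :=
  (hX.contMDiffAt (k := 1) x).mdifferentiableAt (by simp)

lemma add (hX : IsSmoothVectorField I X) (hY : IsSmoothVectorField I Y) :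
    IsSmoothVectorField I (X + Y) :=
  ContMDiff.add_section hX hY

lemma smul (hf : CMDiff ∞ f) (hX : IsSmoothVectorField I X) : IsSmoothVectorField I (f • X) :=
  ContMDiff.smul_section hf hX

lemma const_smul (a : ℝ) (hX : IsSmoothVectorField I X) : IsSmoothVectorField I (a • X) :=
  ContMDiff.const_smul_section hX

lemma mlieBracket [CompleteSpace E] (hX : IsSmoothVectorField I X)
    (hY : IsSmoothVectorField I Y) : IsSmoothVectorField I (mlieBracket I X Y) := by
  have : IsManifold I (((⊤ : ℕ∞) : ℕ∞ω) + 1) M := inferInstanceAs (IsManifold I ∞ M)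
  have : IsManifold I (minSmoothness ℝ 2) M := by
    rw [minSmoothness_of_isRCLikeNormedField]; infer_instance
  exact ContDiff.mlieBracket_vectorField (m := (⊤ : ℕ∞)) (n := (⊤ : ℕ∞)) hX hY (by simp)

/-- The derivative of a smooth function along a smooth vector field is smooth. -/
lemma contMDiff_mvfderiv (hX : IsSmoothVectorField I X) (hf : CMDiff ∞ f) :
    CMDiff ∞ (fun x ↦ d% f x (X x)) := by
  have h : CMDiff ∞ (tangentMap I 𝓘(ℝ, ℝ) f) := hf.contMDiff_tangentMap (by simp)
  have h2 := h.comp hX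
  exact (contMDiff_snd_tangentBundle_modelSpace ℝ 𝓘(ℝ, ℝ)).comp h2

end IsSmoothVectorField

variable [FiniteDimensional ℝ E] [T2Space M]

/-- Every tangent vector extends to a smooth vector field, and locally the extension may be
prescribed to be `FiberBundle.extend`. -/
lemma exists_isSmoothVectorField_eventuallyEq_extend {x : M} (v : TangentSpace I x) :
    ∃ X : Π y : M, TangentSpace I y, IsSmoothVectorField I X ∧
      ∀ᶠ y in nhds x, X y = FiberBundle.extend E v y := by
  obtain ⟨s, hs, hsv⟩ := FiberBundle.exists_contMDiffOn_extend (k := ∞) I E v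
  obtain ⟨u, hus, hu, hxu⟩ := mem_nhds_iff.1 hs
  obtain ⟨ψ, -, hψ⟩ := (SmoothBumpFunction.nhds_basis_tsupport (I := I) x).mem_iff.1
    (hu.mem_nhds hxu)
  refine ⟨(ψ : M → ℝ) • FiberBundle.extend E v, ?_, ?_⟩
  · exact ContMDiffOn.smul_section_of_tsupport ψ.contMDiff.contMDiffOn hu hψ (hsv.mono hus)
  · filter_upwards [ψ.eventuallyEq_one] with y hy
    simp [hy]

/-- A smooth vector field extending a tangent vector. -/
def smoothExtend {x : M} (v : TangentSpace I x) : Π y : M, TangentSpace I y :=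
  (exists_isSmoothVectorField_eventuallyEq_extend v).choose

lemma isSmoothVectorField_smoothExtend {x : M} (v : TangentSpace I x) :
    IsSmoothVectorField I (smoothExtend v) :=
  (exists_isSmoothVectorField_eventuallyEq_extend v).choose_spec.1

lemma smoothExtend_eventuallyEq {x : M} (v : TangentSpace I x) :
    ∀ᶠ y in nhds x, smoothExtend v y = FiberBundle.extend E v y :=
  (exists_isSmoothVectorField_eventuallyEq_extend v).choose_spec.2

@[simp]
lemma smoothExtend_apply_self {x : M} (v : TangentSpace I x) : smoothExtend v x = v := by
  rw [(smoothExtend_eventuallyEq v).self_of_nhds, FiberBundle.extend_apply_self]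

end SmoothFields

/-! ### Vector fields in a chart -/

section ChartRep

variable {E : Type*} [NormedAddCommGroup E] [NormedSpace ℝ E] {H : Type*} [TopologicalSpace H]
  {I : ModelWithCorners ℝ E H} [I.Boundaryless] {M : Type*} [TopologicalSpace M]
  [ChartedSpace H M] [IsManifold I ∞ M] {X Y Z : Π x : M, TangentSpace I x} {f : M → ℝ}

lemma contMDiffAt_extChartAt_symm (p : M) {y : E} (hy : y ∈ (extChartAt I p).target) :
    CMDiffAt ∞ (extChartAt I p).symm y :=
  (contMDiffOn_extChartAt_symm p).contMDiffAt ((isOpen_extChartAt_target p).mem_nhds hy)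

lemma isInvertible_mfderiv_extChartAt_symm (p : M) {y : E} (hy : y ∈ (extChartAt I p).target) :
    (mfderiv 𝓘(ℝ, E) I (extChartAt I p).symm y).IsInvertible := by
  have : IsManifold I 1 M := IsManifold.of_le (n := ∞) (by simp)
  have h := isInvertible_mfderivWithin_extChartAt_symm (I := I) hy
  rwa [I.range_eq_univ, mfderivWithin_univ] at h

variable (I) in
/-- The representation of a vector field in the extended chart at `p`. -/
def chartRep (p : M) (X : Π x : M, TangentSpace I x) : E → E :=
  mpullback 𝓘(ℝ, E) I (extChartAt I p).symm X

lemma mfderiv_symm_chartRep (p : M) (X : Π x : M, TangentSpace I x) {y : E}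
    (hy : y ∈ (extChartAt I p).target) :
    mfderiv 𝓘(ℝ, E) I (extChartAt I p).symm y (chartRep (E := E) I p X y) = X ((extChartAt I p).symm y) :=
  ContinuousLinearMap.IsInvertible.self_apply_inverse
    (isInvertible_mfderiv_extChartAt_symm p hy) _

lemma mdifferentiableAt_symm (p : M) {y : E} (hy : y ∈ (extChartAt I p).target) :
    MDifferentiableAt 𝓘(ℝ, E) I (extChartAt I p).symm y :=
  (contMDiffAt_extChartAt_symm p hy).mdifferentiableAt (by simp)

lemma mvfderiv_eq_fderiv (F : E → ℝ) (y : E) : mvfderiv 𝓘(ℝ, E) F y = fderiv ℝ F y := by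
  rw [mvfderiv, mfderiv_eq_fderiv]
  rfl

/-- A derivative along a vector field, computed in a chart. -/
lemma fderiv_comp_symm_chartRep (p : M) (X : Π x : M, TangentSpace I x) {f : M → ℝ} {y : E}
    (hy : y ∈ (extChartAt I p).target) (hf : MDiffAt f ((extChartAt I p).symm y)) :
    fderiv ℝ (f ∘ (extChartAt I p).symm) y (chartRep I p X y) =
      d% f ((extChartAt I p).symm y) (X ((extChartAt I p).symm y)) := by
  have h : MDifferentiableAt 𝓘(ℝ, E) I (extChartAt I p).symm y := mdifferentiableAt_symm p hy
  have h2 := mvfderiv_comp_apply (I := I) y hf h (chartRep (E := E) I p X y)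
  rw [mfderiv_symm_chartRep p X hy, mvfderiv_eq_fderiv] at h2
  exact h2

lemma IsSmoothVectorField.contDiffAt_chartRep [CompleteSpace E] (hX : IsSmoothVectorField I X)
    (p : M) {y : E} (hy : y ∈ (extChartAt I p).target) : ContDiffAt ℝ ∞ (chartRep I p X) y := by
  have : IsManifold I 1 M := IsManifold.of_le (n := ∞) (by simp)
  exact contMDiffAt_vectorSpace_iff_contDiffAt.1
    (ContMDiffAt.mpullback_vectorField_preimage (ContMDiff.contMDiffAt hX)
      (contMDiffAt_extChartAt_symm p hy) (isInvertible_mfderiv_extChartAt_symm p hy) (by simp))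

lemma mlieBracket_eq_lieBracket (V W : E → E) (y : E) :
    mlieBracket 𝓘(ℝ, E) V W y = lieBracket ℝ V W y := by
  have h := congrFun (mlieBracketWithin_eq_lieBracketWithin (𝕜 := ℝ) (V := V) (W := W)
    (s := Set.univ)) y
  rw [lieBracketWithin_univ] at h
  exact h

lemma chartRep_mlieBracket [CompleteSpace E] (p : M) {y : E}
    (hX : MDiffAt (T% X) ((extChartAt I p).symm y)) (hY : MDiffAt (T% Y) ((extChartAt I p).symm y))
    (hy : y ∈ (extChartAt I p).target) :
    chartRep I p (mlieBracket I X Y) y = lieBracket ℝ (chartRep I p X) (chartRep I p Y) y := by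
  have : IsManifold I (minSmoothness ℝ 2) M := by
    rw [minSmoothness_of_isRCLikeNormedField]; infer_instance
  have h := mpullback_mlieBracket (I := 𝓘(ℝ, E)) hX hY (contMDiffAt_extChartAt_symm p hy)
    (by rw [minSmoothness_of_isRCLikeNormedField]; exact ENat.LEInfty.out)
  exact h.trans (mlieBracket_eq_lieBracket _ _ _)

lemma contDiffAt_comp_extChartAt_symm {F : Type*} [NormedAddCommGroup F] [NormedSpace ℝ F]
    {f : M → F} (hf : CMDiff ∞ f) (p : M) {y : E} (hy : y ∈ (extChartAt I p).target) :
    ContDiffAt ℝ ∞ (f ∘ (extChartAt I p).symm) y :=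
  contMDiffAt_iff_contDiffAt.1 ((hf.contMDiffAt).comp y (contMDiffAt_extChartAt_symm p hy))

/-- The Lie bracket is the commutator of derivations. -/
lemma mvfderiv_mlieBracket [CompleteSpace E] (hX : IsSmoothVectorField I X)
    (hY : IsSmoothVectorField I Y) (hf : CMDiff ∞ f) (x : M) :
    d% f x (mlieBracket I X Y x) =
      d% (fun y ↦ d% f y (Y y)) x (X x) - d% (fun y ↦ d% f y (X y)) x (Y x) := by
  have hmd : ∀ z, MDiffAt f z := fun z ↦ hf.contMDiffAt.mdifferentiableAt (by simp)
  set y := extChartAt I x x with hy_def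
  have hy : y ∈ (extChartAt I x).target := mem_extChartAt_target x
  have hxy : (extChartAt I x).symm y = x := extChartAt_to_inv x
  have hmem : ∀ᶠ z in nhds y, z ∈ (extChartAt I x).target :=
    (isOpen_extChartAt_target x).mem_nhds hy
  set F : E → ℝ := f ∘ (extChartAt I x).symm
  have hF : ContDiffAt ℝ ∞ F y := contDiffAt_comp_extChartAt_symm hf x hy
  have hF' : DifferentiableAt ℝ (fderiv ℝ F) y :=
    (hF.fderiv_right (m := 1) (by norm_num; exact ENat.LEInfty.out)).differentiableAt (by simp)
  -- In the chart, V(Wf) is a Hessian term plus the differential of f applied to the derivative of W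
  -- along V. In the commutator the Hessian terms cancel by symmetry, and the rest is the flat
  -- bracket.
  have key : ∀ W : Π x : M, TangentSpace I x, IsSmoothVectorField I W →
      ∀ V : Π x : M, TangentSpace I x,
      d% (fun z ↦ d% f z (W z)) x (V x) = fderiv ℝ (fderiv ℝ F) y (chartRep I x V y) (chartRep I x W y)
        + fderiv ℝ F y (fderiv ℝ (chartRep I x W) y (chartRep I x V y)) := by
    intro W hW V
    have h1 := fderiv_comp_symm_chartRep x V (f := fun z ↦ d% f z (W z)) hy
      ((hW.contMDiff_mvfderiv hf).contMDiffAt.mdifferentiableAt (by simp))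
    rw [hxy] at h1
    rw [← h1]
    have h2 : (fun z ↦ d% f z (W z)) ∘ (extChartAt I x).symm =ᶠ[nhds y]
        fun z ↦ fderiv ℝ F z (chartRep I x W z) := by
      filter_upwards [hmem] with z hz
      exact (fderiv_comp_symm_chartRep x W hz (hmd _)).symm
    rw [h2.fderiv_eq, fderiv_clm_apply hF'
      ((hW.contDiffAt_chartRep x hy).differentiableAt (by simp))]
    simp [add_comm]
  have hbr := fderiv_comp_symm_chartRep x (mlieBracket I X Y) hy (hmd _)
  rw [chartRep_mlieBracket x (hX.mdifferentiableAt _) (hY.mdifferentiableAt _) hy, hxy] at hbr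
  rw [← hbr, key Y hY X, key X hX Y, lieBracket, map_sub]
  have hs := (hF.isSymmSndFDerivAt
    (by rw [minSmoothness_of_isRCLikeNormedField]; exact ENat.LEInfty.out)).eq (chartRep I x X y) (chartRep I x Y y)
  rw [hs]
  ring

end ChartRep

/-! ### Traces through dual bases of a bilinear form -/

section DualPair

variable {V : Type*} [AddCommGroup V] [Module ℝ V] {ι κ : Type*} [Fintype ι] [Fintype κ]

/-- Two families of vectors that are dual bases of each other with respect to a bilinear form. -/
structure IsDualPair (B : V →ₗ[ℝ] V →ₗ[ℝ] ℝ) (b d : ι → V) : Prop where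
  left (v : V) : ∑ i, B v (d i) • b i = v
  right (v : V) : ∑ i, B v (b i) • d i = v

/-- The Gram matrix of a family of vectors. -/
def gramMatrix (B : V →ₗ[ℝ] V →ₗ[ℝ] ℝ) (b : ι → V) : Matrix ι ι ℝ :=
  Matrix.of fun i j ↦ B (b i) (b j)

/-- The dual family of a family of vectors with invertible Gram matrix. -/
def dualFamily [DecidableEq ι] (B : V →ₗ[ℝ] V →ₗ[ℝ] ℝ) (b : ι → V) (i : ι) : V :=
  ∑ j, (gramMatrix B b)⁻¹ i j • b j

namespace IsDualPair

variable {B : V →ₗ[ℝ] V →ₗ[ℝ] ℝ} {b d : ι → V} {A : Type*} [AddCommGroup A] [Module ℝ A]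

lemma symm (h : IsDualPair B b d) : IsDualPair B d b := ⟨h.right, h.left⟩

/-- The trace of a bilinear map does not depend on the dual pair. -/
lemma sum_eq_sum (h : IsDualPair B b d) (hB : ∀ v w, B v w = B w v) {b' d' : κ → V}
    (h' : IsDualPair B b' d') (F : V →ₗ[ℝ] V →ₗ[ℝ] A) :
    ∑ i, F (b i) (d i) = ∑ k, F (b' k) (d' k) := by
  have h1 : ∀ i, F (b i) (d i) = ∑ k, B (b i) (d' k) • F (b' k) (d i) := fun i ↦ by
    conv_lhs => rw [← h'.left (b i)]
    simp
  have h2 : ∀ k, F (b' k) (d' k) = ∑ i, B (b i) (d' k) • F (b' k) (d i) := fun k ↦ by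
    conv_lhs => rw [← h.right (d' k)]
    simp [hB (d' k)]
  simp_rw [h1, h2]
  exact Finset.sum_comm

lemma sum_swap (h : IsDualPair B b d) (hB : ∀ v w, B v w = B w v) (F : V →ₗ[ℝ] V →ₗ[ℝ] A) :
    ∑ i, F (d i) (b i) = ∑ i, F (b i) (d i) :=
  h.symm.sum_eq_sum hB h F

/-- Expanding S bᵢ in the family b and T dₖ in the family d gives two double sums with the same
coefficients. -/
lemma sum_adjoint (h : IsDualPair B b d) (hB : ∀ v w, B v w = B w v) (F : V →ₗ[ℝ] V →ₗ[ℝ] A)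
    {S T : V →ₗ[ℝ] V} (hST : ∀ v w, B (S v) w = B v (T w)) :
    ∑ i, F (S (b i)) (d i) = ∑ i, F (b i) (T (d i)) := by
  have h1 : ∀ i, F (S (b i)) (d i) = ∑ k, B (S (b i)) (d k) • F (b k) (d i) := fun i ↦ by
    conv_lhs => rw [← h.left (S (b i))]
    simp
  have h2 : ∀ k, F (b k) (T (d k)) = ∑ i, B (S (b i)) (d k) • F (b k) (d i) := fun k ↦ by
    conv_lhs => rw [← h.right (T (d k))]
    simp [hB (T (d k)), hST]
  simp_rw [h1, h2]
  exact Finset.sum_comm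

lemma trace_eq [FiniteDimensional ℝ V] (h : IsDualPair B b d) (S : V →ₗ[ℝ] V) :
    LinearMap.trace ℝ V S = ∑ i, B (S (b i)) (d i) := by
  -- The expansion of v along the dual pair writes S as a sum of rank-one maps, whose traces are
  -- immediate.
  have hS : S = ∑ i, (B.flip (d i)).smulRight (S (b i)) := by
    ext v
    conv_lhs => rw [← h.left v]
    simp
  conv_lhs => rw [hS]
  simp [LinearMap.trace_smulRight]

lemma sum_inner (h : IsDualPair B b d) (v w : V) : ∑ i, B v (d i) * B (b i) w = B v w := by
  conv_rhs => rw [← h.left v]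
  simp

end IsDualPair

variable [DecidableEq ι]

lemma inner_dualFamily {B : V →ₗ[ℝ] V →ₗ[ℝ] ℝ} (hB : ∀ v w, B v w = B w v) {b : ι → V}
    (hb : (gramMatrix B b).det ≠ 0) (i k : ι) :
    B (b i) (dualFamily B b k) = if i = k then 1 else 0 := by
  have h := Matrix.nonsing_inv_mul (gramMatrix B b) (isUnit_iff_ne_zero.2 hb)
  have h2 := congrFun (congrFun h k) i
  rw [Matrix.mul_apply, Matrix.one_apply] at h2
  simp only [dualFamily, map_sum, map_smul, smul_eq_mul]
  simp only [eq_comm (a := i) (b := k)]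
  rw [← h2]
  exact Finset.sum_congr rfl fun j _ ↦ by rw [hB]; rfl

/-- Biorthogonality makes b independent, hence a basis by the dimension count, and coefficients can
be read off with the dual family. The second expansion holds because the error is orthogonal to
every bₖ, hence to the dual family in their span, and so vanishes by the first. -/
lemma isDualPair_dualFamily [FiniteDimensional ℝ V] {B : V →ₗ[ℝ] V →ₗ[ℝ] ℝ}
    (hB : ∀ v w, B v w = B w v) {b : ι → V} (hb : (gramMatrix B b).det ≠ 0)
    (hcard : Fintype.card ι = Module.finrank ℝ V) : IsDualPair B b (dualFamily B b) := by
  have key := inner_dualFamily hB hb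
  have hli : LinearIndependent ℝ b := by
    rw [Fintype.linearIndependent_iff]
    intro c hc k
    have := congrArg (fun v ↦ B v (dualFamily B b k)) hc
    simpa [key] using this
  have hleft : ∀ v : V, ∑ i, B v (dualFamily B b i) • b i = v := by
    intro v
    have hspan : v ∈ Submodule.span ℝ (Set.range b) := by
      rw [hli.span_eq_top_of_card_eq_finrank' hcard]
      trivial
    obtain ⟨c, rfl⟩ := (Submodule.mem_span_range_iff_exists_fun ℝ).1 hspan
    simp [key]
  refine ⟨hleft, fun v ↦ ?_⟩
  rw [← sub_eq_zero]
  set w := ∑ i, B v (b i) • dualFamily B b i - v with hw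
  have h0 : ∀ k, B w (b k) = 0 := fun k ↦ by
    simp [hw, hB _ (b k), key]
  rw [← hleft w]
  simp [dualFamily, h0]

/-- A kernel vector of the Gram matrix gives the coefficients of a vector orthogonal to the whole
basis. -/
lemma det_gramMatrix_ne_zero {B : V →ₗ[ℝ] V →ₗ[ℝ] ℝ} (hB : ∀ v w, B v w = B w v)
    (hnd : ∀ v, (∀ w, B w v = 0) → v = 0)
    (b : Module.Basis ι ℝ V) : (gramMatrix B b).det ≠ 0 := by
  intro h
  obtain ⟨c, hc, hc0⟩ := Matrix.exists_mulVec_eq_zero_iff.2 h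
  have hz : ∑ j, c j • b j = 0 := by
    refine hnd _ fun w ↦ ?_
    have h1 : ∀ i, B (b i) (∑ j, c j • b j) = 0 := fun i ↦ by
      have := congrFun hc0 i
      simpa [Matrix.mulVec, dotProduct, gramMatrix, mul_comm] using this
    rw [hB, ← b.sum_repr w, map_sum]
    exact Finset.sum_eq_zero fun i _ ↦ by rw [map_smul, hB, h1, smul_zero]
  exact hc (funext fun i ↦ Fintype.linearIndependent_iff.1 b.linearIndependent c hz i)

end DualPair

/-! ### Smoothness of determinants and inverse matrices -/

section Matrix

variable {E : Type*} [NormedAddCommGroup E] [NormedSpace ℝ E] {H : Type*} [TopologicalSpace H]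
  {I : ModelWithCorners ℝ E H} {M : Type*} [TopologicalSpace M] [ChartedSpace H M]
  {ι : Type*} [Fintype ι] [DecidableEq ι] {A : M → Matrix ι ι ℝ} {x : M}

lemma contMDiffAt_det (hA : ∀ i j, CMDiffAt ∞ (fun y ↦ A y i j) x) :
    CMDiffAt ∞ (fun y ↦ (A y).det) x := by
  simp only [Matrix.det_apply']
  exact ContMDiffAt.sum fun σ _ ↦ contMDiffAt_const.mul (ContMDiffAt.prod fun i _ ↦ hA _ _)

lemma contMDiffAt_matrix_inv (hA : ∀ i j, CMDiffAt ∞ (fun y ↦ A y i j) x) (hx : (A x).det ≠ 0)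
    (i j : ι) : CMDiffAt ∞ (fun y ↦ (A y)⁻¹ i j) x := by
  simp only [Matrix.inv_def, Ring.inverse_eq_inv', Matrix.smul_apply, smul_eq_mul,
    Matrix.adjugate_apply]
  refine ((contMDiffAt_det hA).inv₀ hx).mul (contMDiffAt_det fun k l ↦ ?_)
  simp only [Matrix.updateRow_apply]
  split_ifs
  · exact contMDiffAt_const
  · exact hA k l

end Matrix

/-! ### Local frames, and smoothness of the Levi-Civita connection -/

namespace SemiRiemannianMetric

variable {E : Type*} [NormedAddCommGroup E] [NormedSpace ℝ E] {H : Type*} [TopologicalSpace H]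
  {I : ModelWithCorners ℝ E H} {M : Type*} [TopologicalSpace M] [ChartedSpace H M]
  [IsManifold I ∞ M] (g : SemiRiemannianMetric I M) {X Y Z W : Π x : M, TangentSpace I x}

/-- The metric at a point as a bilinear form. -/
def bilin (x : M) : TangentSpace I x →ₗ[ℝ] TangentSpace I x →ₗ[ℝ] ℝ :=
  LinearMap.mk₂ ℝ (fun v w ↦ g.inner x v w) (by simp) (by simp) (by simp) (by simp)

@[simp] lemma bilin_apply (x : M) (v w : TangentSpace I x) : g.bilin x v w = g.inner x v w := rfl

lemma bilin_symm (x : M) (v w : TangentSpace I x) : g.bilin x v w = g.bilin x w v := g.symm x v w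

/-- The inner product of two smooth families of tangent vectors is smooth. -/
lemma contMDiffAt_inner_comp {E' : Type*} [NormedAddCommGroup E'] [NormedSpace ℝ E'] {H' : Type*}
    [TopologicalSpace H'] {J : ModelWithCorners ℝ E' H'} {N : Type*} [TopologicalSpace N]
    [ChartedSpace H' N] {b : N → M} {v w : Π n : N, TangentSpace I (b n)} {n : N}
    (hv : ContMDiffAt J I.tangent ∞ (fun n ↦ (⟨b n, v n⟩ : TangentBundle I M)) n)
    (hw : ContMDiffAt J I.tangent ∞ (fun n ↦ (⟨b n, w n⟩ : TangentBundle I M)) n) :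
    ContMDiffAt J 𝓘(ℝ, ℝ) ∞ (fun n ↦ g.inner (b n) (v n) (w n)) n := by
  have hb : ContMDiffAt J I ∞ b n := (contMDiffAt_totalSpace.1 hv).1
  have h : ContMDiffAt J (I.prod 𝓘(ℝ, ℝ)) ∞
      (fun n ↦ TotalSpace.mk' ℝ (E := Bundle.Trivial M ℝ) (b n) (g.inner (b n) (v n) (w n))) n :=
    ContMDiffAt.clm_bundle_apply₂ (F₁ := E) (F₂ := E)
      ((g.contMDiff (b n)).comp n hb) hv hw
  simp only [contMDiffAt_totalSpace] at h
  exact h.2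

lemma contMDiff_inner (hX : IsSmoothVectorField I X) (hY : IsSmoothVectorField I Y) :
    CMDiff ∞ (fun x ↦ g.inner x (X x) (Y x)) :=
  fun x ↦ g.contMDiffAt_inner_comp (hX x) (hY x)

variable [FiniteDimensional ℝ E]

instance finiteDimensional_tangentSpace (x : M) : FiniteDimensional ℝ (TangentSpace I x) :=
  inferInstanceAs (FiniteDimensional ℝ E)

lemma finrank_tangentSpace (x : M) :
    Module.finrank ℝ (TangentSpace I x) = Module.finrank ℝ E := rfl

lemma det_gramMatrix_bilin_ne_zero {ι : Type*} [Fintype ι] [DecidableEq ι] {x : M}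
    (b : Module.Basis ι ℝ (TangentSpace I x)) : (gramMatrix (g.bilin x) b).det ≠ 0 :=
  det_gramMatrix_ne_zero (g.bilin_symm x)
    (fun v hv ↦ g.nondegenerate x v fun w ↦ (g.symm x v w).trans (hv w)) b

lemma isDualPair_tangentBasis [CompleteSpace E] (x : M) : IsDualPair (g.bilin x) (tangentBasis I x)
    (dualFamily (g.bilin x) (tangentBasis I x)) :=
  isDualPair_dualFamily (g.bilin_symm x) (g.det_gramMatrix_bilin_ne_zero _) (by simp; rfl)

/-- Replaces the inverse Gram matrix by a dual pair, so that basis independence of traces becomes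
available for bilinear maps. -/
lemma metricTrace_eq_sum [CompleteSpace E] (x : M) {A : Type*} [AddCommGroup A] [Module ℝ A]
    (F : TangentSpace I x →ₗ[ℝ] TangentSpace I x →ₗ[ℝ] A) :
    g.metricTrace x (fun v w ↦ F v w) =
      ∑ i, F (tangentBasis I x i) (dualFamily (g.bilin x) (tangentBasis I x) i) := by
  simp only [metricTrace, dualFamily, map_sum, map_smul]
  rfl

section Frame

variable [T2Space M] [CompleteSpace E]

variable (I) in
/-- Smooth vector fields that form a frame near `x`. -/
def frame (x : M) (i : Fin (Module.finrank ℝ E)) : Π y : M, TangentSpace I y :=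
  smoothExtend (tangentBasis I x i)

lemma isSmoothVectorField_frame (x : M) (i : Fin (Module.finrank ℝ E)) :
    IsSmoothVectorField I (frame I x i) :=
  isSmoothVectorField_smoothExtend _

@[simp]
lemma frame_apply_self (x : M) (i : Fin (Module.finrank ℝ E)) :
    frame I x i x = tangentBasis I x i :=
  smoothExtend_apply_self _

/-- The vector fields dual to `frame I x` with respect to the metric. -/
def coframe (x : M) (i : Fin (Module.finrank ℝ E)) (y : M) : TangentSpace I y :=
  dualFamily (g.bilin y) (fun i ↦ frame I x i y) i

/-- The determinant of the Gram matrix of `frame I x`. -/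
def frameDet (x y : M) : ℝ := (gramMatrix (g.bilin y) (fun i ↦ frame I x i y)).det

lemma frameDet_self_ne_zero (x : M) : g.frameDet x x ≠ 0 := by
  simp only [frameDet, frame_apply_self]
  exact g.det_gramMatrix_bilin_ne_zero (tangentBasis I x)

lemma contMDiff_gramMatrix_frame (x : M) (i j : Fin (Module.finrank ℝ E)) :
    CMDiff ∞ (fun y ↦ gramMatrix (g.bilin y) (fun i ↦ frame I x i y) i j) :=
  g.contMDiff_inner (isSmoothVectorField_frame x i) (isSmoothVectorField_frame x j)

lemma contMDiffAt_inv_gramMatrix_frame {x y : M} (hy : g.frameDet x y ≠ 0)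
    (i j : Fin (Module.finrank ℝ E)) :
    CMDiffAt ∞ (fun y ↦ (gramMatrix (g.bilin y) (fun i ↦ frame I x i y))⁻¹ i j) y :=
  contMDiffAt_matrix_inv (fun i j ↦ (g.contMDiff_gramMatrix_frame x i j).contMDiffAt) hy i j

lemma eventually_frameDet_ne_zero (x : M) : ∀ᶠ y in nhds x, g.frameDet x y ≠ 0 :=
  (contMDiffAt_det (fun i j ↦ (g.contMDiff_gramMatrix_frame x i j).contMDiffAt)
    (x := x)).continuousAt.eventually_ne (g.frameDet_self_ne_zero x)

lemma isDualPair_frame {x y : M} (hy : g.frameDet x y ≠ 0) :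
    IsDualPair (g.bilin y) (fun i ↦ frame I x i y) (fun i ↦ g.coframe x i y) :=
  isDualPair_dualFamily (g.bilin_symm y) hy (by simp; rfl)

lemma contMDiffAt_coframe {x y : M} (hy : g.frameDet x y ≠ 0) (i : Fin (Module.finrank ℝ E)) :
    CMDiffAt ∞ (T% (g.coframe x i)) y := by
  have h := ContMDiffAt.sum_section (s := Finset.univ) fun j _ ↦
    (g.contMDiffAt_inv_gramMatrix_frame hy i j).smul_section (isSmoothVectorField_frame x j y)
  exact h

/-- A vector field is smooth if its inner products with smooth vector fields are. -/
lemma isSmoothVectorField_of_inner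
    (h : ∀ X : Π x : M, TangentSpace I x, IsSmoothVectorField I X →
      CMDiff ∞ (fun x ↦ g.inner x (W x) (X x))) : IsSmoothVectorField I W := by
  intro x
  -- Near `x` the field equals ∑ g(W, eᵢ) eⁱ, a combination of smooth fields with smooth
  -- coefficients.
  have h1 : CMDiffAt ∞ (T% (fun y ↦ ∑ i, g.inner y (W y) (frame I x i y) • g.coframe x i y)) x :=
    ContMDiffAt.sum_section fun i _ ↦ ((h _ (isSmoothVectorField_frame x i)).contMDiffAt).smul_section
      (g.contMDiffAt_coframe (g.frameDet_self_ne_zero x) i)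
  refine h1.congr_of_eventuallyEq ?_
  filter_upwards [g.eventually_frameDet_ne_zero x] with y hy
  have := (g.isDualPair_frame hy).right (W y)
  simp only [bilin_apply] at this
  rw [this]

variable [I.Boundaryless]

/-- `∇_X Y` is smooth if `X` and `Y` are. -/
lemma isSmoothVectorField_leviCivita (hX : IsSmoothVectorField I X)
    (hY : IsSmoothVectorField I Y) :
    IsSmoothVectorField I (fun x ↦ g.leviCivita Y x (X x)) := by
  refine g.isSmoothVectorField_of_inner fun Z hZ ↦ ?_
  have h : ∀ x, g.inner x (g.leviCivita Y x (X x)) (Z x) = 2⁻¹ * g.koszul X Y Z x := fun x ↦ by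
    rw [← g.two_mul_inner_leviCivita (hX.mdifferentiableAt x) (hY.mdifferentiableAt x)
      (hZ.mdifferentiableAt x), inv_mul_cancel_left₀ two_ne_zero]
  simp only [h, koszul]
  exact contMDiff_const.mul (((((hX.contMDiff_mvfderiv (g.contMDiff_inner hY hZ)).add
    (hY.contMDiff_mvfderiv (g.contMDiff_inner hZ hX))).sub
    (hZ.contMDiff_mvfderiv (g.contMDiff_inner hX hY))).add
    (g.contMDiff_inner (hX.mlieBracket hY) hZ)).sub
    (g.contMDiff_inner (hX.mlieBracket hZ) hY) |>.sub (g.contMDiff_inner (hY.mlieBracket hZ) hX))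

end Frame

end SemiRiemannianMetric

/-! ### Calculus of the connection and symmetries of the curvature -/

namespace SemiRiemannianMetric

variable {E : Type*} [NormedAddCommGroup E] [NormedSpace ℝ E] {H : Type*} [TopologicalSpace H]
  {I : ModelWithCorners ℝ E H} {M : Type*} [TopologicalSpace M] [ChartedSpace H M]
  [IsManifold I ∞ M] (g : SemiRiemannianMetric I M) {X Y Z W : Π x : M, TangentSpace I x}
  [FiniteDimensional ℝ E] [CompleteSpace E] {x : M} {f : M → ℝ}

lemma leviCivita_add (hX : MDiffAt (T% X) x) (hY : MDiffAt (T% Y) x) :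
    g.leviCivita (X + Y) x = g.leviCivita X x + g.leviCivita Y x :=
  g.leviCivita.isCovariantDerivativeOnUniv.add hX hY

lemma leviCivita_smul (hf : MDiffAt f x) (hY : MDiffAt (T% Y) x) :
    g.leviCivita (f • Y) x = f x • g.leviCivita Y x + (d% f x).smulRight (Y x) :=
  g.leviCivita.isCovariantDerivativeOnUniv.leibniz hY hf

lemma leviCivita_const_smul (a : ℝ) (hY : MDiffAt (T% Y) x) :
    g.leviCivita (a • Y) x = a • g.leviCivita Y x :=
  g.leviCivita.isCovariantDerivativeOnUniv.smul_const a hY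

lemma leviCivita_sub (hX : MDiffAt (T% X) x) (hY : MDiffAt (T% Y) x) :
    g.leviCivita (X - Y) x = g.leviCivita X x - g.leviCivita Y x := by
  have h : X - Y = X + (-1 : ℝ) • Y := by simp [sub_eq_add_neg]
  rw [h, g.leviCivita_add hX (by simpa using! (mdifferentiableAt_const (c := (-1 : ℝ))).smul_section hY),
    g.leviCivita_const_smul _ hY]
  simp [sub_eq_add_neg]

lemma leviCivita_congr (hX : MDiffAt (T% X) x) (hY : MDiffAt (T% Y) x)
    (h : ∀ᶠ y in nhds x, X y = Y y) : g.leviCivita X x = g.leviCivita Y x :=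
  g.leviCivita.isCovariantDerivativeOnUniv.congr_of_eventuallyEq hX hY Filter.univ_mem h

lemma mlieBracket_eq (hX : MDiffAt (T% X) x) (hY : MDiffAt (T% Y) x) :
    mlieBracket I X Y x = g.leviCivita Y x (X x) - g.leviCivita X x (Y x) :=
  ((CovariantDerivative.torsion_eq_zero_iff _).1 g.torsion_leviCivita hX hY).symm

lemma curvature_swap : g.curvature X Y Z x = - g.curvature Y X Z x := by
  simp only [curvature, mlieBracket_swap_apply (V := Y) (W := X), map_neg]
  abel

variable [T2Space M] [I.Boundaryless]

/-- The curvature is skew-adjoint. -/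
lemma inner_curvature_swap (hX : IsSmoothVectorField I X) (hY : IsSmoothVectorField I Y)
    (hZ : IsSmoothVectorField I Z) (hW : IsSmoothVectorField I W) :
    g.inner x (g.curvature X Y Z x) (W x) = - g.inner x (Z x) (g.curvature X Y W x) := by
  have hXZ := g.isSmoothVectorField_leviCivita hX hZ
  have hXW := g.isSmoothVectorField_leviCivita hX hW
  have hYZ := g.isSmoothVectorField_leviCivita hY hZ
  have hYW := g.isSmoothVectorField_leviCivita hY hW
  -- In the second derivative of g(Z, W), the two terms with one derivative on each factor are
  -- together symmetric in U and V. They cancel in the commutator, which is the derivative along [X,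
  -- Y].
  have second : ∀ U V : Π x : M, TangentSpace I x, IsSmoothVectorField I U →
      IsSmoothVectorField I V → d% (fun y ↦ d% (fun z ↦ g.inner z (Z z) (W z)) y (V y)) x (U x) =
        g.inner x (g.leviCivita (fun y ↦ g.leviCivita Z y (V y)) x (U x)) (W x)
        + g.inner x (g.leviCivita Z x (V x)) (g.leviCivita W x (U x))
        + (g.inner x (g.leviCivita Z x (U x)) (g.leviCivita W x (V x))
        + g.inner x (Z x) (g.leviCivita (fun y ↦ g.leviCivita W y (V y)) x (U x))) := by
    intro U V hU hV
    have hVZ := g.isSmoothVectorField_leviCivita hV hZ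
    have hVW := g.isSmoothVectorField_leviCivita hV hW
    have h1 : (fun y ↦ d% (fun z ↦ g.inner z (Z z) (W z)) y (V y)) = fun y ↦
        g.inner y (g.leviCivita Z y (V y)) (W y) + g.inner y (Z y) (g.leviCivita W y (V y)) :=
      funext fun y ↦ g.mvfderiv_inner (hV.mdifferentiableAt y) (hZ.mdifferentiableAt y)
        (hW.mdifferentiableAt y)
    rw [h1, mvfderiv_fun_add
      ((g.contMDiff_inner hVZ hW).contMDiffAt.mdifferentiableAt (by simp))
      ((g.contMDiff_inner hZ hVW).contMDiffAt.mdifferentiableAt (by simp)),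
      _root_.add_apply, g.mvfderiv_inner (hU.mdifferentiableAt x) (hVZ.mdifferentiableAt x)
        (hW.mdifferentiableAt x), g.mvfderiv_inner (hU.mdifferentiableAt x)
        (hZ.mdifferentiableAt x) (hVW.mdifferentiableAt x)]
  have h1 := second X Y hX hY
  have h2 := second Y X hY hX
  have h3 := mvfderiv_mlieBracket hX hY (g.contMDiff_inner hZ hW) x
  rw [g.mvfderiv_inner ((hX.mlieBracket hY).mdifferentiableAt x) (hZ.mdifferentiableAt x)
        (hW.mdifferentiableAt x)] at h3
  simp only [curvature, map_sub, _root_.sub_apply]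
  linarith

/-- The first Bianchi identity. -/
lemma curvature_bianchi (hX : IsSmoothVectorField I X) (hY : IsSmoothVectorField I Y)
    (hZ : IsSmoothVectorField I Z) :
    g.curvature X Y Z x + g.curvature Y Z X x + g.curvature Z X Y x = 0 := by
  have : IsManifold I (minSmoothness ℝ 3) M := by
    rw [minSmoothness_of_isRCLikeNormedField]; exact IsManifold.of_le (n := ∞) ENat.LEInfty.out
  have h2 : minSmoothness ℝ 2 = ((2 : ℕ∞) : ℕ∞ω) := minSmoothness_of_isRCLikeNormedField
  have jac := leibniz_identity_mlieBracket_apply (I := I) (x := x)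
    (h2 ▸ hX.contMDiffAt (k := 2) x) (h2 ▸ hY.contMDiffAt (k := 2) x)
    (h2 ▸ hZ.contMDiffAt (k := 2) x)
  have br : ∀ {U V : Π x : M, TangentSpace I x}, IsSmoothVectorField I U →
      IsSmoothVectorField I V → mlieBracket I U V =
        (fun y ↦ g.leviCivita V y (U y)) - fun y ↦ g.leviCivita U y (V y) :=
    fun hU hV ↦ funext fun y ↦ g.mlieBracket_eq (hU.mdifferentiableAt y) (hV.mdifferentiableAt y)
  have nab := fun {U V : Π x : M, TangentSpace I x} (hU : IsSmoothVectorField I U)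
    (hV : IsSmoothVectorField I V) ↦ (g.isSmoothVectorField_leviCivita hU hV).mdifferentiableAt x
  have e1 := g.mlieBracket_eq (hX.mdifferentiableAt x) ((hY.mlieBracket hZ).mdifferentiableAt x)
  have e2 := g.mlieBracket_eq ((hX.mlieBracket hY).mdifferentiableAt x) (hZ.mdifferentiableAt x)
  have e3 := g.mlieBracket_eq (hY.mdifferentiableAt x) ((hX.mlieBracket hZ).mdifferentiableAt x)
  -- With every bracket written as a difference of covariant derivatives, the Jacobi identity is the
  -- Bianchi identity up to sign.
  rw [e1, e2, e3, br hX hY, br hY hZ, br hX hZ, g.leviCivita_sub (nab hY hZ) (nab hZ hY),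
    g.leviCivita_sub (nab hX hY) (nab hY hX), g.leviCivita_sub (nab hX hZ) (nab hZ hX)] at jac
  simp only [curvature, br hX hY, br hY hZ, br hZ hX]
  simp only [Pi.sub_apply, map_sub, _root_.sub_apply] at jac ⊢
  rw [← sub_eq_zero] at jac
  rw [← neg_eq_zero, ← jac]
  abel

/-- The pair symmetry of the curvature. -/
lemma inner_curvature_pair_symm (hX : IsSmoothVectorField I X) (hY : IsSmoothVectorField I Y)
    (hZ : IsSmoothVectorField I Z) (hW : IsSmoothVectorField I W) :
    g.inner x (g.curvature X Y Z x) (W x) = g.inner x (g.curvature Z W X x) (Y x) := by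
  have bi : ∀ {A B C D : Π x : M, TangentSpace I x}, IsSmoothVectorField I A →
      IsSmoothVectorField I B → IsSmoothVectorField I C →
      g.inner x (g.curvature A B C x) (D x) + g.inner x (g.curvature B C A x) (D x)
        + g.inner x (g.curvature C A B x) (D x) = 0 := by
    intro A B C D hA hB hC
    have := congrArg (fun v ↦ g.inner x v (D x)) (g.curvature_bianchi (x := x) hA hB hC)
    simpa using this
  have sk : ∀ {A B C D : Π x : M, TangentSpace I x},
      g.inner x (g.curvature A B C x) (D x) = - g.inner x (g.curvature B A C x) (D x) := by
    intro A B C D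
    rw [g.curvature_swap]
    simp
  have sk2 : ∀ {A B C D : Π x : M, TangentSpace I x}, IsSmoothVectorField I A →
      IsSmoothVectorField I B → IsSmoothVectorField I C → IsSmoothVectorField I D →
      g.inner x (g.curvature A B C x) (D x) = - g.inner x (g.curvature A B D x) (C x) := by
    intro A B C D hA hB hC hD
    rw [g.inner_curvature_swap hA hB hC hD, g.symm]
  -- The Bianchi identities for the four cyclic rotations of (X, Y, Z, W) imply the claim linearly,
  -- once the two skew-symmetries have brought their terms to common representatives.
  have b1 := bi (D := W) hX hY hZ
  have b2 := bi (D := X) hY hZ hW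
  have b3 := bi (D := Y) hZ hW hX
  have b4 := bi (D := Z) hW hX hY
  rw [sk2 hY hZ hW hX] at b2
  rw [sk2 hZ hW hY hX, sk (A := W) (B := Y) (C := Z)] at b2
  rw [sk2 hW hX hZ hY, sk (A := W) (B := X)] at b3
  rw [sk2 hX hZ hW hY, sk (A := X) (B := Z)] at b3
  rw [sk2 hW hX hY hZ] at b4
  rw [sk2 hX hY hW hZ, sk2 hY hW hX hZ] at b4
  have e1 := sk2 hW hX hY hZ
  have e2 := sk (A := W) (B := X) (C := Z) (D := Y)
  have e3 := sk (A := W) (B := Y) (C := Z) (D := X)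
  have e4 := sk2 hX hW hY hZ
  linarith

end SemiRiemannianMetric

/-! ### Algebra at a point: the Laplacian of ξ -/

section PointwiseAlgebra

/-- The algebraic identities satisfied, at a point of a paracontact metric manifold, by the metric
`B`, the tensor `φ`, the vector `ξ`, the endomorphism `P = ∇ξ` and the derivatives `T = ∇φ` and
`N = ∇P`. -/
structure ParacontactPoint {V : Type*} [AddCommGroup V] [Module ℝ V]
    (B : V →ₗ[ℝ] V →ₗ[ℝ] ℝ) (φ P : V →ₗ[ℝ] V) (ξ : V) (T N : V →ₗ[ℝ] V →ₗ[ℝ] V) : Prop where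
  symm (u v : V) : B u v = B v u
  inner_ξ : B ξ ξ = 1
  φ_skew (u v : V) : B (φ u) v = - B u (φ v)
  φ_φ (v : V) : φ (φ v) = v - B ξ v • ξ
  P_adjoint (u v : V) : B (P u) v = B u (P v + (2 : ℝ) • φ v)
  inner_P_ξ (u : V) : B (P u) ξ = 0
  T_skew (u v w : V) : B (T u v) w = - B v (T u w)
  N_adjoint (u v w : V) : B (N u v) w = B v (N u w + (2 : ℝ) • T u w)
  T_φ (u v : V) : T u (φ v) + φ (T u v) = -(B (P u) v • ξ) - B ξ v • P u
  cyclic (u v w : V) : B (N u v - N v u) w + B (N v w - N w v) u + B (N w u - N u w) v = 0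

namespace ParacontactPoint

variable {V : Type*} [AddCommGroup V] [Module ℝ V] {B : V →ₗ[ℝ] V →ₗ[ℝ] ℝ} {φ P : V →ₗ[ℝ] V}
  {ξ : V} {T N : V →ₗ[ℝ] V →ₗ[ℝ] V} (h : ParacontactPoint B φ P ξ T N)
  {ι : Type*} [Fintype ι] {b d : ι → V}

include h

/-- The formula for φ² gives φ²ξ = 0. Applied to φξ, it gives 0 = φ³ξ = φξ - g(ξ, φξ)ξ, and skewness
removes the last term. -/
lemma φ_ξ : φ ξ = 0 := by
  have h1 : φ (φ ξ) = 0 := by rw [h.φ_φ, h.inner_ξ, one_smul, sub_self]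
  have h2 := h.φ_φ (φ ξ)
  have h3 := h.φ_skew ξ ξ
  rw [h.symm] at h3
  rw [h1, map_zero, show B ξ (φ ξ) = 0 by linarith, zero_smul, sub_zero] at h2
  exact h2.symm

lemma inner_ξ_φ (v : V) : B ξ (φ v) = 0 := by
  have := h.φ_skew ξ v
  rw [h.φ_ξ] at this
  simpa using this.symm

lemma inner_Pξ (v : V) : B (P ξ) v = 0 := by
  rw [h.P_adjoint, map_add, map_smul, h.inner_ξ_φ, h.symm, h.inner_P_ξ]
  simp

/-- Closedness of dη, in algebraic form. By `N_adjoint`, 2g(T_u v, w) is the skew part of N_u up to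
sign, so the cyclic sum is a rearrangement of `cyclic`. -/
lemma T_cyclic (u v w : V) : B (T u v) w + B (T v w) u + B (T w u) v = 0 := by
  have key : ∀ u v w, 2 * B (T u v) w = B (N u w) v - B (N u v) w := fun u v w ↦ by
    have := h.N_adjoint u v w
    have h2 := h.T_skew u v w
    rw [map_add, map_smul, smul_eq_mul, h.symm v (N u w)] at this
    linarith
  have c := h.cyclic u v w
  simp only [map_sub, LinearMap.sub_apply] at c
  linarith [key u v w, key v w u, key w u v]

/-- At v = ξ, `T_φ` reads φ(T_u ξ) = -Pu. Applying φ once more recovers T_u ξ, since skewness of T_u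
makes it orthogonal to ξ. -/
lemma T_ξ (u : V) : T u ξ = -φ (P u) := by
  have h1 := h.T_φ u ξ
  rw [h.φ_ξ, map_zero, zero_add, h.inner_P_ξ, h.inner_ξ, zero_smul, one_smul, neg_zero,
    zero_sub] at h1
  have h2 := h.φ_φ (T u ξ)
  have h3 := h.T_skew u ξ ξ
  rw [h.symm] at h3
  rw [h1, show B ξ (T u ξ) = 0 by linarith, zero_smul, sub_zero, map_neg] at h2
  exact h2.symm

/-- By `T_φ`, T_u anticommutes with φ up to two rank-one terms. Each of these has trace -g(Pu, ξ) =
0, and T_u φ and φ T_u have the same trace. -/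
lemma sum_T_φ_left (hd : IsDualPair B b d) (u : V) : ∑ i, B (T u (b i)) (φ (d i)) = 0 := by
  have hadj := hd.sum_adjoint h.symm (B.comp (T u)) (S := φ) (T := -φ)
    (fun v w ↦ by simp [h.φ_skew])
  have hsum : ∑ i, B (T u (φ (b i)) + φ (T u (b i))) (d i) = 0 := by
    simp only [h.T_φ, map_sub, map_neg, map_smul, LinearMap.sub_apply, LinearMap.neg_apply,
      LinearMap.smul_apply, smul_eq_mul, Finset.sum_sub_distrib, Finset.sum_neg_distrib]
    have e1 := hd.sum_inner ξ (P u)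
    have e2 := hd.sum_inner (P u) ξ
    simp only [h.symm (b _) (P u), h.symm (b _) ξ] at e1 e2
    have e1' : ∑ i, B (P u) (b i) * B ξ (d i) = B ξ (P u) := by
      rw [← e1]; exact Finset.sum_congr rfl fun i _ ↦ mul_comm _ _
    have e2' : ∑ i, B ξ (b i) * B (P u) (d i) = B (P u) ξ := by
      rw [← e2]; exact Finset.sum_congr rfl fun i _ ↦ mul_comm _ _
    rw [e1', e2', h.symm ξ, h.inner_P_ξ]
    simp
  simp only [map_add, LinearMap.add_apply, Finset.sum_add_distrib, h.φ_skew,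
    Finset.sum_neg_distrib] at hsum
  simp only [LinearMap.comp_apply, LinearMap.neg_apply, map_neg, Finset.sum_neg_distrib] at hadj
  linarith

/-- Sum the cyclic identity over (u, bᵢ, φdᵢ). The first term vanishes by `sum_T_φ_left`; moving φ
across the dual pair and using skewness of T shows that the other two are equal. -/
lemma sum_T_φ_right (hd : IsDualPair B b d) (u : V) : ∑ i, B (T (b i) (φ (d i))) u = 0 := by
  let F : V →ₗ[ℝ] V →ₗ[ℝ] ℝ := T.compr₂ (B.flip u)
  have hF : ∀ v w, F v w = B (T v w) u := fun _ _ ↦ rfl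
  have h1 := hd.symm.sum_adjoint h.symm F (S := φ) (T := -φ) (fun v w ↦ by simp [h.φ_skew])
  have h2 := hd.sum_swap h.symm (F.compl₂ φ)
  simp only [LinearMap.compl₂_apply, hF, LinearMap.neg_apply, map_neg,
    Finset.sum_neg_distrib] at h1 h2
  have h3 : ∑ i, (B (T u (b i)) (φ (d i)) + B (T (b i) (φ (d i))) u
      + B (T (φ (d i)) u) (b i)) = 0 := Finset.sum_eq_zero fun i _ ↦ h.T_cyclic _ _ _
  simp only [Finset.sum_add_distrib, h.sum_T_φ_left hd] at h3
  have h4 : ∀ i, B (T (φ (d i)) u) (b i) = - B (T (φ (d i)) (b i)) u := fun i ↦ by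
    rw [h.T_skew, h.symm]
  simp only [h4, Finset.sum_neg_distrib] at h3
  linarith

lemma sum_inner_ξ_mul (hd : IsDualPair B b d) (v : V) : ∑ i, B ξ (d i) * B v (b i) = B v ξ := by
  have := hd.sum_inner ξ v
  simp only [h.symm (b _) v] at this
  rw [this, h.symm]

/-- Trace `T_φ` over u = bᵢ, v = dᵢ. The term with φ inside T drops by `sum_T_φ_right`, and the
terms η(dᵢ)P bᵢ add up to Pξ, which is zero. -/
lemma sum_T_φ (hd : IsDualPair B b d) (w : V) :
    ∑ i, B (T (b i) (d i)) (φ w) = (∑ i, B (P (b i)) (d i)) * B ξ w := by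
  have h1 : ∑ i, B (T (b i) (φ (d i)) + φ (T (b i) (d i))) w =
      ∑ i, B (-(B (P (b i)) (d i) • ξ) - B ξ (d i) • P (b i)) w :=
    Finset.sum_congr rfl fun i _ ↦ by rw [h.T_φ]
  have h2 : ∑ i, B ξ (d i) * B (P (b i)) w = 0 := by
    have h3 : ∀ i, B (P (b i)) w = B (P w + (2 : ℝ) • φ w) (b i) := fun i ↦ by
      rw [h.P_adjoint, h.symm]
    simp only [h3]
    rw [h.sum_inner_ξ_mul hd, ← h.symm, ← h.P_adjoint, h.inner_Pξ]
  simp only [map_add, LinearMap.add_apply, Finset.sum_add_distrib, h.sum_T_φ_right hd,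
    map_sub, map_neg, LinearMap.sub_apply, LinearMap.neg_apply, map_smul, LinearMap.smul_apply,
    smul_eq_mul, Finset.sum_sub_distrib, h2, Finset.sum_neg_distrib, h.φ_skew (T _ _),
    ← Finset.sum_mul] at h1
  linarith

/-- `∇ξ` is traceless. -/
lemma sum_P (hd : IsDualPair B b d) : ∑ i, B (P (b i)) (d i) = 0 := by
  -- At w = ξ the left side vanishes because φξ = 0, and η(ξ) = 1 isolates the trace.
  have := h.sum_T_φ hd ξ
  rw [h.φ_ξ, h.inner_ξ] at this
  simpa using this.symm

/-- Skewness of φ and the adjoint P + 2φ of P give tr φP = -tr Pφ - 2 tr φ². Here tr φ² = 2n, and φP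
and Pφ have equal traces. -/
lemma trace_φ_P [FiniteDimensional ℝ V] (hd : IsDualPair B b d) {n : ℕ}
    (hn : Module.finrank ℝ V = 2 * n + 1) : ∑ i, B (φ (P (b i))) (d i) = - (2 * n) := by
  have h1 := hd.trace_eq (φ ∘ₗ P)
  have h2 := hd.trace_eq (P ∘ₗ φ)
  rw [LinearMap.trace_comp_comm'] at h1
  have h3 : ∀ i, B (φ (P (b i))) (d i) = -B (b i) (P (φ (d i))) - 2 * B (b i) (d i)
      + 2 * (B ξ (d i) * B ξ (b i)) := fun i ↦ by
    rw [h.φ_skew, h.P_adjoint, h.φ_φ]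
    simp only [map_add, map_smul, map_sub, smul_eq_mul, h.symm (b i) ξ]
    ring
  have h4 := hd.symm.trace_eq (P ∘ₗ φ)
  have h5 := hd.trace_eq LinearMap.id
  rw [LinearMap.trace_id, hn] at h5
  simp only [LinearMap.comp_apply, LinearMap.id_apply, h.symm _ (b _)] at h1 h2 h4 h5
  have h6 : ∑ i, B (φ (P (b i))) (d i) = -∑ i, B (b i) (P (φ (d i))) - 2 * ∑ i, B (b i) (d i)
      + 2 * ∑ i, B ξ (d i) * B ξ (b i) := by
    simp only [h3, Finset.sum_add_distrib, Finset.sum_sub_distrib, Finset.sum_neg_distrib,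
      Finset.mul_sum]
  rw [h.sum_inner_ξ_mul hd, h.inner_ξ] at h6
  have h7 : ∑ i, B (φ (P (b i))) (d i) = ∑ i, B (b i) (P (φ (d i))) := by
    rw [← h4, h1]
  push_cast at h5
  linarith

/-- The divergence of `φ`. -/
lemma sum_T [FiniteDimensional ℝ V] (hd : IsDualPair B b d) {n : ℕ}
    (hn : Module.finrank ℝ V = 2 * n + 1) (w : V) :
    ∑ i, B (T (b i) (d i)) w = - (2 * n) * B ξ w := by
  -- As tr P = 0, testing against φ(φw) shows that the divergence is a multiple of ξ. Its
  -- ξ-component is tr φP by `T_ξ`.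
  have h0 := h.sum_T_φ hd (φ w)
  rw [h.sum_P hd, zero_mul, h.φ_φ] at h0
  simp only [map_sub, map_smul, Finset.sum_sub_distrib, smul_eq_mul, ← Finset.mul_sum] at h0
  have h1 : ∑ i, B (T (b i) (d i)) ξ = - (2 * n) := by
    rw [← h.trace_φ_P hd hn]
    refine Finset.sum_congr rfl fun i _ ↦ ?_
    rw [h.T_skew, h.T_ξ, map_neg, neg_neg, h.symm]
  rw [h1] at h0
  linarith

lemma sum_T_left [FiniteDimensional ℝ V] (hd : IsDualPair B b d) {n : ℕ}
    (hn : Module.finrank ℝ V = 2 * n + 1) (w : V) :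
    ∑ i, B (T (b i) w) (d i) = 2 * n * B ξ w := by
  have h1 : ∀ i, B (T (b i) w) (d i) = - B (T (b i) (d i)) w := fun i ↦ by
    rw [h.T_skew, h.symm]
  simp only [h1, Finset.sum_neg_distrib, h.sum_T hd hn]
  ring

/-- The operator `h = ½ L_ξ φ` in terms of covariant derivatives. -/
lemma sum_lieDeriv (hd : IsDualPair B b d) [FiniteDimensional ℝ V] :
    ∑ i, B (T ξ (b i) - P (φ (b i)) + φ (P (b i))) (d i) = 0 := by
  -- The traces of Pφ and φP cancel, and T_ξ is traceless because it is skew.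
  have h1 := hd.trace_eq (φ ∘ₗ P)
  have h2 := hd.trace_eq (P ∘ₗ φ)
  rw [LinearMap.trace_comp_comm'] at h1
  simp only [LinearMap.comp_apply] at h1 h2
  have h3 := hd.sum_swap h.symm (B.comp (T ξ))
  simp only [LinearMap.comp_apply] at h3
  have h4 : ∑ i, B (T ξ (d i)) (b i) = - ∑ i, B (T ξ (b i)) (d i) := by
    rw [← Finset.sum_neg_distrib]
    exact Finset.sum_congr rfl fun i _ ↦ by rw [h.T_skew, h.symm]
  simp only [map_add, map_sub, LinearMap.add_apply, LinearMap.sub_apply, Finset.sum_add_distrib,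
    Finset.sum_sub_distrib]
  linarith

/-- The vector is 2hw, so this is η ∘ h = 0. P and φ take values orthogonal to ξ, and g(ξ, T_ξ w) =
g(φPξ, w) = 0. -/
lemma inner_ξ_lieDeriv (w : V) : B ξ (T ξ w - P (φ w) + φ (P w)) = 0 := by
  have h1 : B ξ (T ξ w) = 0 := by
    have h0 : B (φ (P ξ)) w = 0 := by rw [h.φ_skew, h.inner_Pξ, neg_zero]
    have := h.T_skew ξ ξ w
    rw [h.T_ξ, map_neg, LinearMap.neg_apply, h0] at this
    linarith
  rw [map_add, map_sub, h1, h.symm ξ (P _), h.inner_P_ξ, h.inner_ξ_φ]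
  simp

variable {κ μ : ℝ} {ρ : V → V → V}

/-- The Ricci tensor applied to `ξ` on a `(κ, μ)`-space. -/
lemma sum_curvature [FiniteDimensional ℝ V] (hd : IsDualPair B b d) {n : ℕ}
    (hn : Module.finrank ℝ V = 2 * n + 1)
    (hρ : ∀ u v, ρ u v = κ • (B ξ u • v - B ξ v • u)
      + μ • (B ξ u • (2⁻¹ : ℝ) • (T ξ v - P (φ v) + φ (P v))
        - B ξ v • (2⁻¹ : ℝ) • (T ξ u - P (φ u) + φ (P u)))) (w : V) :
    ∑ i, B (ρ (b i) w) (d i) = - (2 * n * κ) * B ξ w := by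
  set L : V → V := fun v ↦ T ξ v - P (φ v) + φ (P v) with hL
  -- The κ-terms contribute κη(w) - (2n + 1)κη(w). The μ-terms vanish, one by η ∘ h = 0 and the
  -- other by tr h = 0.
  have h1 : ∀ i, B (ρ (b i) w) (d i) = κ * (B w (d i) * B ξ (b i)) - κ * B ξ w * B (b i) (d i)
      + μ * 2⁻¹ * (B (L w) (d i) * B ξ (b i)) - μ * B ξ w * 2⁻¹ * B (L (b i)) (d i) := fun i ↦ by
    rw [hρ]
    simp only [map_add, map_sub, map_smul, LinearMap.add_apply, LinearMap.sub_apply,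
      LinearMap.smul_apply, smul_eq_mul, hL]
    ring
  have h5 := hd.trace_eq LinearMap.id
  rw [LinearMap.trace_id, hn] at h5
  simp only [LinearMap.id_apply] at h5
  have e : ∀ v, ∑ i, B v (d i) * B ξ (b i) = B ξ v := fun v ↦ by
    have := hd.sum_inner v ξ
    simp only [h.symm (b _) ξ] at this
    rw [this, h.symm]
  simp only [h1, Finset.sum_add_distrib, Finset.sum_sub_distrib, ← Finset.mul_sum, e, ← h5,
    h.inner_ξ_lieDeriv w, h.sum_lieDeriv hd, hL]
  push_cast
  ring

variable (hN : ∀ u v, N u v - N v u = - ρ u v)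

include hN in
-- The Ricci identity `hN` exchanges the first two slots. The resulting trace of N_w is zero by
-- `htr`, so only the curvature trace remains.
lemma sum_N_left [FiniteDimensional ℝ V] (hd : IsDualPair B b d) {n : ℕ}
    (hn : Module.finrank ℝ V = 2 * n + 1)
    (hρ : ∀ u v, ρ u v = κ • (B ξ u • v - B ξ v • u)
      + μ • (B ξ u • (2⁻¹ : ℝ) • (T ξ v - P (φ v) + φ (P v))
        - B ξ v • (2⁻¹ : ℝ) • (T ξ u - P (φ u) + φ (P u))))
    (htr : ∀ u, ∑ i, B (N u (b i)) (d i) = 0) (w : V) :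
    ∑ i, B (N (b i) w) (d i) = 2 * n * κ * B ξ w := by
  have h1 : ∀ i, B (N (b i) w) (d i) = B (N w (b i)) (d i) - B (ρ (b i) w) (d i) := fun i ↦ by
    have := congrArg (fun v ↦ B v (d i)) (hN (b i) w)
    simp only [map_sub, map_neg, LinearMap.sub_apply, LinearMap.neg_apply] at this
    linarith
  simp only [h1, Finset.sum_sub_distrib, htr, h.sum_curvature hd hn hρ]
  ring

include hN in
/-- The rough Laplacian of `ξ` on a `(κ, μ)`-space. -/
lemma sum_N [FiniteDimensional ℝ V] (hd : IsDualPair B b d) {n : ℕ}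
    (hn : Module.finrank ℝ V = 2 * n + 1)
    (hρ : ∀ u v, ρ u v = κ • (B ξ u • v - B ξ v • u)
      + μ • (B ξ u • (2⁻¹ : ℝ) • (T ξ v - P (φ v) + φ (P v))
        - B ξ v • (2⁻¹ : ℝ) • (T ξ u - P (φ u) + φ (P u))))
    (htr : ∀ u, ∑ i, B (N u (b i)) (d i) = 0) (w : V) :
    ∑ i, B (N (b i) (d i)) w = (2 * n * κ + 4 * n) * B ξ w := by
  -- ∇P fails to be self-adjoint by 2∇φ; this is the source of the 4n, by way of the divergence of
  -- φ.
  have h1 : ∀ i, B (N (b i) (d i)) w = B (N (b i) w) (d i) + 2 * B (T (b i) w) (d i) :=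
    fun i ↦ by
      rw [h.N_adjoint, h.symm]
      simp
  simp only [h1, Finset.sum_add_distrib, ← Finset.mul_sum, h.sum_N_left hN hd hn hρ htr,
    h.sum_T_left hd hn]
  ring

end ParacontactPoint

end PointwiseAlgebra

/-! ### Elementary rules for derivatives of functions -/

section Mvfderiv

variable {E : Type*} [NormedAddCommGroup E] [NormedSpace ℝ E] {H : Type*} [TopologicalSpace H]
  {I : ModelWithCorners ℝ E H} {M : Type*} [TopologicalSpace M] [ChartedSpace H M]
  {F : Type*} [NormedAddCommGroup F] [NormedSpace ℝ F]

lemma mvfderiv_congr {f f' : M → F} {x : M} (h : f =ᶠ[nhds x] f') : d% f x = d% f' x := by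
  ext u
  have := congrArg (fun L : E →L[ℝ] F ↦ L u) (h.mfderiv_eq (I := I) (I' := 𝓘(ℝ, F)))
  exact this

lemma mvfderiv_apply_eq_zero {f : M → F} {x : M} {c : F} (h : f =ᶠ[nhds x] fun _ ↦ c)
    (u : TangentSpace I x) : d% f x u = 0 := by
  rw [mvfderiv_congr h]
  have := congrArg (fun L : E →L[ℝ] F ↦ L u) (mfderiv_const (I := I) (I' := 𝓘(ℝ, F)) (x := x) (c := c))
  exact this

lemma mvfderiv_sum_apply {ι : Type*} (s : Finset ι) {f : ι → M → ℝ} {x : M}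
    (h : ∀ i ∈ s, MDiffAt (f i) x) (u : TangentSpace I x) :
    d% (fun y ↦ ∑ i ∈ s, f i y) x u = ∑ i ∈ s, d% (f i) x u := by
  classical
  suffices MDiffAt (fun y ↦ ∑ i ∈ s, f i y) x ∧
      d% (fun y ↦ ∑ i ∈ s, f i y) x u = ∑ i ∈ s, d% (f i) x u from this.2
  induction s using Finset.induction_on with
  | empty =>
    simp only [Finset.sum_empty]
    exact ⟨mdifferentiableAt_const, mvfderiv_apply_eq_zero (Filter.Eventually.of_forall fun _ ↦ rfl) u⟩
  | insert a s ha ih =>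
    have ha' := h a (Finset.mem_insert_self a s)
    obtain ⟨h1, h2⟩ := ih fun i hi ↦ h i (Finset.mem_insert_of_mem hi)
    simp only [Finset.sum_insert ha]
    refine ⟨ha'.add h1, ?_⟩
    rw [mvfderiv_fun_add ha' h1, ← h2]
    rfl

end Mvfderiv

/-! ### Covariant derivatives of endomorphism fields -/

namespace SemiRiemannianMetric

variable {E : Type*} [NormedAddCommGroup E] [NormedSpace ℝ E] {H : Type*} [TopologicalSpace H]
  {I : ModelWithCorners ℝ E H} {M : Type*} [TopologicalSpace M] [ChartedSpace H M]
  [IsManifold I ∞ M] (g : SemiRiemannianMetric I M) {X Y Z W : Π x : M, TangentSpace I x}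
  [FiniteDimensional ℝ E] [CompleteSpace E] [T2Space M] [I.Boundaryless]

/-- Two fields of endomorphisms that preserve smoothness and are adjoint to each other. -/
structure IsSmoothAdjointPair (A A' : Π x : M, TangentSpace I x →L[ℝ] TangentSpace I x) :
    Prop where
  smooth_left {X : Π x : M, TangentSpace I x} (hX : IsSmoothVectorField I X) :
    IsSmoothVectorField I (fun x ↦ A x (X x))
  smooth_right {X : Π x : M, TangentSpace I x} (hX : IsSmoothVectorField I X) :
    IsSmoothVectorField I (fun x ↦ A' x (X x))
  adjoint (x : M) (v w : TangentSpace I x) : g.inner x (A x v) w = g.inner x v (A' x w)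

variable {A A' : Π x : M, TangentSpace I x →L[ℝ] TangentSpace I x}

/-- The covariant derivative of a field of endomorphisms, applied to a vector field:
`(∇_u A) Y = ∇_u (A Y) - A (∇_u Y)`. -/
def covDerivEnd (A : Π x : M, TangentSpace I x →L[ℝ] TangentSpace I x)
    (Y : Π x : M, TangentSpace I x) (x : M) (u : TangentSpace I x) : TangentSpace I x :=
  g.leviCivita (fun y ↦ A y (Y y)) x u - A x (g.leviCivita Y x u)

variable {g}

lemma IsSmoothAdjointPair.symm (hA : g.IsSmoothAdjointPair A A') : g.IsSmoothAdjointPair A' A :=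
  ⟨hA.smooth_right, hA.smooth_left, fun x v w ↦ by rw [g.symm, ← hA.adjoint, g.symm]⟩

lemma mvfderiv_inner_apply (hX : IsSmoothVectorField I X) (hY : IsSmoothVectorField I Y) (x : M)
    (u : TangentSpace I x) : d% (fun y ↦ g.inner y (X y) (Y y)) x u =
      g.inner x (g.leviCivita X x u) (Y x) + g.inner x (X x) (g.leviCivita Y x u) := by
  have := g.mvfderiv_inner ((isSmoothVectorField_smoothExtend u).mdifferentiableAt x)
    (hX.mdifferentiableAt x) (hY.mdifferentiableAt x)
  rwa [smoothExtend_apply_self] at this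

namespace IsSmoothAdjointPair

/-- Differentiate g(AY, Z) = g(Y, A'Z). The right side sees Y only through its value at `x`, which
is what makes ∇A a tensor. -/
lemma inner_covDerivEnd (hA : g.IsSmoothAdjointPair A A') (hY : IsSmoothVectorField I Y)
    (hZ : IsSmoothVectorField I Z) (x : M) (u : TangentSpace I x) :
    g.inner x (g.covDerivEnd A Y x u) (Z x) = g.inner x (Y x) (g.covDerivEnd A' Z x u) := by
  have h1 := mvfderiv_inner_apply (g := g) (hA.smooth_left hY) hZ x u
  have h2 := mvfderiv_inner_apply (g := g) hY (hA.smooth_right hZ) x u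
  simp only [hA.adjoint] at h1
  rw [h1] at h2
  simp only [covDerivEnd, map_sub, _root_.sub_apply, hA.adjoint]
  linarith

/-- The covariant derivative of a field of endomorphisms, as a tensor. -/
def covDeriv (hA : g.IsSmoothAdjointPair A A') (x : M) :
    TangentSpace I x →ₗ[ℝ] TangentSpace I x →ₗ[ℝ] TangentSpace I x :=
  LinearMap.mk₂ ℝ (fun u v ↦ g.covDerivEnd A (smoothExtend v) x u)
    (fun u u' v ↦ by simp only [covDerivEnd, map_add]; abel)
    (fun c u v ↦ by simp only [covDerivEnd, map_smul, smul_sub])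
    -- `smoothExtend` rests on a choice and need not be linear; on the adjoint side only the vector
    -- v itself enters.
    (fun u v v' ↦ g.eq_of_forall_inner fun Z _ ↦ by
      have key : ∀ v, g.inner x (g.covDerivEnd A (smoothExtend v) x u) (Z x) =
          g.inner x v (g.covDerivEnd A' (smoothExtend (Z x)) x u) := fun v ↦ by
        have := hA.inner_covDerivEnd (isSmoothVectorField_smoothExtend v)
          (isSmoothVectorField_smoothExtend (Z x)) x u
        rwa [smoothExtend_apply_self, smoothExtend_apply_self] at this
      simp only [map_add, _root_.add_apply, key])
    (fun c u v ↦ g.eq_of_forall_inner fun Z _ ↦ by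
      have key : ∀ v, g.inner x (g.covDerivEnd A (smoothExtend v) x u) (Z x) =
          g.inner x v (g.covDerivEnd A' (smoothExtend (Z x)) x u) := fun v ↦ by
        have := hA.inner_covDerivEnd (isSmoothVectorField_smoothExtend v)
          (isSmoothVectorField_smoothExtend (Z x)) x u
        rwa [smoothExtend_apply_self, smoothExtend_apply_self] at this
      simp only [map_smul, _root_.smul_apply, key])

lemma covDeriv_apply (hA : g.IsSmoothAdjointPair A A') (hY : IsSmoothVectorField I Y) (x : M)
    (u : TangentSpace I x) : hA.covDeriv x u (Y x) = g.covDerivEnd A Y x u := by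
  refine g.eq_of_forall_inner fun Z _ ↦ ?_
  have h1 := hA.inner_covDerivEnd (isSmoothVectorField_smoothExtend (Y x))
    (isSmoothVectorField_smoothExtend (Z x)) x u
  have h2 := hA.inner_covDerivEnd hY (isSmoothVectorField_smoothExtend (Z x)) x u
  rw [smoothExtend_apply_self, smoothExtend_apply_self] at h1
  rw [smoothExtend_apply_self] at h2
  exact h1.trans h2.symm

lemma inner_covDeriv (hA : g.IsSmoothAdjointPair A A') (x : M) (u v w : TangentSpace I x) :
    g.inner x (hA.covDeriv x u v) w = g.inner x v (hA.symm.covDeriv x u w) := by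
  have := hA.inner_covDerivEnd (isSmoothVectorField_smoothExtend v)
    (isSmoothVectorField_smoothExtend w) x u
  rwa [smoothExtend_apply_self, smoothExtend_apply_self] at this

/-- The trace commutes with the covariant derivative: if `A` is traceless, so is `∇_u A`. -/
lemma sum_covDeriv_eq_zero (hA : g.IsSmoothAdjointPair A A')
    (htr : ∀ x, LinearMap.trace ℝ _ (A x : TangentSpace I x →ₗ[ℝ] TangentSpace I x) = 0) (x : M)
    (u : TangentSpace I x) : ∑ i, g.inner x (hA.covDeriv x u (tangentBasis I x i))
      (dualFamily (g.bilin x) (tangentBasis I x) i) = 0 := by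
  set b := tangentBasis I x
  set d := dualFamily (g.bilin x) b
  have hd : IsDualPair (g.bilin x) b d := g.isDualPair_tangentBasis x
  have hx := g.frameDet_self_ne_zero x
  have hfr := fun i ↦ isSmoothVectorField_frame (I := I) x i
  have hco := fun i ↦ (g.contMDiffAt_coframe hx i).mdifferentiableAt (by simp)
  have hcox : ∀ i, g.coframe x i x = d i := fun i ↦ by
    simp only [coframe, frame_apply_self]; rfl
  obtain ⟨U, hU, hUx⟩ : ∃ U : Π x : M, TangentSpace I x, MDiffAt (T% U) x ∧ U x = u :=
    ⟨_, (isSmoothVectorField_smoothExtend u).mdifferentiableAt x, smoothExtend_apply_self u⟩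
  -- Derivative of tr A, which near `x` is ∑ g(A eᵢ, eⁱ) and vanishes identically.
  have h1 : ∑ i, (g.inner x (g.leviCivita (fun y ↦ A y (frame I x i y)) x u) (d i) +
      g.inner x (A x (b i)) (g.leviCivita (g.coframe x i) x u)) = 0 := by
    have e1 : (fun y ↦ ∑ i, g.inner y (A y (frame I x i y)) (g.coframe x i y))
        =ᶠ[nhds x] fun _ ↦ 0 := by
      filter_upwards [g.eventually_frameDet_ne_zero x] with y hy
      rw [← htr y, (g.isDualPair_frame hy).trace_eq]
      rfl
    have hdiff : ∀ i, MDiffAt (fun y ↦ g.inner y (A y (frame I x i y)) (g.coframe x i y)) x :=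
      fun i ↦ g.mdifferentiableAt_inner ((hA.smooth_left (hfr i)).mdifferentiableAt x) (hco i)
    have e2 : d% (fun y ↦ ∑ i, g.inner y (A y (frame I x i y)) (g.coframe x i y)) x u = 0 := by
      exact mvfderiv_apply_eq_zero e1 u
    rw [mvfderiv_sum_apply _ fun i _ ↦ hdiff i] at e2
    rw [← e2]
    refine Finset.sum_congr rfl fun i _ ↦ ?_
    have := g.mvfderiv_inner hU ((hA.smooth_left (hfr i)).mdifferentiableAt x) (hco i)
    rw [hUx] at this
    rw [this, frame_apply_self, hcox]
  -- g(eᵢ, eʲ) is constant near `x`, so the derivatives of the coframe are determined by those of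
  -- the frame. Hence `h3`, which trades ∇eⁱ for the correction term A(∇eᵢ) in ∇A.
  have h2 : ∀ i j, g.inner x (g.leviCivita (frame I x i) x u) (d j)
      + g.inner x (b i) (g.leviCivita (g.coframe x j) x u) = 0 := by
    intro i j
    have e1 : (fun y ↦ g.inner y (frame I x i y) (g.coframe x j y))
        =ᶠ[nhds x] fun _ ↦ if i = j then 1 else 0 := by
      filter_upwards [g.eventually_frameDet_ne_zero x] with y hy
      exact inner_dualFamily (g.bilin_symm y) hy i j
    have := g.mvfderiv_inner hU ((hfr i).mdifferentiableAt x) (hco j)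
    rw [hUx, frame_apply_self, hcox] at this
    rw [← this]
    exact mvfderiv_apply_eq_zero e1 u
  have h3 : ∑ i, g.inner x (A x (b i)) (g.leviCivita (g.coframe x i) x u) =
      - ∑ i, g.inner x (A x (g.leviCivita (frame I x i) x u)) (d i) := by
    have e1 : ∀ i, g.inner x (A x (b i)) (g.leviCivita (g.coframe x i) x u) =
        - ∑ k, g.inner x (A x (b i)) (d k) * g.inner x (g.leviCivita (frame I x k) x u) (d i) := by
      intro i
      conv_lhs => rw [← hd.left (A x (b i))]
      simp only [map_sum, map_smul, FunLike.coe_sum, Finset.sum_apply, _root_.smul_apply,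
        smul_eq_mul, bilin_apply, ← Finset.sum_neg_distrib]
      refine Finset.sum_congr rfl fun k _ ↦ ?_
      linear_combination g.inner x (A x (b i)) (d k) * h2 k i
    have e2 : ∀ k, g.inner x (A x (g.leviCivita (frame I x k) x u)) (d k) =
        ∑ i, g.inner x (A x (b i)) (d k) * g.inner x (g.leviCivita (frame I x k) x u) (d i) := by
      intro k
      conv_lhs => rw [← hd.left (g.leviCivita (frame I x k) x u)]
      simp only [map_sum, map_smul, FunLike.coe_sum, Finset.sum_apply, _root_.smul_apply,
        smul_eq_mul, bilin_apply]
      exact Finset.sum_congr rfl fun k _ ↦ mul_comm _ _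
    simp only [e1, e2, Finset.sum_neg_distrib]
    rw [Finset.sum_comm]
  have h4 : ∀ i, hA.covDeriv x u (b i) = g.leviCivita (fun y ↦ A y (frame I x i y)) x u
      - A x (g.leviCivita (frame I x i) x u) := fun i ↦ by
    have := hA.covDeriv_apply (hfr i) x u
    rwa [frame_apply_self] at this
  simp only [h4, map_sub, _root_.sub_apply, Finset.sum_sub_distrib]
  rw [Finset.sum_add_distrib, h3] at h1
  linarith

end IsSmoothAdjointPair

end SemiRiemannianMetric

/-! ### The Lie derivative of the connection depends on germs -/

namespace SemiRiemannianMetric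

variable {E : Type*} [NormedAddCommGroup E] [NormedSpace ℝ E] {H : Type*} [TopologicalSpace H]
  {I : ModelWithCorners ℝ E H} {M : Type*} [TopologicalSpace M] [ChartedSpace H M]
  [IsManifold I ∞ M] (g : SemiRiemannianMetric I M) {V : Π x : M, TangentSpace I x}
  [FiniteDimensional ℝ E] [CompleteSpace E] [T2Space M] [I.Boundaryless]

/-- `FiberBundle.extend` is only known to be smooth near `x`, while the calculus above is for
globally smooth fields. Brackets and covariant derivatives depend on germs, so the extensions may be
exchanged. -/
lemma lieDerivConnection_extend (hV : IsSmoothVectorField I V) (x : M) (u v : TangentSpace I x) :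
    g.lieDerivConnection V (FiberBundle.extend E u) (FiberBundle.extend E v) x =
    g.lieDerivConnection V (smoothExtend u) (smoothExtend v) x := by
  set X := FiberBundle.extend E u
  set Y := FiberBundle.extend E v
  have hX : X =ᶠ[nhds x] smoothExtend u := (smoothExtend_eventuallyEq u).mono fun y hy ↦ hy.symm
  have hY : Y =ᶠ[nhds x] smoothExtend v := (smoothExtend_eventuallyEq v).mono fun y hy ↦ hy.symm
  have sv := isSmoothVectorField_smoothExtend v
  have dY : ∀ᶠ y in nhds x, MDiffAt (T% Y) y := by
    filter_upwards [hY.eventuallyEq_nhds] with y hy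
    refine (sv.mdifferentiableAt y).congr_of_eventuallyEq ?_
    filter_upwards [hy] with z hz
    rw [hz]
  have e1 : (fun y ↦ g.leviCivita Y y (X y)) =ᶠ[nhds x]
      fun y ↦ g.leviCivita (smoothExtend v) y (smoothExtend u y) := by
    filter_upwards [hX, hY.eventuallyEq_nhds, dY] with y hy hy' hy''
    rw [hy, g.leviCivita_congr hy'' (sv.mdifferentiableAt y) hy']
  have e2 : (fun y ↦ mlieBracket I V Y y) =ᶠ[nhds x]
      fun y ↦ mlieBracket I V (smoothExtend v) y :=
    (Filter.EventuallyEq.refl _ V).mlieBracket_vectorField hY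
  have s2 := hV.mlieBracket sv
  have d2 : MDiffAt (T% (fun y ↦ mlieBracket I V Y y)) x := by
    refine (s2.mdifferentiableAt x).congr_of_eventuallyEq ?_
    filter_upwards [e2] with z hz
    rw [hz]
  rw [lieDerivConnection, lieDerivConnection,
    (Filter.EventuallyEq.refl _ V).mlieBracket_vectorField_eq e1,
    (Filter.EventuallyEq.refl _ V).mlieBracket_vectorField_eq hX,
    g.leviCivita_congr dY.self_of_nhds (sv.mdifferentiableAt x) hY,
    g.leviCivita_congr d2 (s2.mdifferentiableAt x) e2, hX.self_of_nhds]

end SemiRiemannianMetric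

/-! ### Paracontact geometry and the trace of L_ξ ∇ -/

namespace ParacontactMetricStructure

variable {n : ℕ} {M : Type*} [TopologicalSpace M] [T2Space M]
  [ChartedSpace (EuclideanSpace ℝ (Fin (2 * n + 1))) M] [IsManifold (𝓡 (2 * n + 1)) ∞ M]
  (S : ParacontactMetricStructure n M) {X Y : Π x : M, TangentSpace (𝓡 (2 * n + 1)) x}

/-- The endomorphism field `∇ξ`. -/
def nablaξ (x : M) : TangentSpace (𝓡 (2 * n + 1)) x →L[ℝ] TangentSpace (𝓡 (2 * n + 1)) x :=
  S.g.leviCivita S.ξ x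

lemma isSmoothVectorField_φ (hX : IsSmoothVectorField (𝓡 (2 * n + 1)) X) :
    IsSmoothVectorField (𝓡 (2 * n + 1)) (fun x ↦ S.φ x (X x)) :=
  ContMDiff.clm_bundle_apply S.contMDiff_φ hX

lemma isSmoothVectorField_nablaξ (hX : IsSmoothVectorField (𝓡 (2 * n + 1)) X) :
    IsSmoothVectorField (𝓡 (2 * n + 1)) (fun x ↦ S.nablaξ x (X x)) :=
  S.g.isSmoothVectorField_leviCivita hX S.contMDiff_ξ

lemma inner_ξ_ξ (x : M) : S.g.inner x (S.ξ x) (S.ξ x) = 1 := by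
  rw [← S.η_eq, S.η_ξ]

lemma inner_nablaξ_ξ (x : M) (u : TangentSpace (𝓡 (2 * n + 1)) x) :
    S.g.inner x (S.nablaξ x u) (S.ξ x) = 0 := by
  have h := SemiRiemannianMetric.mvfderiv_inner_apply (g := S.g) S.contMDiff_ξ S.contMDiff_ξ x u
  rw [mvfderiv_apply_eq_zero (c := 1) (Filter.Eventually.of_forall S.inner_ξ_ξ),
    S.g.symm x (S.ξ x)] at h
  rw [nablaξ]
  linarith

/-- Torsion-freeness turns dη into the skew part of ∇ξ. The factor 2 undoes the ½ in the
normalization of dη. -/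
lemma inner_nablaξ_sub (x : M) (u v : TangentSpace (𝓡 (2 * n + 1)) x) :
    S.g.inner x (S.nablaξ x u) v - S.g.inner x (S.nablaξ x v) u = 2 * S.g.inner x u (S.φ x v) := by
  have hu := isSmoothVectorField_smoothExtend u
  have hv := isSmoothVectorField_smoothExtend v
  have h := S.dη_eq _ _ hu hv x
  simp only [extDerivOneForm, S.η_eq] at h
  rw [SemiRiemannianMetric.mvfderiv_inner_apply (g := S.g) S.contMDiff_ξ hv,
    SemiRiemannianMetric.mvfderiv_inner_apply (g := S.g) S.contMDiff_ξ hu,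
    S.g.mlieBracket_eq (hu.mdifferentiableAt x) (hv.mdifferentiableAt x)] at h
  simp only [smoothExtend_apply_self, map_sub] at h
  rw [nablaξ]
  linarith

/-- The left side of `inner_nablaξ_sub` changes sign when u and v are exchanged. -/
lemma inner_φ_left (x : M) (u v : TangentSpace (𝓡 (2 * n + 1)) x) :
    S.g.inner x (S.φ x u) v = - S.g.inner x u (S.φ x v) := by
  have h1 := S.inner_nablaξ_sub x u v
  have h2 := S.inner_nablaξ_sub x v u
  rw [S.g.symm]
  linarith

lemma isSmoothAdjointPair_φ : S.g.IsSmoothAdjointPair S.φ (fun x ↦ -S.φ x) where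
  smooth_left hX := S.isSmoothVectorField_φ hX
  smooth_right {X} hX := by
    have := (S.isSmoothVectorField_φ hX).const_smul (-1)
    have e : (-1 : ℝ) • (fun x ↦ S.φ x (X x)) = fun x ↦ (-S.φ x) (X x) := by ext x; simp
    rwa [e] at this
  adjoint x v w := by simp [S.inner_φ_left]

lemma isSmoothAdjointPair_nablaξ :
    S.g.IsSmoothAdjointPair S.nablaξ (fun x ↦ S.nablaξ x + (2 : ℝ) • S.φ x) where
  smooth_left hX := S.isSmoothVectorField_nablaξ hX
  smooth_right {X} hX :=
    (S.isSmoothVectorField_nablaξ hX).add ((S.isSmoothVectorField_φ hX).const_smul 2)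
  adjoint x v w := by
    have := S.inner_nablaξ_sub x v w
    rw [S.g.symm x (S.nablaξ x w)] at this
    simp only [_root_.add_apply, _root_.smul_apply, map_add, map_smul, smul_eq_mul]
    linarith

/-- Ricci identity for ξ; the minus sign comes from the convention R(X, Y) = ∇_[X, Y] - [∇_X, ∇_Y].
-/
lemma covDerivEnd_nablaξ_sub (hX : IsSmoothVectorField (𝓡 (2 * n + 1)) X)
    (hY : IsSmoothVectorField (𝓡 (2 * n + 1)) Y) (x : M) :
    S.g.covDerivEnd S.nablaξ Y x (X x) - S.g.covDerivEnd S.nablaξ X x (Y x) =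
      - S.g.curvature X Y S.ξ x := by
  simp only [SemiRiemannianMetric.covDerivEnd, SemiRiemannianMetric.curvature, nablaξ,
    S.g.mlieBracket_eq (hX.mdifferentiableAt x) (hY.mdifferentiableAt x), map_sub]
  abel

lemma covDeriv_nablaξ_sub (hX : IsSmoothVectorField (𝓡 (2 * n + 1)) X)
    (hY : IsSmoothVectorField (𝓡 (2 * n + 1)) Y) (x : M) :
    S.isSmoothAdjointPair_nablaξ.covDeriv x (X x) (Y x)
      - S.isSmoothAdjointPair_nablaξ.covDeriv x (Y x) (X x) = - S.g.curvature X Y S.ξ x := by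
  rw [S.isSmoothAdjointPair_nablaξ.covDeriv_apply hX, S.isSmoothAdjointPair_nablaξ.covDeriv_apply hY,
    S.covDerivEnd_nablaξ_sub hX hY]

/-- Leibniz rule applied to φ² = I - η ⊗ ξ. -/
lemma covDeriv_φ_φ (hY : IsSmoothVectorField (𝓡 (2 * n + 1)) Y) (x : M)
    (u : TangentSpace (𝓡 (2 * n + 1)) x) :
    S.g.covDerivEnd S.φ (fun y ↦ S.φ y (Y y)) x u + S.φ x (S.g.covDerivEnd S.φ Y x u) =
      -(S.g.inner x (S.nablaξ x u) (Y x) • S.ξ x)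
        - S.g.inner x (S.ξ x) (Y x) • S.nablaξ x u := by
  have hf : ContMDiff (𝓡 (2 * n + 1)) 𝓘(ℝ, ℝ) ∞ (fun y ↦ S.g.inner y (S.ξ y) (Y y)) :=
    S.g.contMDiff_inner S.contMDiff_ξ hY
  have h1 : (fun y ↦ S.φ y (S.φ y (Y y))) = Y - (fun y ↦ S.g.inner y (S.ξ y) (Y y)) • S.ξ := by
    ext1 y
    rw [S.φ_φ, S.η_eq]
    rfl
  have h2 := SemiRiemannianMetric.mvfderiv_inner_apply (g := S.g) S.contMDiff_ξ hY x u
  rw [SemiRiemannianMetric.covDerivEnd, SemiRiemannianMetric.covDerivEnd, h1, map_sub, S.φ_φ,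
    S.η_eq]
  rw [S.g.leviCivita_sub (hY.mdifferentiableAt x) ((S.contMDiff_ξ.smul hf).mdifferentiableAt x),
    S.g.leviCivita_smul (hf.mdifferentiableAt (by simp)) (S.contMDiff_ξ.mdifferentiableAt x)]
  simp only [_root_.sub_apply, _root_.add_apply, _root_.smul_apply,
    ContinuousLinearMap.smulRight_apply, h2, nablaξ]
  module

/-- Passage from geometry to algebra. `T_skew` and `N_adjoint` are derivatives of the adjunctions
for φ and ∇ξ. For `cyclic`, the Ricci identity and skew-adjointness of the curvature lead to g(ξ,
R(u, v)w), whose cyclic sum is zero by the first Bianchi identity. -/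
lemma paracontactPoint (x : M) : ParacontactPoint (S.g.bilin x) (S.φ x).toLinearMap
    (S.nablaξ x).toLinearMap (S.ξ x) (S.isSmoothAdjointPair_φ.covDeriv x)
    (S.isSmoothAdjointPair_nablaξ.covDeriv x) where
  symm := S.g.bilin_symm x
  inner_ξ := S.inner_ξ_ξ x
  φ_skew := S.inner_φ_left x
  φ_φ v := by
    have := S.φ_φ x v
    rwa [S.η_eq] at this
  P_adjoint u v := S.isSmoothAdjointPair_nablaξ.adjoint x u v
  inner_P_ξ := S.inner_nablaξ_ξ x
  T_skew u v w := by
    have h := S.isSmoothAdjointPair_φ.inner_covDeriv x u v w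
    have hw := isSmoothVectorField_smoothExtend w
    have h2 := S.isSmoothAdjointPair_φ.symm.covDeriv_apply hw x u
    have h3 := S.isSmoothAdjointPair_φ.covDeriv_apply hw x u
    have h4 := S.g.leviCivita_const_smul (-1) ((S.isSmoothVectorField_φ hw).mdifferentiableAt x)
    have e : (fun y ↦ (-S.φ y) (smoothExtend w y)) =
      (-1 : ℝ) • (fun y ↦ S.φ y (smoothExtend w y)) := by ext y; simp
    rw [smoothExtend_apply_self] at h2 h3
    rw [SemiRiemannianMetric.bilin_apply, SemiRiemannianMetric.bilin_apply, h, h2, h3]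
    simp only [SemiRiemannianMetric.covDerivEnd]
    rw [e, h4]
    simp only [_root_.smul_apply, _root_.neg_apply, map_sub, map_neg, map_smul, smul_eq_mul]
    ring
  N_adjoint u v w := by
    have h := S.isSmoothAdjointPair_nablaξ.inner_covDeriv x u v w
    have hw := isSmoothVectorField_smoothExtend w
    have h2 := S.isSmoothAdjointPair_nablaξ.symm.covDeriv_apply hw x u
    have h3 := S.isSmoothAdjointPair_nablaξ.covDeriv_apply hw x u
    have h3' := S.isSmoothAdjointPair_φ.covDeriv_apply hw x u
    have h4 := S.g.leviCivita_add ((S.isSmoothVectorField_nablaξ hw).mdifferentiableAt x)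
      (((S.isSmoothVectorField_φ hw).const_smul 2).mdifferentiableAt x)
    have h5 := S.g.leviCivita_const_smul 2 ((S.isSmoothVectorField_φ hw).mdifferentiableAt x)
    have e : (fun y ↦ (S.nablaξ y + (2 : ℝ) • S.φ y) (smoothExtend w y)) =
      (fun y ↦ S.nablaξ y (smoothExtend w y)) + (2 : ℝ) • (fun y ↦ S.φ y (smoothExtend w y)) := rfl
    rw [smoothExtend_apply_self] at h2 h3 h3'
    rw [SemiRiemannianMetric.bilin_apply, SemiRiemannianMetric.bilin_apply, h, h2, h3, h3']
    simp only [SemiRiemannianMetric.covDerivEnd]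
    rw [e, h4, h5]
    simp only [_root_.smul_apply, _root_.add_apply, map_sub, map_add, map_smul, smul_eq_mul]
    ring
  T_φ u v := by
    have hv := isSmoothVectorField_smoothExtend v
    have h := S.covDeriv_φ_φ hv x u
    rw [← S.isSmoothAdjointPair_φ.covDeriv_apply hv,
      ← S.isSmoothAdjointPair_φ.covDeriv_apply (S.isSmoothVectorField_φ hv),
      smoothExtend_apply_self] at h
    exact h
  cyclic u v w := by
    have key : ∀ u v w : TangentSpace (𝓡 (2 * n + 1)) x, S.g.bilin x
        (S.isSmoothAdjointPair_nablaξ.covDeriv x u v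
          - S.isSmoothAdjointPair_nablaξ.covDeriv x v u) w =
        S.g.inner x (S.ξ x)
          (S.g.curvature (smoothExtend u) (smoothExtend v) (smoothExtend w) x) := by
      intro u v w
      have hu := isSmoothVectorField_smoothExtend u
      have hv := isSmoothVectorField_smoothExtend v
      have hw := isSmoothVectorField_smoothExtend w
      have h1 := S.covDeriv_nablaξ_sub hu hv x
      have h2 := S.g.inner_curvature_swap (x := x) hu hv S.contMDiff_ξ hw
      rw [smoothExtend_apply_self, smoothExtend_apply_self] at h1
      rw [smoothExtend_apply_self] at h2
      rw [h1, SemiRiemannianMetric.bilin_apply, map_neg, _root_.neg_apply, h2, neg_neg]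
    rw [key, key, key, ← map_add, ← map_add, S.g.curvature_bianchi, map_zero] <;>
    exact isSmoothVectorField_smoothExtend _

lemma finrank_tangentSpace_eq (x : M) :
    Module.finrank ℝ (TangentSpace (𝓡 (2 * n + 1)) x) = 2 * n + 1 := by
  rw [SemiRiemannianMetric.finrank_tangentSpace]
  simp

/-- The endomorphism field `∇ξ` has vanishing trace. -/
lemma trace_nablaξ (x : M) : LinearMap.trace ℝ _ (S.nablaξ x).toLinearMap = 0 := by
  rw [(S.g.isDualPair_tangentBasis x).trace_eq]
  exact (S.paracontactPoint x).sum_P (S.g.isDualPair_tangentBasis x)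

/-- Torsion-freeness replaces both brackets; the two derivatives along ξ combine into (∇_ξ φ)X. -/
lemma h_eq (hX : IsSmoothVectorField (𝓡 (2 * n + 1)) X) (x : M) :
    S.h X x = (2⁻¹ : ℝ) • (S.isSmoothAdjointPair_φ.covDeriv x (S.ξ x) (X x)
      - S.nablaξ x (S.φ x (X x)) + S.φ x (S.nablaξ x (X x))) := by
  rw [h, S.g.mlieBracket_eq (S.contMDiff_ξ.mdifferentiableAt x) (hX.mdifferentiableAt x),
    S.g.mlieBracket_eq (S.contMDiff_ξ.mdifferentiableAt x)
      ((S.isSmoothVectorField_φ hX).mdifferentiableAt x),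
    S.isSmoothAdjointPair_φ.covDeriv_apply hX, SemiRiemannianMetric.covDerivEnd, nablaξ, map_sub]
  congr 1
  abel

namespace IsKappaMuSpace

variable {S} {κ μ : M → ℝ} (hS : S.IsKappaMuSpace κ μ)
include hS

lemma curvature_eq (x : M) (u v : TangentSpace (𝓡 (2 * n + 1)) x) :
    S.g.curvature (smoothExtend u) (smoothExtend v) S.ξ x =
      κ x • (S.g.bilin x (S.ξ x) u • v - S.g.bilin x (S.ξ x) v • u)
      + μ x • (S.g.bilin x (S.ξ x) u • (2⁻¹ : ℝ) • (S.isSmoothAdjointPair_φ.covDeriv x (S.ξ x) v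
          - (S.nablaξ x).toLinearMap ((S.φ x).toLinearMap v)
          + (S.φ x).toLinearMap ((S.nablaξ x).toLinearMap v))
        - S.g.bilin x (S.ξ x) v • (2⁻¹ : ℝ) • (S.isSmoothAdjointPair_φ.covDeriv x (S.ξ x) u
          - (S.nablaξ x).toLinearMap ((S.φ x).toLinearMap u)
          + (S.φ x).toLinearMap ((S.nablaξ x).toLinearMap u))) := by
  have hu := isSmoothVectorField_smoothExtend u
  have hv := isSmoothVectorField_smoothExtend v
  have := hS.curvature_ξ _ _ hu hv x
  rw [S.h_eq hu, S.h_eq hv, S.η_eq, S.η_eq] at this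
  simp only [smoothExtend_apply_self] at this
  exact this

lemma covDeriv_sub_eq (x : M) (u v : TangentSpace (𝓡 (2 * n + 1)) x) :
    S.isSmoothAdjointPair_nablaξ.covDeriv x u v - S.isSmoothAdjointPair_nablaξ.covDeriv x v u =
      -S.g.curvature (smoothExtend u) (smoothExtend v) S.ξ x := by
  have := S.covDeriv_nablaξ_sub (isSmoothVectorField_smoothExtend u)
    (isSmoothVectorField_smoothExtend v) x
  simpa using this

/-- The rough Laplacian of ξ, used in both halves of the theorem: its coefficient decides when ξ is
1-harmonic, and its direction makes ξ harmonic. -/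
lemma sum_covDeriv (x : M) (w : TangentSpace (𝓡 (2 * n + 1)) x) :
    ∑ i, S.g.inner x (S.isSmoothAdjointPair_nablaξ.covDeriv x (SemiRiemannianMetric.tangentBasis (𝓡 (2 * n + 1)) x i)
      (dualFamily (S.g.bilin x) (SemiRiemannianMetric.tangentBasis (𝓡 (2 * n + 1)) x) i)) w =
    (2 * n * κ x + 4 * n) * S.g.inner x (S.ξ x) w :=
  (S.paracontactPoint x).sum_N (hS.covDeriv_sub_eq x) (S.g.isDualPair_tangentBasis x)
    (finrank_tangentSpace_eq x) (hS.curvature_eq x)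
    (S.isSmoothAdjointPair_nablaξ.sum_covDeriv_eq_zero S.trace_nablaξ x) w

lemma sum_curvature (x : M) (w : TangentSpace (𝓡 (2 * n + 1)) x) :
    ∑ i, S.g.inner x (S.g.curvature (smoothExtend (SemiRiemannianMetric.tangentBasis (𝓡 (2 * n + 1)) x i))
      (smoothExtend w) S.ξ x) (dualFamily (S.g.bilin x) (SemiRiemannianMetric.tangentBasis (𝓡 (2 * n + 1)) x) i) =
    -(2 * n * κ x) * S.g.inner x (S.ξ x) w :=
  (S.paracontactPoint x).sum_curvature (S.g.isDualPair_tangentBasis x)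
    (finrank_tangentSpace_eq x) (hS.curvature_eq x) w

end IsKappaMuSpace

/-- The Lie derivative of the Levi-Civita connection along `ξ` in terms of the curvature. -/
lemma lieDerivConnection_ξ (hX : IsSmoothVectorField (𝓡 (2 * n + 1)) X)
    (hY : IsSmoothVectorField (𝓡 (2 * n + 1)) Y) (x : M) :
    S.g.lieDerivConnection S.ξ X Y x = -S.g.curvature S.ξ X Y x
      + S.isSmoothAdjointPair_nablaξ.covDeriv x (X x) (Y x) := by
  have hξ := S.contMDiff_ξ
  have h1 : (fun y ↦ mlieBracket (𝓡 (2 * n + 1)) S.ξ Y y) =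
      (fun y ↦ S.g.leviCivita Y y (S.ξ y)) - fun y ↦ S.g.leviCivita S.ξ y (Y y) :=
    funext fun y ↦ S.g.mlieBracket_eq (hξ.mdifferentiableAt y) (hY.mdifferentiableAt y)
  rw [S.isSmoothAdjointPair_nablaξ.covDeriv_apply hY, SemiRiemannianMetric.covDerivEnd,
    SemiRiemannianMetric.lieDerivConnection, h1, S.g.leviCivita_sub
      ((S.g.isSmoothVectorField_leviCivita hξ hY).mdifferentiableAt x)
      ((S.g.isSmoothVectorField_leviCivita hY hξ).mdifferentiableAt x),
    S.g.mlieBracket_eq (hξ.mdifferentiableAt x)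
      ((S.g.isSmoothVectorField_leviCivita hX hY).mdifferentiableAt x)]
  simp only [SemiRiemannianMetric.curvature, nablaξ, _root_.sub_apply]
  abel

namespace IsKappaMuSpace

variable {S} {κ μ : M → ℝ} (hS : S.IsKappaMuSpace κ μ)
include hS

/-- The trace of the Lie derivative of the Levi-Civita connection along `ξ`. -/
lemma metricTrace_lieDerivConnection (x : M) : S.g.metricTrace x (fun u w ↦
    S.g.lieDerivConnection S.ξ (FiberBundle.extend (EuclideanSpace ℝ (Fin (2 * n + 1))) u)
      (FiberBundle.extend (EuclideanSpace ℝ (Fin (2 * n + 1))) w) x) =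
    (4 * n * (1 + κ x)) • S.ξ x := by
  refine S.g.eq_of_forall_inner fun Z _ ↦ ?_
  set w := Z x
  have hξ := S.contMDiff_ξ
  -- The curvature is defined on fields; its linearity in u is read off from the (κ, μ)-formula.
  let L₁ : TangentSpace (𝓡 (2 * n + 1)) x →ₗ[ℝ] TangentSpace (𝓡 (2 * n + 1)) x →ₗ[ℝ] ℝ :=
    LinearMap.mk₂ ℝ (fun u v ↦ S.g.inner x (S.g.curvature (smoothExtend u) (smoothExtend w) S.ξ x) v)
      (fun u v v' ↦ by
        simp only [hS.curvature_eq, map_add, map_sub, map_smul,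
          _root_.add_apply, _root_.sub_apply, _root_.smul_apply, smul_eq_mul]
        ring)
      (fun c u v ↦ by
        simp only [hS.curvature_eq, map_add, map_sub, map_smul,
          _root_.add_apply, _root_.sub_apply, _root_.smul_apply, smul_eq_mul]
        ring)
      (fun u u' v ↦ by simp only [map_add])
      (fun c u v ↦ by simp only [map_smul])
  let L₂ : TangentSpace (𝓡 (2 * n + 1)) x →ₗ[ℝ] TangentSpace (𝓡 (2 * n + 1)) x →ₗ[ℝ] ℝ :=
    (S.isSmoothAdjointPair_nablaξ.covDeriv x).compr₂ ((S.g.bilin x).flip w)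
  -- Pair symmetry moves ξ into the slot that the (κ, μ)-condition controls.
  have key : ∀ u v, S.g.inner x (S.g.lieDerivConnection S.ξ
      (FiberBundle.extend (EuclideanSpace ℝ (Fin (2 * n + 1))) u)
      (FiberBundle.extend (EuclideanSpace ℝ (Fin (2 * n + 1))) v) x) w =
      (-L₁.flip + L₂) u v := by
    intro u v
    have su := isSmoothVectorField_smoothExtend u
    have sv := isSmoothVectorField_smoothExtend v
    have sw := isSmoothVectorField_smoothExtend w
    have h1 := S.g.inner_curvature_pair_symm (x := x) hξ su sv sw
    rw [smoothExtend_apply_self, smoothExtend_apply_self] at h1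
    rw [S.g.lieDerivConnection_extend hξ, S.lieDerivConnection_ξ su sv, map_add, map_neg,
      _root_.add_apply, _root_.neg_apply, h1, smoothExtend_apply_self, smoothExtend_apply_self]
    rfl
  have h2 := S.g.metricTrace_eq_sum x (-L₁.flip + L₂)
  have hd := S.g.isDualPair_tangentBasis x
  have h3 := hd.sum_swap (S.g.bilin_symm x) L₁
  have h4 := hS.sum_curvature x w
  have h5 := hS.sum_covDeriv x w
  simp only [LinearMap.add_apply, LinearMap.neg_apply, LinearMap.flip_apply,
    Finset.sum_add_distrib, Finset.sum_neg_distrib, h3] at h2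
  have h6 : S.g.inner x (S.g.metricTrace x fun u w ↦ S.g.lieDerivConnection S.ξ
      (FiberBundle.extend (EuclideanSpace ℝ (Fin (2 * n + 1))) u)
      (FiberBundle.extend (EuclideanSpace ℝ (Fin (2 * n + 1))) w) x) w =
      S.g.metricTrace x (fun u v ↦ (-L₁.flip + L₂) u v) := by
    simp only [SemiRiemannianMetric.metricTrace, map_sum, map_smul, FunLike.coe_sum,
      Finset.sum_apply, _root_.smul_apply, key]
  rw [h6]
  refine h2.trans ?_
  -- The coefficient is -(-2nκ) + (2nκ + 4n) = 4n(1 + κ).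
  refine (congrArg₂ (fun a b : ℝ ↦ -a + b) h4 h5).trans ?_
  simp only [map_smul, _root_.smul_apply, smul_eq_mul]
  ring

/-- `ξ` is an infinitesimal harmonic transformation if and only if `κ = -1`. -/
lemma isInfinitesimalHarmonicTransformation_iff (hn : 1 ≤ n) :
    S.g.IsInfinitesimalHarmonicTransformation S.ξ ↔ ∀ x, κ x = -1 := by
  refine forall_congr' fun x ↦ ?_
  rw [hS.metricTrace_lieDerivConnection, smul_eq_zero]
  have h0 : S.ξ x ≠ 0 := fun h ↦ by
    have := S.inner_ξ_ξ x
    rw [h] at this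
    simp at this
  have hn' : (n : ℝ) ≠ 0 := by positivity
  simp only [h0, or_false, mul_eq_zero, hn', OfNat.ofNat_ne_zero, false_or]
  constructor <;> intro h <;> linarith

end IsKappaMuSpace

end ParacontactMetricStructure

/-! ### Smooth functions depending on a parameter -/

section Parametric

variable {E : Type*} [NormedAddCommGroup E] [NormedSpace ℝ E] {H : Type*} [TopologicalSpace H]
  {I : ModelWithCorners ℝ E H} [I.Boundaryless] {M : Type*} [TopologicalSpace M]
  [ChartedSpace H M] [IsManifold I ∞ M] {X : Π x : M, TangentSpace I x} {f : ℝ × M → ℝ}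

lemma contDiffAt_comp_prodMap_extChartAt_symm (hf : ContMDiff (𝓘(ℝ, ℝ).prod I) 𝓘(ℝ, ℝ) ∞ f) (p : M)
    (t : ℝ) {y : E} (hy : y ∈ (extChartAt I p).target) :
    ContDiffAt ℝ ∞ (fun q : ℝ × E ↦ f (q.1, (extChartAt I p).symm q.2)) (t, y) := by
  have h1 : ContMDiffAt 𝓘(ℝ, ℝ × E) 𝓘(ℝ, ℝ) ∞ (Prod.fst : ℝ × E → ℝ) (t, y) :=
    contDiff_fst.contMDiff.contMDiffAt
  have h2 : ContMDiffAt 𝓘(ℝ, ℝ × E) 𝓘(ℝ, E) ∞ (Prod.snd : ℝ × E → E) (t, y) :=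
    contDiff_snd.contMDiff.contMDiffAt
  have h3 : ContMDiffAt 𝓘(ℝ, ℝ × E) I ∞ (fun q : ℝ × E ↦ (extChartAt I p).symm q.2) (t, y) :=
    (contMDiffAt_extChartAt_symm p hy).comp (t, y) h2
  exact contMDiffAt_iff_contDiffAt.1 ((hf.contMDiffAt).comp (t, y) (h1.prodMk h3))

lemma contMDiffAt_comp_prodMap_extChartAt {G : ℝ × E → ℝ} (t : ℝ) (x : M)
    (hG : ContDiffAt ℝ ∞ G (t, extChartAt I x x)) :
    ContMDiffAt (𝓘(ℝ, ℝ).prod I) 𝓘(ℝ, ℝ) ∞ (fun q : ℝ × M ↦ G (q.1, extChartAt I x q.2)) (t, x) := by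
  have h2 : ContMDiffAt (𝓘(ℝ, ℝ).prod I) 𝓘(ℝ, E) ∞ (fun q : ℝ × M ↦ extChartAt I x q.2) (t, x) :=
    (contMDiffAt_extChartAt (I := I) (x := x) (n := ∞)).comp (t, x) contMDiffAt_snd
  have h3 : ContMDiffAt (𝓘(ℝ, ℝ).prod I) 𝓘(ℝ, ℝ × E) ∞
      (fun q : ℝ × M ↦ (q.1, extChartAt I x q.2)) (t, x) := contMDiffAt_fst.prodMk_space h2
  exact ContMDiffAt.comp (t, x) (I' := 𝓘(ℝ, ℝ × E)) (g := G) hG.contMDiffAt h3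

lemma hasDerivAt_comp_fst (hf : ContMDiff (𝓘(ℝ, ℝ).prod I) 𝓘(ℝ, ℝ) ∞ f) (p : M)
    (t : ℝ) {y : E} (hy : y ∈ (extChartAt I p).target) :
    HasDerivAt (fun s ↦ f (s, (extChartAt I p).symm y))
      (fderiv ℝ (fun q : ℝ × E ↦ f (q.1, (extChartAt I p).symm q.2)) (t, y) (1, 0)) t := by
  have h := ((contDiffAt_comp_prodMap_extChartAt_symm hf p t hy).differentiableAt
    (by simp)).hasFDerivAt
  exact h.comp_hasDerivAt t ((hasDerivAt_id t).prodMk (hasDerivAt_const t y))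

lemma mvfderiv_comp_snd (hf : ContMDiff (𝓘(ℝ, ℝ).prod I) 𝓘(ℝ, ℝ) ∞ f) (p : M)
    (t : ℝ) {y : E} (hy : y ∈ (extChartAt I p).target) :
    d% (fun x ↦ f (t, x)) ((extChartAt I p).symm y) (X ((extChartAt I p).symm y)) =
      fderiv ℝ (fun q : ℝ × E ↦ f (q.1, (extChartAt I p).symm q.2)) (t, y)
        (0, chartRep I p X y) := by
  have h := ((contDiffAt_comp_prodMap_extChartAt_symm hf p t hy).differentiableAt
    (by simp)).hasFDerivAt
  have h2 : HasFDerivAt ((fun x ↦ f (t, x)) ∘ (extChartAt I p).symm) _ y :=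
    h.comp y ((hasFDerivAt_const t y).prodMk (hasFDerivAt_id y))
  have h3 : CMDiff ∞ (fun x ↦ f (t, x)) := hf.comp (contMDiff_const.prodMk contMDiff_id)
  rw [← fderiv_comp_symm_chartRep p X hy (h3.contMDiffAt.mdifferentiableAt (by simp)), h2.fderiv]
  rfl

/-- The derivative of a smooth function on `ℝ × M` with respect to the parameter is smooth. -/
lemma contMDiff_deriv_fst (hf : ContMDiff (𝓘(ℝ, ℝ).prod I) 𝓘(ℝ, ℝ) ∞ f) :
    ContMDiff (𝓘(ℝ, ℝ).prod I) 𝓘(ℝ, ℝ) ∞ (fun p : ℝ × M ↦ deriv (fun s ↦ f (s, p.2)) p.1) := by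
  rintro ⟨t, x⟩
  have hF := contDiffAt_comp_prodMap_extChartAt_symm hf x t (mem_extChartAt_target (I := I) x)
  have hF' := (hF.fderiv_right (m := ∞) (by simp)).clm_apply
    (contDiffAt_const (c := ((1, 0) : ℝ × E)))
  refine (contMDiffAt_comp_prodMap_extChartAt t x hF').congr_of_eventuallyEq ?_
  have hs : ∀ᶠ q : ℝ × M in nhds (t, x), q.2 ∈ (extChartAt I x).source :=
    continuous_snd.continuousAt.eventually (extChartAt_source_mem_nhds (I := I) x)
  filter_upwards [hs] with q hq
  have := (hasDerivAt_comp_fst hf x q.1 ((extChartAt I x).map_source hq)).deriv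
  rwa [(extChartAt I x).left_inv hq] at this

lemma hasDerivAt_fst (hf : ContMDiff (𝓘(ℝ, ℝ).prod I) 𝓘(ℝ, ℝ) ∞ f) (t : ℝ) (x : M) :
    HasDerivAt (fun s ↦ f (s, x)) (deriv (fun s ↦ f (s, x)) t) t := by
  have := (hasDerivAt_comp_fst hf x t (mem_extChartAt_target (I := I) x))
  rw [extChartAt_to_inv] at this
  exact this.differentiableAt.hasDerivAt

variable [CompleteSpace E]

/-- The derivative of a smooth function on `ℝ × M` along a smooth vector field on `M` is smooth. -/
lemma contMDiff_mvfderiv_snd (hf : ContMDiff (𝓘(ℝ, ℝ).prod I) 𝓘(ℝ, ℝ) ∞ f)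
    (hX : IsSmoothVectorField I X) :
    ContMDiff (𝓘(ℝ, ℝ).prod I) 𝓘(ℝ, ℝ) ∞ (fun p : ℝ × M ↦ d% (fun y ↦ f (p.1, y)) p.2 (X p.2)) := by
  rintro ⟨t, x⟩
  have hy := mem_extChartAt_target (I := I) x
  have hF := contDiffAt_comp_prodMap_extChartAt_symm hf x t hy
  have hX' : ContDiffAt ℝ ∞ (fun q : ℝ × E ↦ ((0 : ℝ), chartRep I x X q.2)) (t, extChartAt I x x) :=
    contDiffAt_const.prodMk ((hX.contDiffAt_chartRep x hy).comp
      ((t, extChartAt I x x) : ℝ × E) contDiffAt_snd)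
  have hF' := (hF.fderiv_right (m := ∞) (by simp)).clm_apply hX'
  refine (contMDiffAt_comp_prodMap_extChartAt t x hF').congr_of_eventuallyEq ?_
  have hs : ∀ᶠ q : ℝ × M in nhds (t, x), q.2 ∈ (extChartAt I x).source :=
    continuous_snd.continuousAt.eventually (extChartAt_source_mem_nhds (I := I) x)
  filter_upwards [hs] with q hq
  have := mvfderiv_comp_snd (X := X) hf x q.1 ((extChartAt I x).map_source hq)
  rwa [(extChartAt I x).left_inv hq] at this

/-- Differentiation with respect to the parameter commutes with differentiation along a vector
field. -/
lemma hasDerivAt_mvfderiv_snd (hf : ContMDiff (𝓘(ℝ, ℝ).prod I) 𝓘(ℝ, ℝ) ∞ f)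
    (t : ℝ) (x : M) :
    HasDerivAt (fun s ↦ d% (fun y ↦ f (s, y)) x (X x))
      (d% (fun y ↦ deriv (fun s ↦ f (s, y)) t) x (X x)) t := by
  set y := extChartAt I x x with hy_def
  have hy : y ∈ (extChartAt I x).target := mem_extChartAt_target (I := I) x
  have hxy : (extChartAt I x).symm y = x := extChartAt_to_inv x
  set F : ℝ × E → ℝ := fun q ↦ f (q.1, (extChartAt I x).symm q.2)
  have hF : ContDiffAt ℝ ∞ F (t, y) := contDiffAt_comp_prodMap_extChartAt_symm hf x t hy
  have hF' : DifferentiableAt ℝ (fderiv ℝ F) (t, y) :=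
    (hF.fderiv_right (m := 1) (by norm_num; exact ENat.LEInfty.out)).differentiableAt (by simp)
  have e1 : (fun s ↦ d% (fun y ↦ f (s, y)) x (X x)) =
      fun s ↦ fderiv ℝ F (s, y) (0, chartRep I x X y) := by
    ext s
    have := mvfderiv_comp_snd (X := X) hf x s hy
    rwa [hxy] at this
  have e2 : d% (fun y ↦ deriv (fun s ↦ f (s, y)) t) x (X x) =
      fderiv ℝ (fderiv ℝ F) (t, y) (0, chartRep I x X y) (1, 0) := by
    have h1 := mvfderiv_comp_snd (X := X) (contMDiff_deriv_fst hf) x t hy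
    rw [hxy] at h1
    rw [h1]
    have h2 : (fun q : ℝ × E ↦ deriv (fun s ↦ f (s, (extChartAt I x).symm q.2)) q.1) =ᶠ[nhds (t, y)]
        fun q ↦ fderiv ℝ F q (1, 0) := by
      have hs : ∀ᶠ q : ℝ × E in nhds (t, y), q.2 ∈ (extChartAt I x).target :=
        continuous_snd.continuousAt.eventually ((isOpen_extChartAt_target x).mem_nhds hy)
      filter_upwards [hs] with q hq
      exact (hasDerivAt_comp_fst hf x q.1 hq).deriv
    rw [h2.fderiv_eq, fderiv_clm_apply hF' (differentiableAt_const _)]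
    simp
  -- The two differentiations commute by symmetry of the second derivative of the chart expression.
  have hs := (hF.isSymmSndFDerivAt
    (by rw [minSmoothness_of_isRCLikeNormedField]; exact ENat.LEInfty.out)).eq
      ((1, 0) : ℝ × E) (0, chartRep I x X y)
  rw [e1, e2, ← hs]
  have h3 : HasDerivAt (fun s ↦ fderiv ℝ F (s, y)) (fderiv ℝ (fderiv ℝ F) (t, y) (1, 0)) t :=
    hF'.hasFDerivAt.comp_hasDerivAt t ((hasDerivAt_id t).prodMk (hasDerivAt_const t y))
  have h4 := h3.clm_apply (hasDerivAt_const t ((0, chartRep I x X y) : ℝ × E))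
  simpa using h4

end Parametric

/-! ### First variation of the energy density -/

namespace SemiRiemannianMetric

section Variation

variable {E : Type*} [NormedAddCommGroup E] [NormedSpace ℝ E] {H : Type*} [TopologicalSpace H]
  {I : ModelWithCorners ℝ E H} {M : Type*} [TopologicalSpace M] [ChartedSpace H M]
  [IsManifold I ∞ M] (g : SemiRiemannianMetric I M) {X Y : Π x : M, TangentSpace I x}
  [FiniteDimensional ℝ E] [CompleteSpace E] [T2Space M] [I.Boundaryless]
  {U : ℝ → Π x : M, TangentSpace I x}

/-- `U` is a smooth one-parameter family of vector fields. -/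
def IsSmoothFamily (U : ℝ → Π x : M, TangentSpace I x) : Prop :=
  ContMDiff (𝓘(ℝ, ℝ).prod I) I.tangent ∞
    (fun p : ℝ × M ↦ (⟨p.2, U p.1 p.2⟩ : TangentBundle I M))

lemma IsSmoothFamily.isSmoothVectorField (hU : IsSmoothFamily U) (t : ℝ) :
    IsSmoothVectorField I (U t) :=
  ContMDiff.comp (f := fun x : M ↦ ((t, x) : ℝ × M)) hU (contMDiff_const.prodMk contMDiff_id)

variable {g} in
-- Product rule for curves whose derivative is only known against fixed vectors: expansion along a
-- dual pair reduces it to products of real functions.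
lemma hasDerivAt_inner_of_forall {x : M} {A B : ℝ → TangentSpace I x} {A' B' : TangentSpace I x}
    {t : ℝ} (hA : ∀ v, HasDerivAt (fun s ↦ g.inner x (A s) v) (g.inner x A' v) t)
    (hB : ∀ v, HasDerivAt (fun s ↦ g.inner x (B s) v) (g.inner x B' v) t) :
    HasDerivAt (fun s ↦ g.inner x (A s) (B s)) (g.inner x A' (B t) + g.inner x (A t) B') t := by
  have hd := g.isDualPair_tangentBasis x
  have key : ∀ a b, g.inner x a b = ∑ i, g.inner x a (dualFamily (g.bilin x) (tangentBasis I x) i) *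
      g.inner x b (tangentBasis I x i) := fun a b ↦ by
    rw [← bilin_apply, ← hd.sum_inner]
    exact Finset.sum_congr rfl fun i _ ↦ by rw [g.bilin_symm x (tangentBasis I x i)]; rfl
  have h := HasDerivAt.fun_sum (u := Finset.univ) fun i _ ↦
    (hA (dualFamily (g.bilin x) (tangentBasis I x) i)).mul (hB (tangentBasis I x i))
  rw [Finset.sum_add_distrib, ← key, ← key] at h
  refine h.congr_of_eventuallyEq (Filter.Eventually.of_forall fun s ↦ ?_)
  exact key _ _

/-- The derivative of a one-parameter family of vector fields with respect to the parameter. -/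
def velocity (U : ℝ → Π x : M, TangentSpace I x) (t : ℝ) (x : M) : TangentSpace I x :=
  ∑ i, deriv (fun s ↦ g.inner x (U s x) (tangentBasis I x i)) t •
    dualFamily (g.bilin x) (tangentBasis I x) i

/-- Frees the density from the pointwise basis of its definition. The trace of g itself is the
dimension. -/
lemma energyDensity_eq {ι : Type*} [Fintype ι] {x : M} {b d : ι → TangentSpace I x}
    (hd : IsDualPair (g.bilin x) b d) (V : Π x : M, TangentSpace I x) :
    g.energyDensity V x = 2⁻¹ * (Module.finrank ℝ E
      + ∑ i, g.inner x (g.leviCivita V x (b i)) (g.leviCivita V x (d i))) := by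
  let L : TangentSpace I x →ₗ[ℝ] TangentSpace I x →ₗ[ℝ] ℝ := g.bilin x +
    (g.bilin x).compl₁₂ (g.leviCivita V x).toLinearMap (g.leviCivita V x).toLinearMap
  have h1 := g.metricTrace_eq_sum x L
  rw [(g.isDualPair_tangentBasis x).sum_eq_sum (g.bilin_symm x) hd L] at h1
  have h2 := hd.trace_eq LinearMap.id
  rw [LinearMap.trace_id, finrank_tangentSpace] at h2
  have h3 : ∑ i, L (b i) (d i) = ∑ i, g.bilin x (b i) (d i)
      + ∑ i, g.inner x (g.leviCivita V x (b i)) (g.leviCivita V x (d i)) := by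
    rw [← Finset.sum_add_distrib]
    rfl
  simp only [LinearMap.id_apply] at h2
  rw [h3, ← h2] at h1
  exact congrArg (2⁻¹ * ·) h1

variable (hU : IsSmoothFamily U)
include hU

lemma contMDiff_inner_family (hX : IsSmoothVectorField I X) :
    ContMDiff (𝓘(ℝ, ℝ).prod I) 𝓘(ℝ, ℝ) ∞
      (fun p : ℝ × M ↦ g.inner p.2 (U p.1 p.2) (X p.2)) :=
  fun p ↦ g.contMDiffAt_inner_comp (hU p) ((hX.comp contMDiff_snd) p)

lemma hasDerivAt_inner_family (t : ℝ) (x : M) (v : TangentSpace I x) :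
    HasDerivAt (fun s ↦ g.inner x (U s x) v) (g.inner x (g.velocity U t x) v) t := by
  have h1 : ∀ v : TangentSpace I x, HasDerivAt (fun s ↦ g.inner x (U s x) v)
      (deriv (fun s ↦ g.inner x (U s x) v) t) t := fun v ↦ by
    have := hasDerivAt_fst (g.contMDiff_inner_family hU (isSmoothVectorField_smoothExtend v)) t x
    simpa only [smoothExtend_apply_self] using this
  have hd := g.isDualPair_tangentBasis x
  have h := HasDerivAt.fun_sum (u := Finset.univ) fun i _ ↦
    (h1 (tangentBasis I x i)).mul_const
      (g.inner x (dualFamily (g.bilin x) (tangentBasis I x) i) v)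
  have e1 : ∀ s, g.inner x (U s x) v = ∑ i, g.inner x (U s x) (tangentBasis I x i) *
      g.inner x (dualFamily (g.bilin x) (tangentBasis I x) i) v := fun s ↦
    (hd.symm.sum_inner (U s x) v).symm
  simp only [velocity, map_sum, map_smul, FunLike.coe_sum, Finset.sum_apply, _root_.smul_apply,
    smul_eq_mul, e1]
  exact h

lemma isSmoothVectorField_velocity (t : ℝ) : IsSmoothVectorField I (g.velocity U t) := by
  refine g.isSmoothVectorField_of_inner fun X hX ↦ ?_
  have h := (contMDiff_deriv_fst (g.contMDiff_inner_family hU hX)).comp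
    (contMDiff_const.prodMk contMDiff_id : ContMDiff I _ ∞ (fun x : M ↦ ((t, x) : ℝ × M)))
  refine h.congr fun x ↦ ?_
  exact (g.hasDerivAt_inner_family hU t x (X x)).deriv.symm

/-- Metric compatibility takes ∇ off the family. What remains is a derivative of a real function on
ℝ × M and a pairing with a fixed field, both of which the parametric lemmas handle. -/
lemma inner_leviCivita_family (hY : IsSmoothVectorField I Y)
    (t : ℝ) (x : M) : g.inner x (g.leviCivita (U t) x (X x)) (Y x) =
      d% (fun y ↦ g.inner y (U t y) (Y y)) x (X x)
        - g.inner x (U t x) (g.leviCivita Y x (X x)) := by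
  rw [mvfderiv_inner_apply (g := g) (hU.isSmoothVectorField t) hY]
  ring

lemma contMDiff_inner_leviCivita_family (hX : IsSmoothVectorField I X)
    (hY : IsSmoothVectorField I Y) : ContMDiff (𝓘(ℝ, ℝ).prod I) 𝓘(ℝ, ℝ) ∞
      (fun p : ℝ × M ↦ g.inner p.2 (g.leviCivita (U p.1) p.2 (X p.2)) (Y p.2)) := by
  simp only [g.inner_leviCivita_family hU hY]
  exact (contMDiff_mvfderiv_snd (g.contMDiff_inner_family hU hY) hX).sub
    (g.contMDiff_inner_family hU (g.isSmoothVectorField_leviCivita hX hY))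

/-- The parameter derivative commutes with the derivative of g(U_t, v) along u, and it turns the
correction g(U_t, ∇_u v) into its analogue for the velocity. -/
lemma hasDerivAt_inner_leviCivita_family (t : ℝ) (x : M) (u v : TangentSpace I x) :
    HasDerivAt (fun s ↦ g.inner x (g.leviCivita (U s) x u) v)
      (g.inner x (g.leviCivita (g.velocity U t) x u) v) t := by
  have hu := isSmoothVectorField_smoothExtend u
  have hv := isSmoothVectorField_smoothExtend v
  have h1 := hasDerivAt_mvfderiv_snd (X := smoothExtend u) (g.contMDiff_inner_family hU hv) t x
  have h2 := g.hasDerivAt_inner_family hU t x (g.leviCivita (smoothExtend v) x u)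
  have h3 := fun s ↦ g.inner_leviCivita_family (X := smoothExtend u) hU hv s x
  have h4 : (fun y ↦ deriv (fun s ↦ g.inner y (U s y) (smoothExtend v y)) t) =
      fun y ↦ g.inner y (g.velocity U t y) (smoothExtend v y) :=
    funext fun y ↦ (g.hasDerivAt_inner_family hU t y _).deriv
  rw [h4, mvfderiv_inner_apply (g := g) (g.isSmoothVectorField_velocity hU t) hv] at h1
  simp only [smoothExtend_apply_self] at h1 h3
  have := h1.sub h2
  rw [add_sub_cancel_right] at this
  refine this.congr_of_eventuallyEq (Filter.Eventually.of_forall fun s ↦ ?_)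
  exact h3 s

/-- The first variation of the energy density. -/
lemma hasDerivAt_energyDensity (t : ℝ) (x : M) :
    HasDerivAt (fun s ↦ g.energyDensity (U s) x)
      (∑ i, g.inner x (g.leviCivita (g.velocity U t) x (tangentBasis I x i))
        (g.leviCivita (U t) x (dualFamily (g.bilin x) (tangentBasis I x) i))) t := by
  have hd := g.isDualPair_tangentBasis x
  simp only [g.energyDensity_eq hd]
  have h := ((HasDerivAt.fun_sum (u := Finset.univ) fun i _ ↦
    hasDerivAt_inner_of_forall
      (g.hasDerivAt_inner_leviCivita_family hU t x (tangentBasis I x i))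
      (g.hasDerivAt_inner_leviCivita_family hU t x
        (dualFamily (g.bilin x) (tangentBasis I x) i))).const_add
          (Module.finrank ℝ E : ℝ)).const_mul 2⁻¹
  refine h.congr_deriv ?_
  -- Symmetry of the trace makes the two terms of the product rule equal, which absorbs the factor
  -- ½.
  have h2 := hd.sum_swap (g.bilin_symm x) ((g.bilin x).compl₁₂
    (g.leviCivita (g.velocity U t) x).toLinearMap (g.leviCivita (U t) x).toLinearMap)
  simp only [LinearMap.compl₁₂_apply, bilin_apply, ContinuousLinearMap.coe_coe] at h2
  rw [Finset.sum_add_distrib]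
  simp only [g.symm x (g.leviCivita (U t) x _)]
  rw [h2, ← two_mul, inv_mul_cancel_left₀ two_ne_zero]

/-- `tangentBasis` need not vary smoothly with the point, so the density is written in a smooth
frame, with entries of the inverse Gram matrix as coefficients. -/
lemma contMDiff_energyDensity : ContMDiff (𝓘(ℝ, ℝ).prod I) 𝓘(ℝ, ℝ) ∞
    (fun p : ℝ × M ↦ g.energyDensity (U p.1) p.2) := by
  rintro ⟨t, x⟩
  set Γ : Fin (Module.finrank ℝ E) → Fin (Module.finrank ℝ E) → M → ℝ :=
    fun i j y ↦ (gramMatrix (g.bilin y) (fun i ↦ frame I x i y))⁻¹ i j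
  have hΓ : ∀ i j, ContMDiffAt (𝓘(ℝ, ℝ).prod I) 𝓘(ℝ, ℝ) ∞ (fun p : ℝ × M ↦ Γ i j p.2) (t, x) :=
    fun i j ↦ (g.contMDiffAt_inv_gramMatrix_frame (g.frameDet_self_ne_zero x) i j).comp (t, x)
      contMDiffAt_snd
  have ha := fun i j ↦ (g.contMDiff_inner_leviCivita_family hU (isSmoothVectorField_frame x i)
    (isSmoothVectorField_frame x j)).contMDiffAt (x := (t, x))
  have key : ContMDiffAt (𝓘(ℝ, ℝ).prod I) 𝓘(ℝ, ℝ) ∞ (fun p : ℝ × M ↦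
      2⁻¹ * ((Module.finrank ℝ E : ℝ) + ∑ i, ∑ k,
        (∑ j, Γ k j p.2 * g.inner p.2 (g.leviCivita (U p.1) p.2 (frame I x i p.2)) (frame I x j p.2))
        * (∑ j, Γ i j p.2 *
          g.inner p.2 (g.leviCivita (U p.1) p.2 (frame I x j p.2)) (frame I x k p.2)))) (t, x) :=
    contMDiffAt_const.mul (contMDiffAt_const.add (ContMDiffAt.sum fun i _ ↦
      ContMDiffAt.sum fun k _ ↦ (ContMDiffAt.sum fun j _ ↦ (hΓ k j).mul (ha i j)).mul
        (ContMDiffAt.sum fun j _ ↦ (hΓ i j).mul (ha j k))))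
  refine key.congr_of_eventuallyEq ?_
  have hs : ∀ᶠ q : ℝ × M in nhds (t, x), g.frameDet x q.2 ≠ 0 :=
    (continuous_snd.tendsto ((t, x) : ℝ × M)).eventually (g.eventually_frameDet_ne_zero x)
  filter_upwards [hs] with q hq
  have hd := g.isDualPair_frame hq
  rw [g.energyDensity_eq hd]
  congr 2
  refine Finset.sum_congr rfl fun i _ ↦ ?_
  rw [← bilin_apply, ← hd.sum_inner]
  refine Finset.sum_congr rfl fun k _ ↦ ?_
  congr 1
  · simp only [coframe, dualFamily, map_sum, map_smul, smul_eq_mul]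
    rfl
  · rw [g.bilin_symm]
    simp only [coframe, dualFamily, map_sum, map_smul, smul_eq_mul, LinearMap.coe_sum,
      Finset.sum_apply, LinearMap.smul_apply]
    rfl

lemma hasDerivAt_inner_self_family (t : ℝ) (x : M) :
    HasDerivAt (fun s ↦ g.inner x (U s x) (U s x)) (2 * g.inner x (U t x) (g.velocity U t x)) t := by
  have h := hasDerivAt_inner_of_forall (g.hasDerivAt_inner_family hU t x)
    (g.hasDerivAt_inner_family hU t x)
  rwa [g.symm x (g.velocity U t x), ← two_mul] at h

lemma velocity_eq_zero {x : M} {v : TangentSpace I x} (h : ∀ s, U s x = v) (t : ℝ) :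
    g.velocity U t x = 0 := by
  refine g.nondegenerate x _ fun w ↦ ?_
  have h1 := g.hasDerivAt_inner_family hU t x w
  simp only [h] at h1
  exact h1.unique (hasDerivAt_const t _)

end Variation

end SemiRiemannianMetric

/-! ### The first variation at ξ is a divergence -/

namespace ParacontactMetricStructure.IsKappaMuSpace

variable {n : ℕ} {M : Type*} [TopologicalSpace M] [T2Space M]
  [ChartedSpace (EuclideanSpace ℝ (Fin (2 * n + 1))) M] [IsManifold (𝓡 (2 * n + 1)) ∞ M]
  {S : ParacontactMetricStructure n M} {κ μ : M → ℝ} (hS : S.IsKappaMuSpace κ μ)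
include hS

/-- On a `(κ, μ)`-space, the first variation of the energy of `ξ` in a direction orthogonal to `ξ`
is a divergence. -/
lemma sum_inner_leviCivita_eq_trace {W : Π x : M, TangentSpace (𝓡 (2 * n + 1)) x}
    (hW : IsSmoothVectorField (𝓡 (2 * n + 1)) W) {x : M} (hx : S.g.inner x (S.ξ x) (W x) = 0) :
    ∑ i, S.g.inner x (S.g.leviCivita W x (SemiRiemannianMetric.tangentBasis (𝓡 (2 * n + 1)) x i))
      (S.nablaξ x (dualFamily (S.g.bilin x) (SemiRiemannianMetric.tangentBasis (𝓡 (2 * n + 1)) x) i)) =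
    LinearMap.trace ℝ _ (S.g.leviCivita (fun y ↦ (S.nablaξ y + (2 : ℝ) • S.φ y) (W y)) x).toLinearMap := by
  have hd := S.g.isDualPair_tangentBasis x
  have hP := S.isSmoothAdjointPair_nablaξ
  have h1 := hS.sum_covDeriv x (W x)
  -- The Laplacian of ξ is a multiple of ξ, hence orthogonal to W at `x`.
  rw [hx, mul_zero] at h1
  rw [hd.trace_eq]
  -- Leibniz rule for the adjoint P + 2φ applied to W, paired with v.
  have h2 : ∀ u v, S.g.inner x (S.g.leviCivita (fun y ↦ (S.nablaξ y + (2 : ℝ) • S.φ y) (W y)) x u) v =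
      S.g.inner x (hP.covDeriv x u v) (W x) + S.g.inner x (S.g.leviCivita W x u) (S.nablaξ x v) := by
    intro u v
    have h3 := hP.symm.covDeriv_apply hW x u
    rw [SemiRiemannianMetric.covDerivEnd, eq_sub_iff_add_eq] at h3
    rw [← h3, map_add, _root_.add_apply, hP.symm.inner_covDeriv, hP.symm.adjoint,
      S.g.symm x (W x)]
  simp only [SemiRiemannianMetric.bilin_apply, ContinuousLinearMap.coe_coe, h2,
    Finset.sum_add_distrib]
  erw [h1]
  rw [zero_add]

end ParacontactMetricStructure.IsKappaMuSpace

/-! ### Derivatives of determinants and volume densities -/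

section Determinant

variable {ι : Type*} [Fintype ι] [DecidableEq ι] {A : ℝ → Matrix ι ι ℝ} {A' : Matrix ι ι ℝ} {t : ℝ}

/-- Jacobi's formula for the derivative of the determinant. -/
lemma hasDerivAt_det (h : ∀ i j, HasDerivAt (fun s ↦ A s i j) (A' i j) t) :
    HasDerivAt (fun s ↦ (A s).det) ((A t).adjugate * A').trace t := by
  have h1 : HasDerivAt (fun s ↦ ∑ σ : Equiv.Perm ι, ((Equiv.Perm.sign σ : ℤ) : ℝ) * ∏ i, A s (σ i) i)
      (∑ σ : Equiv.Perm ι, ((Equiv.Perm.sign σ : ℤ) : ℝ) *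
        ∑ i, (∏ j ∈ Finset.univ.erase i, A t (σ j) j) • A' (σ i) i) t :=
    HasDerivAt.fun_sum fun σ _ ↦ (HasDerivAt.fun_finsetProd fun i _ ↦ h (σ i) i).const_mul _
  simp only [Matrix.det_apply']
  refine h1.congr_deriv ?_
  -- By Cramer's rule the trace is a sum of determinants with one column differentiated, to be
  -- matched with the Leibniz expansion.
  have h2 : ((A t).adjugate * A').trace = ∑ i, ((A t).updateCol i (fun j ↦ A' j i)).det := by
    refine Finset.sum_congr rfl fun i _ ↦ ?_
    rw [← Matrix.cramer_apply, Matrix.cramer_eq_adjugate_mulVec]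
    rfl
  simp only [h2, Matrix.det_apply', Finset.mul_sum]
  rw [Finset.sum_comm]
  refine Finset.sum_congr rfl fun i _ ↦ Finset.sum_congr rfl fun σ _ ↦ ?_
  congr 1
  rw [← Finset.mul_prod_erase _ _ (Finset.mem_univ i), smul_eq_mul, mul_comm]
  congr 1
  · simp
  · refine Finset.prod_congr rfl fun j hj ↦ ?_
    rw [Matrix.updateCol_ne (Finset.ne_of_mem_erase hj)]

/-- √|a| = exp(½ log |a|), and `Real.log` is already log |·|. So the sign of the determinant,
arbitrary for an indefinite metric, plays no role. -/
lemma hasDerivAt_sqrt_abs_det (h : ∀ i j, HasDerivAt (fun s ↦ A s i j) (A' i j) t)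
    (h0 : (A t).det ≠ 0) : HasDerivAt (fun s ↦ √|(A s).det|)
      (√|(A t).det| * (2⁻¹ * ((A t)⁻¹ * A').trace)) t := by
  have hexp : ∀ a : ℝ, a ≠ 0 → √|a| = Real.exp (Real.log a / 2) := fun a ha ↦ by
    rw [Real.exp_half, Real.exp_log_eq_abs ha]
  have h1 := (((hasDerivAt_det h).log h0).div_const 2).exp
  have h2 : ∀ᶠ s in nhds t, (A s).det ≠ 0 := (hasDerivAt_det h).continuousAt.eventually_ne h0
  have h3 : (fun s ↦ √|(A s).det|) =ᶠ[nhds t] fun s ↦ Real.exp (Real.log (A s).det / 2) :=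
    h2.mono fun s hs ↦ hexp _ hs
  refine (h1.congr_of_eventuallyEq h3).congr_deriv ?_
  rw [hexp _ h0, Matrix.inv_def, Ring.inverse_eq_inv', Matrix.smul_mul, Matrix.trace_smul,
    smul_eq_mul]
  ring

end Determinant

/-! ### Coordinate vector fields -/

section CoordField

variable {E : Type*} [NormedAddCommGroup E] [NormedSpace ℝ E] {H : Type*} [TopologicalSpace H]
  {I : ModelWithCorners ℝ E H} [I.Boundaryless] {M : Type*} [TopologicalSpace M]
  [ChartedSpace H M] [IsManifold I ∞ M] {X Y Z : Π x : M, TangentSpace I x} {f : M → ℝ}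

variable (I) in
/-- The vector field on the domain of the chart at `p` that is represented by a constant. -/
def coordField (p : M) (v : E) : Π x : M, TangentSpace I x :=
  mpullback I 𝓘(ℝ, E) (extChartAt I p) (fun _ ↦ v)

lemma coordField_symm (p : M) (v : E) {y : E} (hy : y ∈ (extChartAt I p).target) :
    coordField I p v ((extChartAt I p).symm y) = mfderiv 𝓘(ℝ, E) I (extChartAt I p).symm y v := by
  have : IsManifold I 1 M := IsManifold.of_le (n := ∞) (by simp)
  have h1 := mfderiv_extChartAt_comp_mfderivWithin_extChartAt_symm (I := I) hy
  have h2 := mfderivWithin_extChartAt_symm_comp_mfderiv_extChartAt (I := I) hy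
  rw [I.range_eq_univ, mfderivWithin_univ] at h1 h2
  have h3 : (mfderiv I 𝓘(ℝ, E) (extChartAt I p) ((extChartAt I p).symm y)).inverse =
      mfderiv 𝓘(ℝ, E) I (extChartAt I p).symm y := ContinuousLinearMap.inverse_eq h1 h2
  exact congrArg (fun L : E →L[ℝ] TangentSpace I ((extChartAt I p).symm y) ↦ L v) h3

lemma chartRep_coordField (p : M) (v : E) {y : E} (hy : y ∈ (extChartAt I p).target) :
    chartRep I p (coordField I p v) y = v := by
  rw [chartRep, mpullback_apply, coordField_symm p v hy]
  exact (isInvertible_mfderiv_extChartAt_symm p hy).inverse_apply_self v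

lemma contMDiffAt_coordField [CompleteSpace E] (p : M) (v : E) {x : M}
    (hx : x ∈ (extChartAt I p).source) : CMDiffAt ∞ (T% (coordField I p v)) x := by
  have : IsManifold I 1 M := IsManifold.of_le (n := ∞) (by simp)
  refine ContMDiffAt.mpullback_vectorField_preimage (n := ∞) ?_
    (contMDiffAt_extChartAt' (by rwa [extChartAt_source] at hx))
    (isInvertible_mfderiv_extChartAt hx) (by simp)
  exact contMDiffAt_vectorSpace_iff_contDiffAt.2 contDiffAt_const

end CoordField

/-! ### The divergence in a chart -/

namespace SemiRiemannianMetric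

section Divergence

variable {E : Type*} [NormedAddCommGroup E] [NormedSpace ℝ E] {H : Type*} [TopologicalSpace H]
  {I : ModelWithCorners ℝ E H} [I.Boundaryless] {M : Type*} [TopologicalSpace M]
  [ChartedSpace H M] [IsManifold I ∞ M] (g : SemiRiemannianMetric I M)
  [FiniteDimensional ℝ E] [CompleteSpace E]
  {X Y Z : Π x : M, TangentSpace I x} {f : M → ℝ}
  {ι : Type*} [Fintype ι] [DecidableEq ι] (b : Module.Basis ι ℝ E)

/-- The divergence of a vector field. -/
def divergence (Z : Π x : M, TangentSpace I x) (x : M) : ℝ :=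
  LinearMap.trace ℝ (TangentSpace I x) (g.leviCivita Z x).toLinearMap

/-- The Gram matrix of the coordinate vector fields in the extended chart at `p`. -/
def coordGram (p : M) (y : E) : Matrix ι ι ℝ :=
  gramMatrix (g.bilin ((extChartAt I p).symm y))
    (fun i ↦ coordField I p (b i) ((extChartAt I p).symm y))

/-- The volume density in the extended chart at `p`. -/
def coordDensity (p : M) (y : E) : ℝ := √|(g.coordGram b p y).det|

lemma coordGram_apply (p : M) (y : E) (i j : ι) : g.coordGram b p y i j =
    ((fun x ↦ g.inner x (coordField I p (b i) x) (coordField I p (b j) x)) ∘ (extChartAt I p).symm) y :=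
  rfl

lemma exists_coordEquiv (p : M) {y : E} (hy : y ∈ (extChartAt I p).target) :
    ∃ e : E ≃L[ℝ] TangentSpace I ((extChartAt I p).symm y), ∀ v,
      e v = mfderiv 𝓘(ℝ, E) I (extChartAt I p).symm y v := by
  obtain ⟨e, he⟩ := isInvertible_mfderiv_extChartAt_symm (I := I) p hy
  exact ⟨e, fun v ↦ congrArg
    (fun L : E →L[ℝ] TangentSpace I ((extChartAt I p).symm y) ↦ L v) he⟩

lemma det_coordGram_ne_zero (p : M) {y : E} (hy : y ∈ (extChartAt I p).target) :
    (g.coordGram b p y).det ≠ 0 := by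
  obtain ⟨e, he⟩ := exists_coordEquiv (I := I) p hy
  have h : (fun i ↦ coordField I p (b i) ((extChartAt I p).symm y)) = b.map e.toLinearEquiv := by
    ext1 i
    rw [coordField_symm p _ hy, ← he, Module.Basis.map_apply]
    rfl
  rw [coordGram, h]
  exact g.det_gramMatrix_bilin_ne_zero _

lemma isDualPair_coordField (p : M) {y : E} (hy : y ∈ (extChartAt I p).target) :
    IsDualPair (g.bilin ((extChartAt I p).symm y))
      (fun i ↦ coordField I p (b i) ((extChartAt I p).symm y))
      (dualFamily (g.bilin ((extChartAt I p).symm y))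
        (fun i ↦ coordField I p (b i) ((extChartAt I p).symm y))) :=
  isDualPair_dualFamily (g.bilin_symm _) (g.det_coordGram_ne_zero b p hy)
    (by rw [finrank_tangentSpace, Module.finrank_eq_card_basis b])

lemma contMDiffAt_inner_coordField (p : M) (v w : E) {x : M} (hx : x ∈ (extChartAt I p).source) :
    CMDiffAt ∞ (fun x ↦ g.inner x (coordField I p v x) (coordField I p w x)) x :=
  g.contMDiffAt_inner_comp (contMDiffAt_coordField p v hx) (contMDiffAt_coordField p w hx)

lemma contDiffAt_coordGram (p : M) {y : E} (hy : y ∈ (extChartAt I p).target) (i j : ι) :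
    ContDiffAt ℝ ∞ (fun y ↦ g.coordGram b p y i j) y := by
  simp only [coordGram_apply]
  exact contMDiffAt_iff_contDiffAt.1
    ((g.contMDiffAt_inner_coordField p (b i) (b j) ((extChartAt I p).map_target hy)).comp y
      (contMDiffAt_extChartAt_symm p hy))

lemma contDiffAt_coordDensity (p : M) {y : E} (hy : y ∈ (extChartAt I p).target) :
    ContDiffAt ℝ ∞ (g.coordDensity b p) y := by
  have h0 := g.det_coordGram_ne_zero b p hy
  have h : ContDiffAt ℝ ∞ (fun y ↦ (g.coordGram b p y).det) y := by
    rw [← contMDiffAt_iff_contDiffAt]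
    exact contMDiffAt_det fun i j ↦ (g.contDiffAt_coordGram b p hy i j).contMDiffAt
  exact (h.abs h0).sqrt (abs_pos.2 h0).ne'

lemma fderiv_coordGram (hZ : IsSmoothVectorField I Z) (p : M) {y : E}
    (hy : y ∈ (extChartAt I p).target) (i j : ι) :
    fderiv ℝ (fun y ↦ g.coordGram b p y i j) y (chartRep I p Z y) =
      g.inner ((extChartAt I p).symm y)
        (g.leviCivita (coordField I p (b i)) ((extChartAt I p).symm y) (Z ((extChartAt I p).symm y)))
        (coordField I p (b j) ((extChartAt I p).symm y)) +
      g.inner ((extChartAt I p).symm y) (coordField I p (b i) ((extChartAt I p).symm y))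
        (g.leviCivita (coordField I p (b j)) ((extChartAt I p).symm y)
          (Z ((extChartAt I p).symm y))) := by
  have hx := (extChartAt I p).map_target hy
  have hc := fun i ↦ (contMDiffAt_coordField p (b i) hx).mdifferentiableAt (by simp)
  rw [← g.mvfderiv_inner (hZ.mdifferentiableAt _) (hc i) (hc j), ← fderiv_comp_symm_chartRep p Z hy
    ((g.contMDiffAt_inner_coordField p (b i) (b j) hx).mdifferentiableAt (by simp))]
  rfl

lemma fderiv_coordDensity (p : M) {y : E} (hy : y ∈ (extChartAt I p).target) (v : E) :
    fderiv ℝ (g.coordDensity b p) y v = g.coordDensity b p y * (2⁻¹ * ((g.coordGram b p y)⁻¹ *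
      Matrix.of fun i j ↦ fderiv ℝ (fun y ↦ g.coordGram b p y i j) y v).trace) := by
  have hl : HasDerivAt (fun s : ℝ ↦ y + s • v) v 0 := by
    simpa using ((hasDerivAt_id (0 : ℝ)).smul_const v).const_add y
  have hy0 : y = y + (0 : ℝ) • v := by simp
  have h1 : HasDerivAt (fun s : ℝ ↦ g.coordDensity b p (y + s • v))
      (fderiv ℝ (g.coordDensity b p) y v) 0 :=
    HasFDerivAt.comp_hasDerivAt_of_eq 0
      ((g.contDiffAt_coordDensity b p hy).differentiableAt (by simp)).hasFDerivAt hl hy0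
  have h2 : ∀ i j, HasDerivAt (fun s : ℝ ↦ g.coordGram b p (y + s • v) i j)
      ((Matrix.of fun i j ↦ fderiv ℝ (fun y ↦ g.coordGram b p y i j) y v) i j) 0 := fun i j ↦
    HasFDerivAt.comp_hasDerivAt_of_eq 0
      ((g.contDiffAt_coordGram b p hy i j).differentiableAt (by simp)).hasFDerivAt hl hy0
  have h3 := hasDerivAt_sqrt_abs_det h2 (by rw [← hy0]; exact g.det_coordGram_ne_zero b p hy)
  have := h1.unique h3
  rwa [← hy0] at this

/-- The divergence in a chart: `√|det G| div Z = ∑ᵢ ∂ᵢ (√|det G| Zⁱ)`. -/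
lemma coordDensity_mul_divergence (hZ : IsSmoothVectorField I Z) (p : M) {y : E}
    (hy : y ∈ (extChartAt I p).target) :
    g.coordDensity b p y * g.divergence Z ((extChartAt I p).symm y) =
      fderiv ℝ (g.coordDensity b p) y (chartRep I p Z y)
        + g.coordDensity b p y * LinearMap.trace ℝ E (fderiv ℝ (chartRep I p Z) y).toLinearMap := by
  have hx := (extChartAt I p).map_target hy
  have hd := g.isDualPair_coordField b p hy
  have hc := fun i ↦ (contMDiffAt_coordField p (b i) hx).mdifferentiableAt (by simp)
  have hdu : ∀ i u, g.inner ((extChartAt I p).symm y) u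
      (dualFamily (g.bilin ((extChartAt I p).symm y))
        (fun i ↦ coordField I p (b i) ((extChartAt I p).symm y)) i) =
      ∑ j, (g.coordGram b p y)⁻¹ i j * g.inner ((extChartAt I p).symm y) u
        (coordField I p (b j) ((extChartAt I p).symm y)) := fun i u ↦ by
    simp only [dualFamily, map_sum, map_smul, smul_eq_mul]
    rfl
  set x := (extChartAt I p).symm y with hxdef
  set c := fun i ↦ coordField I p (b i) x with hcdef
  set d := dualFamily (g.bilin x) c with hddef
  obtain ⟨e, he⟩ : ∃ e : E ≃L[ℝ] TangentSpace I x, ∀ v,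
      e v = mfderiv 𝓘(ℝ, E) I (extChartAt I p).symm y v := exists_coordEquiv p hy
  have hec : ∀ i, c i = e (b i) := fun i ↦ (coordField_symm p _ hy).trans (he _).symm
  -- Coordinate fields are constant in the chart, so the bracket only differentiates the components
  -- of Z.
  have hbr : ∀ i, mlieBracket I (coordField I p (b i)) Z x =
      e (fderiv ℝ (chartRep I p Z) y (b i)) := by
    intro i
    have h1 : chartRep I p (coordField I p (b i)) =ᶠ[nhds y] fun _ ↦ b i := by
      filter_upwards [(isOpen_extChartAt_target p).mem_nhds hy] with z hz
      exact chartRep_coordField p (b i) hz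
    have h2 := chartRep_mlieBracket p (hc i) (hZ.mdifferentiableAt _) hy
    rw [lieBracket, h1.fderiv_eq, chartRep_coordField p (b i) hy, fderiv_const_apply,
      _root_.zero_apply, sub_zero] at h2
    rw [← h2]
    exact ((he _).trans (mfderiv_symm_chartRep p _ hy)).symm
  have h0 : g.divergence Z x = ∑ i, g.inner x (g.leviCivita Z x (c i)) (d i) := hd.trace_eq _
  -- Torsion-freeness: ∇_{∂ᵢ} Z = ∇_Z ∂ᵢ + [∂ᵢ, Z]. The bracket traces to the flat divergence
  -- (`h2`), the other term to the logarithmic derivative of the density (`h6`).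
  have h1 : ∀ i, g.leviCivita Z x (c i) = g.leviCivita (coordField I p (b i)) x (Z x)
      + e (fderiv ℝ (chartRep I p Z) y (b i)) := fun i ↦ by
    rw [← hbr, g.mlieBracket_eq (hc i) (hZ.mdifferentiableAt _)]
    simp [hcdef]
  have h2 : ∑ i, g.inner x (e (fderiv ℝ (chartRep I p Z) y (b i))) (d i) =
      LinearMap.trace ℝ E (fderiv ℝ (chartRep I p Z) y).toLinearMap := by
    have h3 := hd.trace_eq (e.toLinearEquiv.conj (fderiv ℝ (chartRep I p Z) y).toLinearMap)
    rw [LinearMap.trace_conj'] at h3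
    rw [h3]
    refine Finset.sum_congr rfl fun i _ ↦ ?_
    have h5 : e.toLinearEquiv.conj (fderiv ℝ (chartRep I p Z) y).toLinearMap (c i) =
        e (fderiv ℝ (chartRep I p Z) y (b i)) := by
      rw [LinearEquiv.conj_apply_apply, hec]
      exact congrArg (fun v ↦ e (fderiv ℝ (chartRep I p Z) y v)) (e.symm_apply_apply _)
    rw [← h5]
    rfl
  have h6 : ∑ i, g.inner x (g.leviCivita (coordField I p (b i)) x (Z x)) (d i) =
      2⁻¹ * ((g.coordGram b p y)⁻¹ *
      Matrix.of fun i j ↦ fderiv ℝ (fun y ↦ g.coordGram b p y i j) y (chartRep I p Z y)).trace := by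
    have hsymm : ∀ i j, (g.coordGram b p y)⁻¹ i j = (g.coordGram b p y)⁻¹ j i := fun i j ↦ by
      have ht : (g.coordGram b p y).transpose = g.coordGram b p y := by
        ext i j
        exact g.symm _ _ _
      conv_lhs => rw [← ht, ← Matrix.transpose_nonsing_inv]
      rfl
    have h7 : ((g.coordGram b p y)⁻¹ * Matrix.of fun i j ↦
        fderiv ℝ (fun y ↦ g.coordGram b p y i j) y (chartRep I p Z y)).trace =
        ∑ i, ∑ j, ((g.coordGram b p y)⁻¹ j i *
          g.inner x (g.leviCivita (coordField I p (b j)) x (Z x)) (c i)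
        + (g.coordGram b p y)⁻¹ i j *
          g.inner x (g.leviCivita (coordField I p (b i)) x (Z x)) (c j)) := by
      simp only [Matrix.trace, Matrix.diag, Matrix.mul_apply, Matrix.of_apply]
      refine Finset.sum_congr rfl fun i _ ↦ Finset.sum_congr rfl fun j _ ↦ ?_
      rw [g.fderiv_coordGram b hZ p hy, hsymm j i, ← mul_add, g.symm x (coordField I p (b j) x)]
    simp only [hdu]
    rw [h7]
    simp only [Finset.sum_add_distrib]
    rw [Finset.sum_comm (f := fun i j ↦ (g.coordGram b p y)⁻¹ j i *
          g.inner x (g.leviCivita (coordField I p (b j)) x (Z x)) (c i)), ← two_mul,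
      inv_mul_cancel_left₀ two_ne_zero]
  rw [h0, g.fderiv_coordDensity b p hy]
  simp only [h1, map_add, _root_.add_apply, Finset.sum_add_distrib, h2, h6]
  ring

variable [T2Space M]

lemma contMDiff_divergence (hZ : IsSmoothVectorField I Z) : CMDiff ∞ (g.divergence Z) := by
  intro x
  have h : CMDiffAt ∞ (fun y ↦ ∑ i, g.inner y (g.leviCivita Z y (frame I x i y)) (g.coframe x i y)) x :=
    ContMDiffAt.sum fun i _ ↦ g.contMDiffAt_inner_comp
      (g.isSmoothVectorField_leviCivita (isSmoothVectorField_frame x i) hZ x)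
      (g.contMDiffAt_coframe (g.frameDet_self_ne_zero x) i)
  refine h.congr_of_eventuallyEq ?_
  filter_upwards [g.eventually_frameDet_ne_zero x] with y hy
  exact (g.isDualPair_frame hy).trace_eq _

lemma divergence_eq_zero (hZ : IsSmoothVectorField I Z) {x : M} (h : ∀ᶠ y in nhds x, Z y = 0) :
    g.divergence Z x = 0 := by
  have h0 : IsSmoothVectorField I ((0 : ℝ) • Z) := hZ.const_smul 0
  rw [divergence, g.leviCivita_congr (hZ.mdifferentiableAt x) (h0.mdifferentiableAt x)
    (h.mono fun y hy ↦ by simp [hy]), g.leviCivita_const_smul _ (hZ.mdifferentiableAt x)]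
  simp

end Divergence

end SemiRiemannianMetric

/-! ### Charts modelled on Euclidean space -/

section Euclidean

variable {m : ℕ} {M : Type*} [TopologicalSpace M] [ChartedSpace (EuclideanSpace ℝ (Fin m)) M]

lemma extChartAt_euclidean_source (p : M) :
    (extChartAt (𝓡 m) p).source = (chartAt (EuclideanSpace ℝ (Fin m)) p).source :=
  extChartAt_source (𝓡 m) p

lemma extChartAt_euclidean_target (p : M) :
    (extChartAt (𝓡 m) p).target = (chartAt (EuclideanSpace ℝ (Fin m)) p).target := by
  simp [extChartAt, mfld_simps]

end Euclidean

/-- The inverse chart is continuous only on its target, so measurability is established on that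
subtype. -/
lemma measurableSet_target_inter_preimage {α β : Type*} [TopologicalSpace α] [TopologicalSpace β]
    [MeasurableSpace α] [BorelSpace α] [MeasurableSpace β] [BorelSpace β]
    (χ : OpenPartialHomeomorph α β) {s : Set α} (hs : MeasurableSet s) :
    MeasurableSet (χ.target ∩ χ.symm ⁻¹' s) := by
  have h := (continuousOn_iff_continuous_domRestrict.1 χ.continuousOn_symm).measurable hs
  have h2 := (χ.open_target.measurableSet).subtype_image h
  convert h2 using 1
  ext y
  simp [and_comm]

/-! ### Chart independence of the volume measure -/

namespace SemiRiemannianMetric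

section ChangeOfCharts

variable {E : Type*} [NormedAddCommGroup E] [NormedSpace ℝ E] {H : Type*} [TopologicalSpace H]
  {I : ModelWithCorners ℝ E H} [I.Boundaryless] {M : Type*} [TopologicalSpace M]
  [ChartedSpace H M] [IsManifold I ∞ M] (g : SemiRiemannianMetric I M) [FiniteDimensional ℝ E] [CompleteSpace E]
  {ι : Type*} [Fintype ι] [DecidableEq ι] (b : Module.Basis ι ℝ E)

variable (I) in
/-- The coordinate change between two extended charts. -/
def coordChange (p q : M) (y : E) : E := extChartAt I q ((extChartAt I p).symm y)

lemma differentiableAt_coordChange {p q : M} {y : E} (hy : y ∈ (extChartAt I p).target)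
    (hq : (extChartAt I p).symm y ∈ (extChartAt I q).source) :
    DifferentiableAt ℝ (coordChange I p q) y := by
  have h : CMDiffAt ∞ (coordChange I p q) y :=
    (contMDiffAt_extChartAt' (by rwa [extChartAt_source] at hq)).comp y
      (contMDiffAt_extChartAt_symm p hy)
  exact (contMDiffAt_iff_contDiffAt.1 h).differentiableAt (by simp)

lemma coordField_eq_coordField_fderiv {p q : M} {y : E} (hy : y ∈ (extChartAt I p).target)
    (hq : (extChartAt I p).symm y ∈ (extChartAt I q).source) (v : E) :
    coordField I p v ((extChartAt I p).symm y) =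
      coordField I q (fderiv ℝ (coordChange I p q) y v) ((extChartAt I p).symm y) := by
  have hτ := differentiableAt_coordChange hy hq
  have hty : coordChange I p q y ∈ (extChartAt I q).target := (extChartAt I q).map_source hq
  have hback : (extChartAt I q).symm (coordChange I p q y) = (extChartAt I p).symm y :=
    (extChartAt I q).left_inv hq
  have hev : ∀ᶠ z in nhds y, (extChartAt I p).symm z =
      ((extChartAt I q).symm ∘ coordChange I p q) z := by
    have hc : ContinuousAt (extChartAt I p).symm y :=
      (contMDiffAt_extChartAt_symm (I := I) p hy).continuousAt
    filter_upwards [hc.eventually ((isOpen_extChartAt_source q).mem_nhds hq)] with z hz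
    exact ((extChartAt I q).left_inv hz).symm
  have h1 : mfderiv 𝓘(ℝ, E) I (extChartAt I p).symm y v =
      mfderiv 𝓘(ℝ, E) I ((extChartAt I q).symm ∘ coordChange I p q) y v := by
    have := congrArg (fun L : E →L[ℝ] E ↦ L v) (Filter.EventuallyEq.mfderiv_eq (I := 𝓘(ℝ, E)) (I' := I) hev)
    exact this
  have h2 := mfderiv_comp_apply (I := 𝓘(ℝ, E)) (I' := 𝓘(ℝ, E)) (I'' := I) y
    (mdifferentiableAt_symm q hty) hτ.mdifferentiableAt v
  rw [coordField_symm p v hy, h1, h2]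
  have h3 := coordField_symm q (fderiv ℝ (coordChange I p q) y v) hty
  rw [mfderiv_eq_fderiv]
  rw [hback] at h3
  exact h3.symm

/-- With J the Jacobian matrix, the Gram matrices satisfy G_p = Jᵀ G_q J, so √|det G| acquires the
factor |det J|. -/
lemma coordDensity_eq_mul {p q : M} {y : E} (hy : y ∈ (extChartAt I p).target)
    (hq : (extChartAt I p).symm y ∈ (extChartAt I q).source) :
    g.coordDensity b p y = |(fderiv ℝ (coordChange I p q) y).det| *
      g.coordDensity b q (coordChange I p q y) := by
  have hty : coordChange I p q y ∈ (extChartAt I q).target := (extChartAt I q).map_source hq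
  have hback : (extChartAt I q).symm (coordChange I p q y) = (extChartAt I p).symm y :=
    (extChartAt I q).left_inv hq
  set L := fderiv ℝ (coordChange I p q) y with hL
  set J := LinearMap.toMatrix b b L.toLinearMap with hJ
  obtain ⟨e, he⟩ := exists_coordEquiv (I := I) q hty
  have hLb : ∀ i, L (b i) = ∑ k, J k i • b k := fun i ↦ by
    conv_lhs => rw [← b.sum_repr (L (b i))]
    simp only [hJ, LinearMap.toMatrix_apply]
    rfl
  have hc : ∀ i, coordField I p (b i) ((extChartAt I p).symm y) =
      ∑ k, J k i • coordField I q (b k) ((extChartAt I p).symm y) := fun i ↦ by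
    rw [coordField_eq_coordField_fderiv hy hq, ← hL, hLb, ← hback]
    simp only [coordField_symm q _ hty, ← he, map_sum, map_smul]
  have hG : g.coordGram b p y = J.transpose * g.coordGram b q (coordChange I p q y) * J := by
    ext i j
    simp only [coordGram, gramMatrix, Matrix.of_apply, hc, map_sum, map_smul,
      LinearMap.coe_sum, Finset.sum_apply, LinearMap.smul_apply, smul_eq_mul, Matrix.mul_apply,
      Matrix.transpose_apply, Finset.sum_mul, Finset.mul_sum]
    refine Finset.sum_congr rfl fun k _ ↦ Finset.sum_congr rfl fun l _ ↦ ?_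
    rw [hback]
    ring
  have hdet : J.det = L.det := by
    rw [hJ, LinearMap.det_toMatrix]
  rw [coordDensity, hG, Matrix.det_mul, Matrix.det_mul, Matrix.det_transpose, hdet, mul_right_comm,
    abs_mul, Real.sqrt_mul (abs_nonneg _), abs_mul_self, Real.sqrt_mul_self_eq_abs, coordDensity]

end ChangeOfCharts

variable {m : ℕ} {M : Type*} [TopologicalSpace M] [ChartedSpace (EuclideanSpace ℝ (Fin m)) M]
  [IsManifold (𝓡 m) ∞ M] (g : SemiRiemannianMetric (𝓡 m) M)

lemma chartGram_eq (p : M) {y : EuclideanSpace ℝ (Fin m)}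
    (hy : y ∈ (chartAt (EuclideanSpace ℝ (Fin m)) p).target) :
    g.chartGram p y = g.coordGram (EuclideanSpace.basisFun (Fin m) ℝ).toBasis p y := by
  rw [← extChartAt_euclidean_target] at hy
  ext i j
  simp only [coordGram, gramMatrix, Matrix.of_apply, coordField_symm p _ hy, OrthonormalBasis.coe_toBasis]
  rfl

/-- The volume density in a chart. -/
def chartDensity (p : M) (y : EuclideanSpace ℝ (Fin m)) : ℝ := √|(g.chartGram p y).det|

lemma chartDensity_eq (p : M) {y : EuclideanSpace ℝ (Fin m)}
    (hy : y ∈ (chartAt (EuclideanSpace ℝ (Fin m)) p).target) :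
    g.chartDensity p y = g.coordDensity (EuclideanSpace.basisFun (Fin m) ℝ).toBasis p y := by
  rw [chartDensity, coordDensity, g.chartGram_eq p hy]

lemma continuousOn_chartDensity (p : M) :
    ContinuousOn (g.chartDensity p) (chartAt (EuclideanSpace ℝ (Fin m)) p).target := by
  refine ContinuousOn.congr (f := g.coordDensity (EuclideanSpace.basisFun (Fin m) ℝ).toBasis p)
    (fun y hy ↦ ?_) fun y hy ↦ g.chartDensity_eq p hy
  rw [← extChartAt_euclidean_target] at hy
  exact (g.contDiffAt_coordDensity _ p hy).continuousAt.continuousWithinAt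

variable [MeasurableSpace M] [BorelSpace M]

lemma aemeasurable_chart_symm (p : M) : AEMeasurable (chartAt (EuclideanSpace ℝ (Fin m)) p).symm
    ((volume.restrict (chartAt (EuclideanSpace ℝ (Fin m)) p).target).withDensity
      (fun y ↦ ENNReal.ofReal (g.chartDensity p y))) :=
  ((chartAt (EuclideanSpace ℝ (Fin m)) p).continuousOn_symm.aemeasurable
    (chartAt (EuclideanSpace ℝ (Fin m)) p).open_target.measurableSet).mono_ac
      (withDensity_absolutelyContinuous _ _)

lemma chartVolume_apply (p : M) {s : Set M} (hs : MeasurableSet s) : g.chartVolume p s =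
    ∫⁻ y in (chartAt (EuclideanSpace ℝ (Fin m)) p).target ∩
      (chartAt (EuclideanSpace ℝ (Fin m)) p).symm ⁻¹' s, ENNReal.ofReal (g.chartDensity p y) := by
  have h := Measure.map_apply_of_aemeasurable (g.aemeasurable_chart_symm p) hs
  rw [withDensity_apply', Measure.restrict_restrict'
    (chartAt (EuclideanSpace ℝ (Fin m)) p).open_target.measurableSet, Set.inter_comm] at h
  exact h

/-- Change of variables: the Jacobian of the substitution is the factor in `coordDensity_eq_mul`. -/
lemma chartVolume_eq_chartVolume (p q : M) {s : Set M} (hs : MeasurableSet s)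
    (hp : s ⊆ (chartAt (EuclideanSpace ℝ (Fin m)) p).source)
    (hq : s ⊆ (chartAt (EuclideanSpace ℝ (Fin m)) q).source) :
    g.chartVolume p s = g.chartVolume q s := by
  set χ := chartAt (EuclideanSpace ℝ (Fin m)) p with hχ
  set ψ := chartAt (EuclideanSpace ℝ (Fin m)) q with hψ
  set A := χ.target ∩ χ.symm ⁻¹' s with hA
  have hyA : ∀ y ∈ A, y ∈ (extChartAt (𝓡 m) p).target ∧
      (extChartAt (𝓡 m) p).symm y ∈ (extChartAt (𝓡 m) q).source := fun y hy ↦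
    ⟨by rw [extChartAt_euclidean_target]; exact hy.1,
      by rw [extChartAt_euclidean_source]; exact hq hy.2⟩
  have himage : ψ.target ∩ ψ.symm ⁻¹' s = coordChange (𝓡 m) p q '' A := by
    ext z
    constructor
    · rintro ⟨hz, hzs⟩
      refine ⟨χ (ψ.symm z), ⟨χ.map_source (hp hzs), ?_⟩, ?_⟩
      · rwa [Set.mem_preimage, χ.left_inv (hp hzs)]
      · change ψ (χ.symm (χ (ψ.symm z))) = z
        rw [χ.left_inv (hp hzs), ψ.right_inv hz]
    · rintro ⟨y, ⟨hy, hys⟩, rfl⟩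
      change ψ (χ.symm y) ∈ _
      refine ⟨ψ.map_source (hq hys), ?_⟩
      rwa [Set.mem_preimage, ψ.left_inv (hq hys)]
  have hinj : Set.InjOn (coordChange (𝓡 m) p q) A := by
    rintro y ⟨hy, hys⟩ z ⟨hz, hzs⟩ h
    change ψ (χ.symm y) = ψ (χ.symm z) at h
    exact χ.symm.injOn hy hz (ψ.injOn (hq hys) (hq hzs) h)
  have hAm : MeasurableSet A := measurableSet_target_inter_preimage χ hs
  rw [chartVolume_apply g p hs, chartVolume_apply g q hs, himage,
    lintegral_image_eq_lintegral_abs_det_fderiv_mul volume hAm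
      (fun y hy ↦ (differentiableAt_coordChange (hyA y hy).1
        (hyA y hy).2).hasFDerivAt.hasFDerivWithinAt) hinj]
  refine setLIntegral_congr_fun hAm fun y hy ↦ ?_
  have h1 : coordChange (𝓡 m) p q y ∈ ψ.target := ψ.map_source (hq hy.2)
  rw [← ENNReal.ofReal_mul (abs_nonneg _), g.chartDensity_eq p hy.1, g.chartDensity_eq q h1,
    g.coordDensity_eq_mul _ (hyA y hy).1 (hyA y hy).2]

variable [Nonempty M] [SecondCountableTopology M]

/-- The gluing does not matter: the part of s in each disjoint piece lies both in that piece's chart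
and in the chart at `p`, where the two measures agree. -/
lemma volumeMeasure_apply (p : M) {s : Set M} (hs : MeasurableSet s)
    (hp : s ⊆ (chartAt (EuclideanSpace ℝ (Fin m)) p).source) :
    g.volumeMeasure s = g.chartVolume p s := by
  set c := (exists_chart_sequence m M).choose
  have hc : ⋃ k, (chartAt (EuclideanSpace ℝ (Fin m)) (c k)).source = Set.univ :=
    (exists_chart_sequence m M).choose_spec
  set D : ℕ → Set M := disjointed fun l ↦ (chartAt (EuclideanSpace ℝ (Fin m)) (c l)).source
  have hDm : ∀ k, MeasurableSet (D k) := fun k ↦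
    MeasurableSet.disjointed (fun l ↦ (chartAt _ (c l)).open_source.measurableSet) k
  have hDs : ∀ k, D k ⊆ (chartAt (EuclideanSpace ℝ (Fin m)) (c k)).source := disjointed_subset _
  have h1 : g.volumeMeasure s = ∑' k, g.chartVolume p (s ∩ D k) := by
    rw [volumeMeasure, Measure.sum_apply _ hs]
    refine tsum_congr fun k ↦ ?_
    rw [Measure.restrict_apply hs]
    exact g.chartVolume_eq_chartVolume _ _ (hs.inter (hDm k)) (Set.inter_subset_right.trans (hDs k))
      (Set.inter_subset_left.trans hp)
  have hdisj : Pairwise (Function.onFun Disjoint fun k ↦ s ∩ D k) := fun i j hij ↦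
    ((disjoint_disjointed _) hij).mono Set.inter_subset_right Set.inter_subset_right
  rw [h1, ← measure_iUnion hdisj fun k ↦ hs.inter (hDm k), ← Set.inter_iUnion, iUnion_disjointed,
    hc, Set.inter_univ]

lemma volumeMeasure_restrict_source (p : M) :
    g.volumeMeasure.restrict (chartAt (EuclideanSpace ℝ (Fin m)) p).source = g.chartVolume p := by
  have hsm : MeasurableSet (chartAt (EuclideanSpace ℝ (Fin m)) p).source :=
    (chartAt (EuclideanSpace ℝ (Fin m)) p).open_source.measurableSet
  ext s hs
  rw [Measure.restrict_apply hs, g.volumeMeasure_apply p (hs.inter hsm) Set.inter_subset_right,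
    chartVolume_apply g p hs, chartVolume_apply g p (hs.inter hsm)]
  congr 2
  ext y
  simp only [Set.mem_inter_iff, Set.mem_preimage, and_congr_right_iff, and_iff_left_iff_imp]
  exact fun hy _ ↦ (chartAt (EuclideanSpace ℝ (Fin m)) p).map_target hy

instance isLocallyFiniteMeasure_volumeMeasure : IsLocallyFiniteMeasure g.volumeMeasure where
  finiteAtNhds x := by
    set χ := chartAt (EuclideanSpace ℝ (Fin m)) x
    have hx : χ x ∈ χ.target := mem_chart_target _ x
    obtain ⟨K, hK, hxK, hKt⟩ := exists_compact_subset χ.open_target hx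
    refine ⟨χ.source ∩ χ ⁻¹' interior K, (χ.isOpen_inter_preimage isOpen_interior).mem_nhds
      ⟨mem_chart_source _ x, hxK⟩, ?_⟩
    rw [g.volumeMeasure_apply x (χ.isOpen_inter_preimage isOpen_interior).measurableSet
      Set.inter_subset_left, chartVolume_apply g x
      (χ.isOpen_inter_preimage isOpen_interior).measurableSet]
    have hint : IntegrableOn (g.chartDensity x) K :=
      ((g.continuousOn_chartDensity x).mono hKt).integrableOn_compact hK
    refine (lintegral_mono_set ?_).trans_lt hint.lintegral_lt_top
    rintro y ⟨hy, -, hys⟩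
    rw [Set.mem_preimage, χ.right_inv hy] at hys
    exact interior_subset hys

/-- The integral of a function supported in a chart domain. -/
lemma integral_volumeMeasure (p : M) {f : M → ℝ} (hf : Continuous f)
    (hfs : ∀ x ∉ (chartAt (EuclideanSpace ℝ (Fin m)) p).source, f x = 0) :
    ∫ x, f x ∂g.volumeMeasure = ∫ y in (chartAt (EuclideanSpace ℝ (Fin m)) p).target,
      g.chartDensity p y * f ((chartAt (EuclideanSpace ℝ (Fin m)) p).symm y) := by
  rw [← setIntegral_eq_integral_of_forall_compl_eq_zero hfs, g.volumeMeasure_restrict_source]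
  have hm : AEMeasurable (fun y ↦ ENNReal.ofReal (g.chartDensity p y))
      (volume.restrict (chartAt (EuclideanSpace ℝ (Fin m)) p).target) :=
    ((g.continuousOn_chartDensity p).aemeasurable
      (chartAt (EuclideanSpace ℝ (Fin m)) p).open_target.measurableSet).ennreal_ofReal
  refine (integral_map (g.aemeasurable_chart_symm p) hf.aestronglyMeasurable).trans ?_
  rw [integral_withDensity_eq_integral_toReal_smul₀ hm
    (Filter.Eventually.of_forall fun y ↦ ENNReal.ofReal_lt_top)]
  refine integral_congr_ae (Filter.Eventually.of_forall fun y ↦ ?_)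
  simp only [smul_eq_mul]
  rw [ENNReal.toReal_ofReal (show 0 ≤ g.chartDensity p y from Real.sqrt_nonneg _)]

end SemiRiemannianMetric

/-! ### The divergence theorem in a vector space -/

section Flat

variable {E : Type*} [NormedAddCommGroup E] [NormedSpace ℝ E] [FiniteDimensional ℝ E]
  [MeasurableSpace E] [BorelSpace E]

/-- The integral of the divergence of a compactly supported vector field vanishes. -/
lemma integral_trace_fderiv_eq_zero (μ : Measure E) [μ.IsAddHaarMeasure] {V : E → E}
    (hV : ContDiff ℝ 1 V) (hc : HasCompactSupport V) :
    ∫ y, LinearMap.trace ℝ E (fderiv ℝ V y).toLinearMap ∂μ = 0 := by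
  set b := Module.finBasis ℝ E
  have htr : ∀ y, LinearMap.trace ℝ E (fderiv ℝ V y).toLinearMap =
      ∑ i, (b.coord i).toContinuousLinearMap (fderiv ℝ V y (b i)) := fun y ↦ by
    rw [LinearMap.trace_eq_matrix_trace ℝ b, Matrix.trace]
    refine Finset.sum_congr rfl fun i _ ↦ ?_
    rw [Matrix.diag_apply, LinearMap.toMatrix_apply]
    rfl
  have hd : Continuous (fderiv ℝ V) := hV.continuous_fderiv (by simp)
  have hcont : ∀ i, Continuous fun y ↦ (b.coord i).toContinuousLinearMap (fderiv ℝ V y (b i)) :=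
    fun i ↦ (b.coord i).toContinuousLinearMap.continuous.comp (hd.clm_apply continuous_const)
  have hint : ∀ i, Integrable (fun y ↦ (b.coord i).toContinuousLinearMap (fderiv ℝ V y (b i))) μ :=
    fun i ↦ (hcont i).integrable_of_hasCompactSupport
      ((hc.fderiv (𝕜 := ℝ)).comp_left (g := fun L : E →L[ℝ] E ↦
        (b.coord i).toContinuousLinearMap (L (b i))) (by simp))
  simp only [htr]
  rw [integral_finsetSum _ fun i _ ↦ hint i]
  refine Finset.sum_eq_zero fun i _ ↦ ?_
  have hF : ∀ y, fderiv ℝ (fun y ↦ (b.coord i).toContinuousLinearMap (V y)) y (b i) =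
      (b.coord i).toContinuousLinearMap (fderiv ℝ V y (b i)) := fun y ↦ by
    have := ((b.coord i).toContinuousLinearMap.hasFDerivAt.comp y
      ((hV.differentiable (by simp)) y).hasFDerivAt).fderiv
    exact congrArg (fun L : E →L[ℝ] ℝ ↦ L (b i)) this
  -- Integration by parts against the constant 1, in one basis direction.
  have h := integral_mul_fderiv_eq_neg_fderiv_mul_of_integrable (μ := μ) (f := fun _ : E ↦ (1 : ℝ))
    (g := fun y ↦ (b.coord i).toContinuousLinearMap (V y)) (v := b i) (by simp)
    (by simpa only [hF, one_mul] using hint i)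
    (by
      simp only [one_mul]
      exact ((b.coord i).toContinuousLinearMap.continuous.comp
        hV.continuous).integrable_of_hasCompactSupport
        (hc.comp_left (g := (b.coord i).toContinuousLinearMap) (by simp)))
    (fun _ _ ↦ differentiableAt_const _)
    (fun y _ ↦ (b.coord i).toContinuousLinearMap.differentiableAt.comp y
      ((hV.differentiable (by simp)) y))
  simpa only [hF, one_mul, fderiv_fun_const, Pi.zero_apply, _root_.zero_apply, zero_mul,
    integral_zero, neg_zero] using h

end Flat

/-! ### The divergence theorem on a manifold -/

namespace SemiRiemannianMetric

variable {m : ℕ} {M : Type*} [TopologicalSpace M] [T2Space M]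
  [ChartedSpace (EuclideanSpace ℝ (Fin m)) M]
  [IsManifold (𝓡 m) ∞ M] (g : SemiRiemannianMetric (𝓡 m) M)
  [MeasurableSpace M] [BorelSpace M] [Nonempty M] [SecondCountableTopology M]
  {Z : Π x : M, TangentSpace (𝓡 m) x}

/-- The divergence theorem for vector fields supported in a chart domain. -/
lemma integral_divergence_eq_zero_of_subset_source (hZ : IsSmoothVectorField (𝓡 m) Z) (p : M) {K : Set M}
    (hK : IsCompact K) (hKp : K ⊆ (chartAt (EuclideanSpace ℝ (Fin m)) p).source)
    (hZK : ∀ x ∉ K, Z x = 0) : ∫ x, g.divergence Z x ∂g.volumeMeasure = 0 := by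
  set χ := chartAt (EuclideanSpace ℝ (Fin m)) p with hχ
  set b := (EuclideanSpace.basisFun (Fin m) ℝ).toBasis
  have hdiv : ∀ x ∉ K, g.divergence Z x = 0 := fun x hx ↦ g.divergence_eq_zero hZ
    (Filter.eventually_of_mem (hK.isClosed.isOpen_compl.mem_nhds hx) hZK)
  rw [g.integral_volumeMeasure p (g.contMDiff_divergence hZ).continuous
    fun x hx ↦ hdiv x fun h ↦ hx (hKp h)]
  set K' := χ '' K with hK'
  have hK'c : IsCompact K' := hK.image_of_continuousOn (χ.continuousOn.mono hKp)
  have hK't : K' ⊆ χ.target := by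
    rintro _ ⟨x, hx, rfl⟩
    exact χ.map_source (hKp hx)
  have htarget : (extChartAt (𝓡 m) p).target = χ.target := extChartAt_euclidean_target p
  -- By `coordDensity_mul_divergence`, density times divergence is the flat divergence of this
  -- field.
  set V₀ : EuclideanSpace ℝ (Fin m) → EuclideanSpace ℝ (Fin m) :=
    fun y ↦ g.coordDensity b p y • chartRep (𝓡 m) p Z y with hV₀
  -- Off the chart target V₀ has no meaning. The cutoff costs no smoothness, since the field already
  -- vanishes off the compact set K'.
  set V := χ.target.indicator V₀ with hV
  have hVK : ∀ y ∉ K', V y = 0 := by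
    intro y hy
    by_cases hyt : y ∈ χ.target
    · have h1 : χ.symm y ∉ K := fun h ↦ hy ⟨_, h, χ.right_inv hyt⟩
      have h2 : chartRep (𝓡 m) p Z y = 0 := by
        rw [chartRep, mpullback_apply]
        have : Z ((extChartAt (𝓡 m) p).symm y) = 0 := hZK _ h1
        rw [this]
        exact map_zero _
      rw [hV, Set.indicator_of_mem hyt, hV₀]
      simp [h2]
    · exact Set.indicator_of_notMem hyt _
  have hev : ∀ y ∈ χ.target, V =ᶠ[nhds y] V₀ := fun y hy ↦
    Filter.eventually_of_mem (χ.open_target.mem_nhds hy) fun z hz ↦ Set.indicator_of_mem hz _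
  have hev' : ∀ y ∉ χ.target, V =ᶠ[nhds y] fun _ ↦ 0 := fun y hy ↦
    Filter.eventually_of_mem (hK'c.isClosed.isOpen_compl.mem_nhds fun h ↦ hy (hK't h)) hVK
  have hd : ∀ y ∈ χ.target, ContDiffAt ℝ ∞ (g.coordDensity b p) y := fun y hy ↦
    g.contDiffAt_coordDensity b p (htarget ▸ hy)
  have hr : ∀ y ∈ χ.target, ContDiffAt ℝ ∞ (chartRep (𝓡 m) p Z) y := fun y hy ↦
    hZ.contDiffAt_chartRep p (htarget ▸ hy)
  have hVs : ContDiff ℝ 1 V := contDiff_iff_contDiffAt.2 fun y ↦ by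
    by_cases hy : y ∈ χ.target
    · exact (((hd y hy).smul (hr y hy)).of_le (by simp)).congr_of_eventuallyEq (hev y hy)
    · exact contDiffAt_const.congr_of_eventuallyEq (hev' y hy)
  have hVc : HasCompactSupport V := HasCompactSupport.intro hK'c hVK
  have hoff : ∀ y ∉ χ.target, LinearMap.trace ℝ (EuclideanSpace ℝ (Fin m))
      (fderiv ℝ V y).toLinearMap = 0 := fun y hy ↦ by
    rw [(hev' y hy).fderiv_eq]; simp
  rw [← integral_trace_fderiv_eq_zero volume hVs hVc,
    ← setIntegral_eq_integral_of_forall_compl_eq_zero hoff]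
  refine setIntegral_congr_fun χ.open_target.measurableSet fun y hy ↦ ?_
  have h1 := g.coordDensity_mul_divergence b hZ p (htarget ▸ hy : y ∈ (extChartAt (𝓡 m) p).target)
  rw [g.chartDensity_eq p hy, (hev y hy).fderiv_eq]
  refine h1.trans ?_
  rw [hV₀, fderiv_fun_smul ((hd y hy).differentiableAt (by simp))
    ((hr y hy).differentiableAt (by simp))]
  have h2 : (g.coordDensity b p y • fderiv ℝ (chartRep (𝓡 m) p Z) y +
      (fderiv ℝ (g.coordDensity b p) y).smulRight (chartRep (𝓡 m) p Z y)).toLinearMap =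
      g.coordDensity b p y • (fderiv ℝ (chartRep (𝓡 m) p Z) y).toLinearMap +
      (fderiv ℝ (g.coordDensity b p) y).toLinearMap.smulRight (chartRep (𝓡 m) p Z y) := rfl
  rw [h2, map_add, map_smul, LinearMap.trace_smulRight, smul_eq_mul, add_comm]
  rfl

lemma divergence_add {Z' : Π x : M, TangentSpace (𝓡 m) x} (hZ : IsSmoothVectorField (𝓡 m) Z)
    (hZ' : IsSmoothVectorField (𝓡 m) Z') (x : M) :
    g.divergence (Z + Z') x = g.divergence Z x + g.divergence Z' x := by
  rw [divergence, g.leviCivita_add (hZ.mdifferentiableAt x) (hZ'.mdifferentiableAt x)]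
  exact map_add _ _ _

/-- The divergence theorem for compactly supported vector fields. -/
lemma integral_divergence_eq_zero (hZ : IsSmoothVectorField (𝓡 m) Z) {K : Set M}
    (hK : IsCompact K) (hZK : ∀ x ∉ K, Z x = 0) :
    ∫ x, g.divergence Z x ∂g.volumeMeasure = 0 := by
  have : LocallyCompactSpace M := ChartedSpace.locallyCompactSpace (EuclideanSpace ℝ (Fin m)) M
  obtain ⟨f, hf⟩ := SmoothPartitionOfUnity.exists_isSubordinate_chartAt_source (𝓡 m) M
  -- Only finitely many functions of the partition meet K, so Z is a finite sum of fields, each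
  -- supported in one chart.
  set F := (f.locallyFinite.finite_nonempty_inter_compact hK).toFinset
  have hsum : ∀ x ∈ K, ∑ i ∈ F, f i x = 1 := fun x hx ↦ by
    rw [← f.sum_eq_one (Set.mem_univ x), finsum_eq_sum_of_support_subset]
    intro i hi
    simp only [F, Set.Finite.coe_toFinset, Set.mem_ofPred_eq]
    exact ⟨x, hi, hx⟩
  have hsm : ∀ i, IsSmoothVectorField (𝓡 m) ((f i : M → ℝ) • Z) := fun i ↦
    hZ.smul (f i).contMDiff
  have hzero : ∀ i, ∀ x ∉ K ∩ tsupport (f i), ((f i : M → ℝ) • Z) x = 0 := by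
    intro i x hx
    by_cases h : x ∈ K
    · have : f i x = 0 := image_eq_zero_of_notMem_tsupport fun h' ↦ hx ⟨h, h'⟩
      simp [this]
    · simp [hZK x h]
  have hcomp : ∀ i, IsCompact (K ∩ tsupport (f i)) := fun i ↦ hK.inter_right (isClosed_tsupport _)
  have key : ∀ s : Finset M, IsSmoothVectorField (𝓡 m) (∑ i ∈ s, (f i : M → ℝ) • Z) ∧
      Integrable (g.divergence (∑ i ∈ s, (f i : M → ℝ) • Z)) g.volumeMeasure ∧
      ∫ x, g.divergence (∑ i ∈ s, (f i : M → ℝ) • Z) x ∂g.volumeMeasure = 0 := by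
    intro s
    classical
    induction s using Finset.induction_on with
    | empty =>
      have h0 : IsSmoothVectorField (𝓡 m) (∑ i ∈ (∅ : Finset M), (f i : M → ℝ) • Z) := by
        simpa using! hZ.const_smul 0
      have h1 : g.divergence (∑ i ∈ (∅ : Finset M), (f i : M → ℝ) • Z) = fun _ ↦ 0 :=
        funext fun x ↦ g.divergence_eq_zero h0 (Filter.Eventually.of_forall fun y ↦ by simp)
      exact ⟨h0, by rw [h1]; exact integrable_zero _ _ _, by rw [h1]; simp⟩
    | insert a s ha ih =>
      obtain ⟨h1, h2, h3⟩ := ih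
      have h4 : g.divergence (∑ i ∈ insert a s, (f i : M → ℝ) • Z) = fun x ↦
          g.divergence ((f a : M → ℝ) • Z) x + g.divergence (∑ i ∈ s, (f i : M → ℝ) • Z) x := by
        ext x
        rw [Finset.sum_insert ha, g.divergence_add (hsm a) h1]
      have h5 : Integrable (g.divergence ((f a : M → ℝ) • Z)) g.volumeMeasure :=
        (g.contMDiff_divergence (hsm a)).continuous.integrable_of_hasCompactSupport
          (HasCompactSupport.intro (hcomp a) fun x hx ↦ g.divergence_eq_zero (hsm a)
            (Filter.eventually_of_mem ((hcomp a).isClosed.isOpen_compl.mem_nhds hx) (hzero a)))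
      refine ⟨by rw [Finset.sum_insert ha]; exact (hsm a).add h1, by rw [h4]; exact h5.add h2, ?_⟩
      rw [h4, integral_add h5 h2, h3, add_zero]
      exact g.integral_divergence_eq_zero_of_subset_source (hsm a) a (hcomp a)
        (Set.inter_subset_right.trans (hf a)) (hzero a)
  have hZF : ∑ i ∈ F, (f i : M → ℝ) • Z = Z := by
    ext1 x
    by_cases h : x ∈ K
    · have := hsum x h
      simp only [Finset.sum_apply, Pi.smul_apply', ← Finset.sum_smul]
      rw [this, one_smul]
    · simp [hZK x h]
  rw [← hZF]
  exact (key F).2.2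

end SemiRiemannianMetric

/-- Differentiation under the integral over a relatively compact set. -/
lemma hasDerivAt_setIntegral {E : Type*} [NormedAddCommGroup E] [NormedSpace ℝ E] {H : Type*}
    [TopologicalSpace H] {I : ModelWithCorners ℝ E H} [I.Boundaryless] {M : Type*}
    [TopologicalSpace M] [ChartedSpace H M] [IsManifold I ∞ M] [MeasurableSpace M] [BorelSpace M]
    (μ : Measure M) [IsLocallyFiniteMeasure μ] [T2Space M] [SecondCountableTopology M]
    {F : ℝ → M → ℝ}
    (hF : ContMDiff (𝓘(ℝ, ℝ).prod I) 𝓘(ℝ, ℝ) ∞ (fun p : ℝ × M ↦ F p.1 p.2)) {D : Set M}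
    (hD : IsCompact (closure D)) (t : ℝ) :
    HasDerivAt (fun s ↦ ∫ x in D, F s x ∂μ) (∫ x in D, deriv (fun s ↦ F s x) t ∂μ) t := by
  have hF' : Continuous fun p : ℝ × M ↦ deriv (fun s ↦ F s p.2) p.1 :=
    (contMDiff_deriv_fst hF).continuous
  have hFc : ∀ s, Continuous (F s) := fun s ↦ hF.continuous.comp (Continuous.prodMk_right s)
  have hF'0 : Continuous fun x ↦ deriv (fun s ↦ F s x) t := hF'.comp (Continuous.prodMk_right t)
  have hDfin : μ D < ⊤ := (measure_mono subset_closure).trans_lt hD.measure_lt_top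
  have : IsFiniteMeasure (μ.restrict D) := ⟨by simpa using hDfin⟩
  -- The dominating function is a constant: the parameter derivative is continuous, hence bounded on
  -- a compact interval times the closure of D.
  obtain ⟨C, hC⟩ := ((isCompact_closedBall t 1).prod hD).exists_bound_of_continuousOn
    hF'.continuousOn
  have hmem : ∀ᵐ x ∂μ.restrict D, x ∈ closure D := by
    have : ∀ᵐ x ∂μ.restrict (closure D), x ∈ closure D :=
      ae_restrict_mem isClosed_closure.measurableSet
    exact Measure.absolutelyContinuous_of_le (Measure.restrict_mono subset_closure le_rfl) this
  have hint : Integrable (F t) (μ.restrict D) :=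
    ((hFc t).continuousOn.integrableOn_compact hD).mono_set subset_closure
  exact (hasDerivAt_integral_of_dominated_loc_of_deriv_le
    (F' := fun s x ↦ deriv (fun s ↦ F s x) s) (bound := fun _ ↦ C)
    (Metric.closedBall_mem_nhds t one_pos)
    (Filter.Eventually.of_forall fun s ↦ (hFc s).aestronglyMeasurable) hint
    hF'0.aestronglyMeasurable
    (hmem.mono fun x hx s hs ↦ hC (s, x) ⟨hs, hx⟩) (integrable_const C)
    (Filter.Eventually.of_forall fun x s _ ↦ hasDerivAt_fst hF s x)).2

/-! ### Variation of the energy and harmonicity of ξ -/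

namespace SemiRiemannianMetric

variable {m : ℕ} {M : Type*} [TopologicalSpace M] [T2Space M]
  [ChartedSpace (EuclideanSpace ℝ (Fin m)) M]
  [IsManifold (𝓡 m) ∞ M] (g : SemiRiemannianMetric (𝓡 m) M)
  [MeasurableSpace M] [BorelSpace M] [Nonempty M] [SecondCountableTopology M]

/-- The first variation of the energy over a relatively compact set. -/
lemma hasDerivAt_energy {U : ℝ → Π x : M, TangentSpace (𝓡 m) x} (hU : IsSmoothFamily U) {D : Set M}
    (hD : IsCompact (closure D)) (t : ℝ) :
    HasDerivAt (fun s ↦ g.energy D (U s))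
      (∫ x in D, deriv (fun s ↦ g.energyDensity (U s) x) t ∂g.volumeMeasure) t :=
  hasDerivAt_setIntegral g.volumeMeasure (F := fun s ↦ g.energyDensity (U s))
    (g.contMDiff_energyDensity hU) hD t

end SemiRiemannianMetric

namespace ParacontactMetricStructure.IsKappaMuSpace

variable {n : ℕ} {M : Type*} [TopologicalSpace M] [T2Space M]
  [ChartedSpace (EuclideanSpace ℝ (Fin (2 * n + 1))) M] [IsManifold (𝓡 (2 * n + 1)) ∞ M]
  [MeasurableSpace M] [BorelSpace M] [Nonempty M] [SecondCountableTopology M]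
  {S : ParacontactMetricStructure n M} {κ μ : M → ℝ} (hS : S.IsKappaMuSpace κ μ)
include hS

/-- The Reeb vector field of a `(κ, μ)`-space is harmonic. -/
lemma isHarmonicVectorField_ξ : S.g.IsHarmonicVectorField S.ξ := by
  refine ⟨S.contMDiff_ξ, 1, one_ne_zero, S.inner_ξ_ξ, fun D _ hD U hU ↦ ?_⟩
  have hUs : SemiRiemannianMetric.IsSmoothFamily U := hU.contMDiff
  obtain ⟨K, hK, hKD, hUK⟩ := hU.support
  set W := S.g.velocity U 0
  have hW : IsSmoothVectorField (𝓡 (2 * n + 1)) W := S.g.isSmoothVectorField_velocity hUs 0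
  -- The squared length is constant along the variation, so its derivative at 0 vanishes.
  have hWξ : ∀ x, S.g.inner x (S.ξ x) (W x) = 0 := fun x ↦ by
    have h1 := S.g.hasDerivAt_inner_self_family hUs 0 x
    simp only [hU.inner_self, hU.zero] at h1
    have := h1.unique (hasDerivAt_const 0 1)
    simpa using this
  have hWK : ∀ x ∉ K, W x = 0 := fun x hx ↦
    S.g.velocity_eq_zero hUs (fun s ↦ hUK s x hx) 0
  have hZ := S.isSmoothAdjointPair_nablaξ.smooth_right hW
  have hZK : ∀ x ∉ K, (S.nablaξ x + (2 : ℝ) • S.φ x) (W x) = 0 := fun x hx ↦ by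
    rw [hWK x hx, map_zero]
  -- No condition on κ enters: the first variation is a divergence on every (κ, μ)-space.
  have hderiv : ∀ x, deriv (fun s ↦ S.g.energyDensity (U s) x) 0 =
      S.g.divergence (fun x ↦ (S.nablaξ x + (2 : ℝ) • S.φ x) (W x)) x := fun x ↦ by
    rw [(S.g.hasDerivAt_energyDensity hUs 0 x).deriv, hU.zero]
    exact hS.sum_inner_leviCivita_eq_trace hW (hWξ x)
  refine (S.g.hasDerivAt_energy hUs hD 0).congr_deriv ?_
  simp only [hderiv]
  -- The divergence vanishes off K, hence off D, so the integral over D is one over M.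
  rw [setIntegral_eq_integral_of_forall_compl_eq_zero, S.g.integral_divergence_eq_zero hZ hK hZK]
  intro x hx
  exact S.g.divergence_eq_zero hZ
    (Filter.eventually_of_mem (hK.isClosed.isOpen_compl.mem_nhds fun h ↦ hx (hKD h)) hZK)

end ParacontactMetricStructure.IsKappaMuSpace

end

theorem corollary5p2 {n : ℕ} (hn : 1 ≤ n) {M : Type*} [TopologicalSpace M] [T2Space M]
    [SecondCountableTopology M] [ConnectedSpace M] [MeasurableSpace M] [BorelSpace M]
    [ChartedSpace (EuclideanSpace ℝ (Fin (2 * n + 1))) M] [IsManifold (𝓡 (2 * n + 1)) ∞ M]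
    (S : ParacontactMetricStructure n M) (κ μ : M → ℝ) (hS : S.IsKappaMuSpace κ μ) :
    (S.g.IsInfinitesimalHarmonicTransformation S.ξ ↔ ∀ x, κ x = -1) ∧
      ((¬ ∀ x, κ x = -1) →
        S.g.IsHarmonicVectorField S.ξ ∧ ¬ S.g.IsOneHarmonic S.ξ) := by
  have h := hS.isInfinitesimalHarmonicTransformation_iff hn
  exact ⟨h, fun hκ ↦ ⟨hS.isHarmonicVectorField_ξ, fun h1 ↦ hκ (h.1 h1)⟩⟩
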